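/- Let $\mathcal M$ be a unital $C^*$-algebra with a continuous action $G\times\mathcal M\to\mathcal M$, $(t,x)\mapsto t\cdot x$, by $*$-automorphisms of a metrizable locally compact abelian group $G$. Let $\widehat{\mathcal M}$ be the spectrum of $\mathcal M$ (unitary equivalence classes of irreducible $*$-representations, with the hull-kernel topology), on which $G$ acts by $[\pi]\cdot t=[a\mapsto\pi(t\cdot a)]$. For a $C^*$-algebra $\mathcal A$ put $\mathcal A^1=\mathcal A$ if $\mathcal A$ is unital, and let $\mathcal A^1=\mathbb C\mathbf 1\oplus\mathcal A$ be its unitization otherwise. Let $G\ltimes\mathcal M$ be the (full) crossed product. Assume the following. (i) $Y\subseteq\widehat{\mathcal M}$ is an open $G$-invariant subset which is metrizable (hence Hausdorff) in the relative topology; the action of $G$ on $Y$ is proper, i.e. for every compact $K\subseteq Y$ the set $\{t\in G\mid (K\cdot t)\cap K\neq\emptyset\}$ is compact; and the orbit space $Y/G$ is compact. (ii) The closed two-sided $G$-invariant ideal $\mathcal J\subseteq\mathcal M$ with $\widehat{\mathcal J}=Y$, i.e. $Y=\{[\pi]\in\widehat{\mathcal M}\mid \pi(\mathcal J)\ne\{0\}\}$,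 has no unit element and is $*$-isomorphic to $\mathcal C_0(Y,\mathcal K(\mathcal H_0))$ for some separable complex Hilbert space $\mathcal H_0$, where $\mathcal K(\mathcal H_0)$ denotes the compact operators. For $y\in Y$ let $\pi_y\colon\mathcal M\to\mathcal B(\mathcal H_0)$ be an irreducible $*$-representation with $[\pi_y]=y$, and let $\Pi_y\colon (G\ltimes\mathcal M)^1\to\mathcal B(L^2(G,\mathcal H_0))$ be the unital extension of the $\pi_y$-regular representation of $G\ltimes\mathcal M$, which is given for $f\in\mathcal C_c(G,\mathcal M)$ and $\varphi\in L^2(G,\mathcal H_0)$ by $$(\Pi_y(f)\varphi)(t)=\int_G\pi_y(t^{-1}\cdot f(s))\,\varphi(s^{-1}t)\,ds .$$ Let $v\in(G\ltimes\mathcal M)^1$ be such that (iii) $vv^*,\ v^*v\in\mathbf 1+(G\ltimes\mathcal J)\subseteq(G\ltimes\mathcal M)^1$; (iv) for every $y\in Y$ the operator $\Pi_y(v)$ is injective and has closed range, but is not surjective. Then $v^*v$ is invertible, and $v(v^*v)^{-1/2}\in(G\ltimes\mathcal M)^1$ is a nonunitary isometry. -/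

import Mathlib

open MeasureTheory TopologicalSpace Filter
open scoped ENNReal CompactlySupported ZeroAtInfty

universe u v

set_option linter.unusedSectionVars false

noncomputable section

section CompactOperators

variable (H : Type v) [NormedAddCommGroup H] [InnerProductSpace ℂ H] [CompleteSpace H]

variable {H} in
theorem IsCompactOperator.adjoint_of_hilbert {T : H →L[ℂ] H} (hT : IsCompactOperator T) :
    IsCompactOperator (star T : H →L[ℂ] H) := by
  have hS : IsCompactOperator (T * star T : H →L[ℂ] H) := hT.comp_clm (star T)
  refine (isCompactOperator_iff_isCompact_closure_image_closedBall
    (star T : H →L[ℂ] H).toLinearMap one_pos).2 ?_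
  have hS' := hS.image_closedBall_subset_compact (f := (T * star T : H →L[ℂ] H).toLinearMap) 1
  obtain ⟨K, hK, hSK⟩ := hS'
  have htb := hK.totallyBounded.subset hSK
  refine TotallyBounded.isCompact_of_isClosed (TotallyBounded.closure ?_) isClosed_closure
  rw [Metric.totallyBounded_iff]
  intro ε hε
  obtain ⟨t', ht's, ht'f, htc⟩ := Set.exists_subset_image_finite_and.1
    (Metric.finite_approx_of_totallyBounded htb (ε ^ 2 / 2) (by positivity))
  refine ⟨(star T : H →L[ℂ] H) '' t', ht'f.image _, ?_⟩
  rintro _ ⟨x, hx, rfl⟩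
  obtain ⟨y, hy, hxy⟩ : ∃ y ∈ t', dist (T (star T x)) (T (star T y)) < ε ^ 2 / 2 := by
    have := htc (Set.mem_image_of_mem _ hx)
    simpa using this
  simp only [Set.mem_iUnion]
  refine ⟨star T y, Set.mem_image_of_mem _ hy, ?_⟩
  rw [Metric.mem_ball]
  have hx1 : ‖x‖ ≤ 1 := by simpa using hx
  have hy1 : ‖y‖ ≤ 1 := by simpa using ht's hy
  have h2 : ‖x - y‖ ≤ 2 := (norm_sub_le _ _).trans (by linarith)
  have key : ‖(star T : H →L[ℂ] H) (x - y)‖ ^ 2 ≤ ‖x - y‖ * ‖T (star T (x - y))‖ := by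
    have h := norm_inner_le_norm (𝕜 := ℂ) (x - y) (T (star T (x - y)))
    rw [ContinuousLinearMap.star_eq_adjoint, ← ContinuousLinearMap.adjoint_inner_left,
      inner_self_eq_norm_sq_to_K, ← ContinuousLinearMap.star_eq_adjoint] at h
    simpa using h
  have h3 : ‖T (star T (x - y))‖ < ε ^ 2 / 2 := by
    rw [dist_eq_norm] at hxy
    simpa using hxy
  have h4 : ‖(star T : H →L[ℂ] H) (x - y)‖ ^ 2 < ε ^ 2 := by
    nlinarith [norm_nonneg (x - y), norm_nonneg (T (star T (x - y)))]
  have := lt_of_pow_lt_pow_left₀ 2 hε.le h4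
  rw [map_sub] at this
  rw [dist_eq_norm]
  exact this

/-- The algebra of compact operators on a complex Hilbert space `H`. -/
def compactOperators : NonUnitalStarSubalgebra ℂ (H →L[ℂ] H) where
  carrier := {T | IsCompactOperator T}
  add_mem' hf hg := hf.add hg
  zero_mem' := isCompactOperator_zero
  mul_mem' {_ g} hf _ := hf.comp_clm g
  smul_mem' c _ hf := hf.smul c
  star_mem' hf := IsCompactOperator.adjoint_of_hilbert hf

instance : IsClosed (compactOperators H : Set (H →L[ℂ] H)) :=
  isClosed_setOfPred_isCompactOperator

end CompactOperators

section Spectrum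

/-- A (unital) `*`-representation on a Hilbert space is irreducible if the Hilbert space is nonzero
and the only closed invariant subspaces are the trivial ones. -/
def IsIrreducibleRep {A : Type*} [CStarAlgebra A] {H : Type*} [NormedAddCommGroup H]
    [InnerProductSpace ℂ H] [CompleteSpace H] (π : A →⋆ₐ[ℂ] (H →L[ℂ] H)) : Prop :=
  Nontrivial H ∧ ∀ p : Submodule ℂ H, IsClosed (p : Set H) →
    (∀ a : A, ∀ x ∈ p, π a x ∈ p) → p = ⊥ ∨ p = ⊤

/-- An irreducible `*`-representation of `A`. Every irreducible representation is unitarily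
equivalent to a GNS representation, so Hilbert spaces in the universe of `A` suffice. -/
structure IrrepOf (A : Type v) [CStarAlgebra A] where
  H : Type v
  [normed : NormedAddCommGroup H]
  [inner : InnerProductSpace ℂ H]
  [complete : CompleteSpace H]
  rep : A →⋆ₐ[ℂ] (H →L[ℂ] H)
  irreducible : IsIrreducibleRep rep

attribute [instance] IrrepOf.normed IrrepOf.inner IrrepOf.complete

variable (A : Type v) [CStarAlgebra A]

/-- Unitary equivalence of irreducible representations. -/
instance IrrepOf.setoid : Setoid (IrrepOf A) where
  r σ τ := ∃ W : σ.H ≃ₗᵢ[ℂ] τ.H, ∀ (a : A) (x : σ.H), W (σ.rep a x) = τ.rep a (W x)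
  iseqv :=
    { refl := fun _ => ⟨LinearIsometryEquiv.refl ℂ _, fun _ _ => rfl⟩
      symm := fun ⟨W, hW⟩ => ⟨W.symm, fun a x => by
        rw [LinearIsometryEquiv.symm_apply_eq, hW, W.apply_symm_apply]⟩
      trans := fun ⟨W, hW⟩ ⟨V, hV⟩ => ⟨W.trans V, fun a x => by
        simp [hW, hV]⟩ }

/-- The spectrum `Â` of a unital `C*`-algebra: the set of unitary equivalence classes of
irreducible `*`-representations. -/
def CStarSpectrum : Type (v + 1) := Quotient (IrrepOf.setoid A)

namespace CStarSpectrum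

variable {A}

/-- The class `[π]` of an irreducible representation. -/
def mk {H : Type v} [NormedAddCommGroup H] [InnerProductSpace ℂ H] [CompleteSpace H]
    (π : A →⋆ₐ[ℂ] (H →L[ℂ] H)) (hπ : IsIrreducibleRep π) : CStarSpectrum A :=
  Quotient.mk (IrrepOf.setoid A) ⟨H, π, hπ⟩

/-- The set of all classes `[π]` such that `π` does not vanish identically on `S`. If `S = J` is a
closed two-sided ideal, this is the usual copy of the spectrum of `J` in the spectrum of `A`. -/
def nonvanishing (S : Set A) : Set (CStarSpectrum A) :=
  {x | Quotient.lift (fun σ : IrrepOf A => ∃ a ∈ S, σ.rep a ≠ 0) (by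
    rintro σ τ ⟨W, hW⟩
    refine propext (exists_congr fun a => and_congr_right fun _ => not_congr ?_)
    constructor
    · intro h
      ext x
      have := hW a (W.symm x)
      rw [h] at this
      simpa using this.symm
    · intro h
      ext x
      have := hW a x
      rw [h] at this
      simpa using this) x}

theorem mem_nonvanishing (S : Set A) (σ : IrrepOf A) :
    (Quotient.mk (IrrepOf.setoid A) σ : CStarSpectrum A) ∈ nonvanishing S ↔ ∃ a ∈ S, σ.rep a ≠ 0 :=
  Iff.rfl

theorem exists_mul_mul_ne_zero (σ : IrrepOf A) {a b : A} (ha : σ.rep a ≠ 0) (hb : σ.rep b ≠ 0) :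
    ∃ c : A, σ.rep (a * c * b) ≠ 0 := by
  by_contra! h
  obtain ⟨ξ, hξ⟩ : ∃ ξ, σ.rep b ξ ≠ 0 := by
    by_contra! h'
    exact hb (by ext x; simpa using h' x)
  let p : Submodule ℂ σ.H :=
    ⨅ c : A, LinearMap.ker ((σ.rep (a * c) : σ.H →L[ℂ] σ.H) : σ.H →ₗ[ℂ] σ.H)
  have hmem : ∀ x, x ∈ p ↔ ∀ c : A, σ.rep (a * c) x = 0 := fun x => by
    simp [p, Submodule.mem_iInf]
  have hclosed : IsClosed (p : Set σ.H) := by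
    have : (p : Set σ.H) = ⋂ c : A, {x | σ.rep (a * c) x = 0} := by
      ext x
      simp [hmem]
    rw [this]
    exact isClosed_iInter fun c => isClosed_eq (σ.rep (a * c)).continuous continuous_const
  rcases σ.irreducible.2 p hclosed (fun d x hx => (hmem _).2 fun c => by
    have := (hmem x).1 hx (c * d)
    rw [← mul_assoc, map_mul] at this
    exact this) with hp | hp
  · have : σ.rep b ξ ∈ p := (hmem _).2 fun c => by
      have := h c
      rw [map_mul] at this
      exact congrArg (fun T : σ.H →L[ℂ] σ.H => T ξ) this
    rw [hp] at this
    exact hξ (by simpa using this)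
  · refine ha ?_
    ext x
    have hx : x ∈ p := by rw [hp]; trivial
    simpa using (hmem x).1 hx 1

/-- The usual (hull-kernel) topology of the spectrum: the open sets are the sets
`{[π] | π(I) ≠ 0}` with `I` a two-sided ideal. (Replacing `I` by its closure does not change
the set.) -/
instance : TopologicalSpace (CStarSpectrum A) where
  IsOpen U := ∃ I : TwoSidedIdeal A, U = nonvanishing (I : Set A)
  isOpen_univ := by
    refine ⟨⊤, (Set.eq_univ_of_forall ?_).symm⟩
    rintro ⟨σ⟩
    have := σ.irreducible.1
    exact ⟨1, trivial, by rw [map_one]; exact one_ne_zero⟩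
  isOpen_inter := by
    rintro _ _ ⟨I, rfl⟩ ⟨J, rfl⟩
    refine ⟨I ⊓ J, Set.ext ?_⟩
    rintro ⟨σ⟩
    constructor
    · rintro ⟨⟨a, ha, ha'⟩, ⟨b, hb, hb'⟩⟩
      obtain ⟨c, hc⟩ := exists_mul_mul_ne_zero σ ha' hb'
      exact ⟨a * c * b, (TwoSidedIdeal.mem_inf A).2 ⟨I.mul_mem_right _ _ (I.mul_mem_right _ _ ha),
        J.mul_mem_left _ _ hb⟩, hc⟩
    · rintro ⟨a, ha, ha'⟩
      exact ⟨⟨a, ((TwoSidedIdeal.mem_inf A).1 ha).1, ha'⟩, ⟨a, ((TwoSidedIdeal.mem_inf A).1 ha).2, ha'⟩⟩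
  isOpen_sUnion := by
    intro S hS
    refine ⟨sSup {I : TwoSidedIdeal A | nonvanishing (I : Set A) ∈ S}, Set.ext ?_⟩
    rintro ⟨σ⟩
    constructor
    · rintro ⟨U, hU, hσ⟩
      obtain ⟨I, rfl⟩ := hS U hU
      obtain ⟨a, ha, ha'⟩ := hσ
      have hle : I ≤ sSup {I : TwoSidedIdeal A | nonvanishing (I : Set A) ∈ S} := le_sSup hU
      exact ⟨a, hle ha, ha'⟩
    · rintro ⟨a, ha, ha'⟩
      by_contra hn
      have hle : sSup {I : TwoSidedIdeal A | nonvanishing (I : Set A) ∈ S} ≤ TwoSidedIdeal.ker σ.rep := by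
        refine sSup_le fun I hI b hb => ?_
        rw [TwoSidedIdeal.mem_ker]
        by_contra hb'
        exact hn ⟨_, hI, b, hb, hb'⟩
      exact ha' ((TwoSidedIdeal.mem_ker _).1 (hle ha))

end CStarSpectrum

end Spectrum

section Dynamics

/-- The action of `G` on `A` commutes with the involution. -/
class StarSMul (G A : Type*) [SMul G A] [Star A] : Prop where
  smul_star : ∀ (t : G) (a : A), t • star a = star (t • a)

variable {G : Type u} {A : Type v} [CStarAlgebra A]

/-- The `*`-automorphism `a ↦ t • a` as a `*`-homomorphism. -/
def actionHom [Group G] [MulSemiringAction G A] [SMulCommClass G ℂ A] [StarSMul G A] (t : G) :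
    A →⋆ₐ[ℂ] A where
  toFun a := t • a
  map_one' := smul_one t
  map_mul' := smul_mul' t
  map_zero' := smul_zero t
  map_add' := smul_add t
  commutes' z := by rw [Algebra.algebraMap_eq_smul_one, smul_comm, smul_one]
  map_star' a := StarSMul.smul_star t a

variable [CommGroup G] [MulSemiringAction G A] [SMulCommClass G ℂ A] [StarSMul G A]

theorem IsIrreducibleRep.comp_actionHom {H : Type*} [NormedAddCommGroup H]
    [InnerProductSpace ℂ H] [CompleteSpace H] {π : A →⋆ₐ[ℂ] (H →L[ℂ] H)}
    (hπ : IsIrreducibleRep π) (t : G) : IsIrreducibleRep (π.comp (actionHom t)) := by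
  refine ⟨hπ.1, fun p hp hinv => hπ.2 p hp fun a x hx => ?_⟩
  have := hinv (t⁻¹ • a) x hx
  simpa [actionHom] using this

/-- The action of the abelian group `G` on the spectrum of `A`: `t • [π] = [π ∘ (a ↦ t • a)]`
(written `[π] · t` as a right action). -/
instance : MulAction G (CStarSpectrum A) where
  smul t := Quotient.map (sa := IrrepOf.setoid A) (sb := IrrepOf.setoid A)
    (fun σ => ⟨σ.H, σ.rep.comp (actionHom t), σ.irreducible.comp_actionHom t⟩)
    (fun _ _ ⟨W, hW⟩ => ⟨W, fun a x => hW (t • a) x⟩)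
  one_smul := by
    rintro ⟨σ⟩
    refine Quotient.sound ⟨LinearIsometryEquiv.refl ℂ _, fun a x => ?_⟩
    change σ.rep ((1 : G) • a) x = σ.rep a x
    rw [one_smul]
  mul_smul := by
    rintro s t ⟨σ⟩
    refine Quotient.sound ⟨LinearIsometryEquiv.refl ℂ _, fun a x => ?_⟩
    change σ.rep ((s * t) • a) x = σ.rep (t • s • a) x
    rw [mul_comm, mul_smul]

/-- Proper actions: for every compact set `K` the set `{t | t • K ∩ K ≠ ∅}` is compact. -/
def IsProperAction (G Y : Type*) [TopologicalSpace G] [TopologicalSpace Y] [SMul G Y] : Prop :=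
  ∀ K : Set Y, IsCompact K → IsCompact {t : G | ∃ y ∈ K, t • y ∈ K}

end Dynamics

section CrossedProduct

variable (G : Type u) (A : Type v) [Group G] [TopologicalSpace G] [IsTopologicalGroup G]
  [CStarAlgebra A] [MulSemiringAction G A]

/-- A nonzero covariant representation of the dynamical system `(A, G)`: a nondegenerate (that is,
unital) `*`-representation of `A` and a strongly continuous unitary representation of `G`, on the
same Hilbert space, which satisfy the covariance relation. -/
structure CovariantRep where
  H : Type (max u v)
  [normed : NormedAddCommGroup H]
  [inner : InnerProductSpace ℂ H]
  [complete : CompleteSpace H]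
  [nontriv : Nontrivial H]
  rep : A →⋆ₐ[ℂ] (H →L[ℂ] H)
  U : G →* (H ≃ₗᵢ[ℂ] H)
  continuous_U : ∀ ξ : H, Continuous fun t => U t ξ
  covariant : ∀ (t : G) (a : A) (ξ : H), U t (rep a ξ) = rep (t • a) (U t ξ)

attribute [instance] CovariantRep.normed CovariantRep.inner CovariantRep.complete
  CovariantRep.nontriv

variable {G A} [LocallyCompactSpace G] [MeasurableSpace G] [BorelSpace G]

namespace CovariantRep

theorem norm_rep_le (R : CovariantRep G A) (a : A) : ‖R.rep a‖ ≤ ‖a‖ :=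
  NonUnitalStarAlgHom.norm_apply_le R.rep a

theorem continuous_integrand (R : CovariantRep G A) (f : C_c(G, A)) (ξ : R.H) :
    Continuous fun s => R.rep (f s) (R.U s ξ) := by
  have h : Continuous R.rep :=
    AddMonoidHomClass.continuous_of_bound R.rep 1 fun a => by simpa using R.norm_rep_le a
  exact (h.comp f.continuous).clm_apply (R.continuous_U ξ)

theorem integrable_integrand (R : CovariantRep G A) (f : C_c(G, A)) (ξ : R.H) :
    Integrable (fun s => R.rep (f s) (R.U s ξ)) (Measure.haar : Measure G) := by
  refine (R.continuous_integrand f ξ).integrable_of_hasCompactSupport ?_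
  refine f.hasCompactSupport.mono fun s hs => ?_
  contrapose! hs
  simp only [Function.mem_support, not_not] at hs ⊢
  simp [hs]

theorem norm_integral_le (R : CovariantRep G A) (f : C_c(G, A)) (ξ : R.H) :
    ‖∫ s, R.rep (f s) (R.U s ξ) ∂(Measure.haar : Measure G)‖ ≤
      (∫ s, ‖f s‖ ∂(Measure.haar : Measure G)) * ‖ξ‖ := by
  rw [← integral_mul_const]
  refine norm_integral_le_of_norm_le ?_ (Eventually.of_forall fun s => ?_)
  · exact (f.continuous.norm.integrable_of_hasCompactSupport f.hasCompactSupport.norm).mul_const _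
  · refine ((R.rep (f s)).le_opNorm _).trans ?_
    rw [LinearIsometryEquiv.norm_map]
    exact mul_le_mul_of_nonneg_right (R.norm_rep_le _) (norm_nonneg _)

/-- The integrated form of a covariant representation on `C_c(G, A)`:
`ξ ↦ ∫ rep (f s) (U s ξ) ds`, with `ds` the Haar measure of `G`. -/
def integrated (R : CovariantRep G A) (f : C_c(G, A)) : R.H →L[ℂ] R.H :=
  LinearMap.mkContinuous
    { toFun := fun ξ => ∫ s, R.rep (f s) (R.U s ξ) ∂(Measure.haar : Measure G)
      map_add' := fun ξ η => by
        simp only [map_add]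
        exact integral_add (R.integrable_integrand f ξ) (R.integrable_integrand f η)
      map_smul' := fun c ξ => by
        simp only [map_smul, RingHom.id_apply]
        exact integral_smul c _ }
    (∫ s, ‖f s‖ ∂(Measure.haar : Measure G)) (R.norm_integral_le f)

theorem norm_integrated_le (R : CovariantRep G A) (f : C_c(G, A)) :
    ‖R.integrated f‖ ≤ ∫ s, ‖f s‖ ∂(Measure.haar : Measure G) :=
  LinearMap.mkContinuous_norm_le _ (integral_nonneg fun _ => norm_nonneg _) _

end CovariantRep

variable (G A) in
/-- The `C*`-algebra of bounded families of operators indexed by all covariant representations,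
with the supremum norm. Every covariant representation of a larger size is a direct sum of cyclic
ones, which are unitarily equivalent to members of the index family. -/
abbrev CovariantFamilies : Type _ := lp (fun R : CovariantRep G A => R.H →L[ℂ] R.H) ∞

variable (G A) in
instance : CStarAlgebra (CovariantFamilies G A) where

/-- The image of `f ∈ C_c(G, A)` in the universal representation. Its norm is the universal norm
of `f`, the supremum of the norms of `f` in all covariant representations. -/
def universalRep (f : C_c(G, A)) : CovariantFamilies G A :=
  ⟨fun R => R.integrated f, memℓp_infty ⟨∫ s, ‖f s‖ ∂(Measure.haar : Measure G), by
    rintro _ ⟨R, rfl⟩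
    exact R.norm_integrated_le f⟩⟩

variable (G) in
/-- For a closed `G`-invariant two-sided ideal `J` of `A`, the crossed product `G ⋉ J`, realized as
a closed ideal of `G ⋉ A`: the closure, for the universal norm, of the `*`-algebra of the
functions in `C_c(G, A)` with values in `J`. -/
def crossedProductOf (J : NonUnitalStarSubalgebra ℂ A) :
    NonUnitalStarSubalgebra ℂ (CovariantFamilies G A) :=
  (NonUnitalStarAlgebra.adjoin ℂ
    {x | ∃ f : C_c(G, A), (∀ s, f s ∈ J) ∧ universalRep f = x}).topologicalClosure

variable (G A) in
/-- The crossed product `G ⋉ A`, the completion of `C_c(G, A)` in the universal norm. -/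
def crossedProduct : NonUnitalStarSubalgebra ℂ (CovariantFamilies G A) :=
  crossedProductOf G (⊤ : NonUnitalStarSubalgebra ℂ A)

/-- `ℂ1 + B`, for a `*`-subalgebra `B` of a unital algebra. -/
def NonUnitalStarSubalgebra.addScalars {B : Type*} [CStarAlgebra B]
    (S : NonUnitalStarSubalgebra ℂ B) : StarSubalgebra ℂ B where
  carrier := {x | ∃ (z : ℂ) (b : B), b ∈ S ∧ x = algebraMap ℂ B z + b}
  mul_mem' := by
    rintro _ _ ⟨z, b, hb, rfl⟩ ⟨w, c, hc, rfl⟩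
    refine ⟨z * w, z • c + w • b + b * c, ?_, ?_⟩
    · exact add_mem (add_mem (SMulMemClass.smul_mem z hc) (SMulMemClass.smul_mem w hb)) (mul_mem hb hc)
    · simp only [Algebra.algebraMap_eq_smul_one, mul_add, add_mul, smul_mul_assoc, one_mul,
        mul_smul_comm, mul_one, smul_add, smul_smul, mul_comm w z]
      abel
  add_mem' := by
    rintro _ _ ⟨z, b, hb, rfl⟩ ⟨w, c, hc, rfl⟩
    refine ⟨z + w, b + c, add_mem hb hc, ?_⟩
    rw [map_add]
    abel
  algebraMap_mem' z := ⟨z, 0, zero_mem S, by simp⟩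
  star_mem' := by
    rintro _ ⟨z, b, hb, rfl⟩
    exact ⟨star z, star b, star_mem hb, by rw [star_add, algebraMap_star_comm]⟩

theorem NonUnitalStarSubalgebra.isClosed_addScalars {B : Type*} [CStarAlgebra B]
    (S : NonUnitalStarSubalgebra ℂ B) (hS : IsClosed (S : Set B)) :
    IsClosed (S.addScalars : Set B) := by
  have h := Submodule.isClosed_sup_finiteDimensional S.toSubmodule (ℂ ∙ (1 : B)) hS
  convert h using 1
  ext x
  simp only [SetLike.mem_coe, Submodule.mem_sup, Submodule.mem_span_singleton]
  constructor
  · rintro ⟨z, b, hb, rfl⟩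
    exact ⟨b, hb, _, ⟨z, rfl⟩, by rw [Algebra.algebraMap_eq_smul_one, add_comm]⟩
  · rintro ⟨b, hb, _, ⟨z, rfl⟩, rfl⟩
    exact ⟨z, b, hb, by rw [Algebra.algebraMap_eq_smul_one, add_comm]⟩

variable (G A) in
/-- `(G ⋉ A)¹`, realized as `ℂ1 + G ⋉ A`, where `1` is the identity operator in every covariant
representation. If `G ⋉ A` is unital, its unit is this `1`, so that `(G ⋉ A)¹ = G ⋉ A`; otherwise
this is the unitization of `G ⋉ A`. -/
def crossedProductUnitization : StarSubalgebra ℂ (CovariantFamilies G A) :=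
  (crossedProduct G A).addScalars

instance : IsClosed (crossedProductUnitization G A : Set (CovariantFamilies G A)) :=
  NonUnitalStarSubalgebra.isClosed_addScalars _
    (NonUnitalStarSubalgebra.isClosed_topologicalClosure _)

/-- The canonical (unital) extension of the integrated form of a covariant representation to
`(G ⋉ A)¹`. -/
def CovariantRep.extend (R : CovariantRep G A) :
    crossedProductUnitization G A →⋆ₐ[ℂ] (R.H →L[ℂ] R.H) where
  toFun v := (v : CovariantFamilies G A) R
  map_one' := rfl
  map_mul' _ _ := rfl
  map_zero' := rfl
  map_add' _ _ := rfl
  commutes' _ := rfl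
  map_star' _ := rfl

end CrossedProduct

section RegularRep

variable {G : Type u} {A : Type v} [Group G] [TopologicalSpace G] [IsTopologicalGroup G]
  [T2Space G] [LocallyCompactSpace G] [MeasurableSpace G] [BorelSpace G]
  {H : Type v} [NormedAddCommGroup H] [InnerProductSpace ℂ H] [CompleteSpace H]

variable (G H) in
/-- `L²(G, H)` for the Haar measure of `G`. -/
abbrev L2Haar : Type (max u v) := Lp H 2 (Measure.haar : Measure G)

theorem Continuous.aestronglyMeasurable_restrict_of_measure_ne_top {E : Type*}
    [TopologicalSpace E] [PseudoMetrizableSpace E] {F : G → E}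
    (hF : Continuous F) {s : Set G} (hs : MeasurableSet s)
    (hs' : (Measure.haar : Measure G) s ≠ ∞) :
    AEStronglyMeasurable F ((Measure.haar : Measure G).restrict s) := by
  have h : ∀ n : ℕ, ∃ K ⊆ s, IsCompact K ∧
      (Measure.haar : Measure G) (s \ K) < ((n : ℝ≥0∞) + 1)⁻¹ := fun n =>
    hs.exists_isCompact_sdiff_lt hs' (by simp)
  choose K hKs hKc hK using h
  have h1 : AEStronglyMeasurable F ((Measure.haar : Measure G).restrict (⋃ n, K n)) :=
    aestronglyMeasurable_iUnion_iff.2 fun n =>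
      hF.continuousOn.aestronglyMeasurable_of_isCompact (hKc n) (hKc n).measurableSet
  have h2 : (⋃ n, K n) =ᵐ[(Measure.haar : Measure G)] s := by
    refine (LE.le.eventuallyLE (Set.iUnion_subset hKs)).antisymm ?_
    rw [ae_le_set]
    refine le_antisymm (ge_of_tendsto' (x := atTop)
      (f := fun n : ℕ => ((n : ℝ≥0∞) + 1)⁻¹) ?_ fun n => ?_) bot_le
    · have := (tendsto_add_atTop_iff_nat 1).2 ENNReal.tendsto_inv_nat_nhds_zero
      simpa using this
    · exact (measure_mono (Set.sdiff_subset_sdiff_right (Set.subset_iUnion K n))).trans (hK n).le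
  rwa [Measure.restrict_congr_set h2] at h1

theorem aestronglyMeasurable_clm_apply {F : G → H →L[ℂ] H} (hF : Continuous F) (φ : L2Haar G H) :
    AEStronglyMeasurable (fun t => F t (φ t)) (Measure.haar : Measure G) := by
  obtain ⟨t, ht, h0, hσ⟩ :=
    (Lp.finStronglyMeasurable φ two_ne_zero ENNReal.ofNat_ne_top).exists_set_sigmaFinite
  have h1 : AEStronglyMeasurable F ((Measure.haar : Measure G).restrict t) := by
    have hU : t = ⋃ n, t ∩ spanningSets ((Measure.haar : Measure G).restrict t) n := by
      rw [← Set.inter_iUnion, iUnion_spanningSets, Set.inter_univ]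
    rw [hU]
    refine aestronglyMeasurable_iUnion_iff.2 fun n => ?_
    refine hF.aestronglyMeasurable_restrict_of_measure_ne_top
      (ht.inter (measurableSet_spanningSets _ n)) ?_
    have := measure_spanningSets_lt_top ((Measure.haar : Measure G).restrict t) n
    rw [Measure.restrict_apply (measurableSet_spanningSets _ n), Set.inter_comm] at this
    exact this.ne
  have h2 : AEStronglyMeasurable (fun x => F x (φ x)) ((Measure.haar : Measure G).restrict t) :=
    Continuous.comp_aestronglyMeasurable (g := fun p : (H →L[ℂ] H) × H => p.1 p.2) (by fun_prop)
      (h1.prodMk (Lp.aestronglyMeasurable φ).restrict)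
  rw [← aestronglyMeasurable_indicator_iff ht] at h2
  convert h2 using 1
  ext x
  by_cases hx : x ∈ t
  · simp [hx]
  · simp [hx, h0 x hx]

theorem memLp_clm_apply {F : G → H →L[ℂ] H} (hF : Continuous F) {C : ℝ} (hC : ∀ t, ‖F t‖ ≤ C)
    (φ : L2Haar G H) : MemLp (fun t => F t (φ t)) 2 (Measure.haar : Measure G) :=
  MemLp.of_le_mul (Lp.memLp φ) (aestronglyMeasurable_clm_apply hF φ)
    (Eventually.of_forall fun t => (F t).le_of_opNorm_le (hC t) (φ t))

/-- The operator of pointwise multiplication by a bounded continuous operator valued function. -/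
def mulOperator (F : G → H →L[ℂ] H) (hF : Continuous F) (C : ℝ) (hC : ∀ t, ‖F t‖ ≤ C) :
    L2Haar G H →L[ℂ] L2Haar G H :=
  LinearMap.mkContinuous
    { toFun := fun φ => (memLp_clm_apply hF hC φ).toLp _
      map_add' := fun φ ψ => by
        rw [← MemLp.toLp_add]
        refine MemLp.toLp_congr _ _ ?_
        filter_upwards [Lp.coeFn_add φ ψ] with t ht
        rw [ht, Pi.add_apply, Pi.add_apply, map_add]
      map_smul' := fun c φ => by
        rw [RingHom.id_apply, ← MemLp.toLp_const_smul]
        refine MemLp.toLp_congr _ _ ?_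
        filter_upwards [Lp.coeFn_smul c φ] with t ht
        rw [ht, Pi.smul_apply, Pi.smul_apply, map_smul] }
    C (fun φ => Lp.norm_le_mul_norm_of_ae_le_mul (by
      filter_upwards [(memLp_clm_apply hF hC φ).coeFn_toLp] with t ht
      refine (le_of_eq (congrArg norm ht)).trans ?_
      exact (F t).le_of_opNorm_le (hC t) (φ t)))

theorem mulOperator_ae (F : G → H →L[ℂ] H) (hF : Continuous F) (C : ℝ) (hC : ∀ t, ‖F t‖ ≤ C)
    (φ : L2Haar G H) :
    ∀ᵐ t ∂(Measure.haar : Measure G), mulOperator F hF C hC φ t = F t (φ t) :=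
  (memLp_clm_apply hF hC φ).coeFn_toLp

/-- The left translation operators `(λ_s φ)(t) = φ(s⁻¹ t)` on `L²(G, H)`. -/
def leftTranslation : G →* (L2Haar G H ≃ₗᵢ[ℂ] L2Haar G H) :=
  have hcomp : ∀ (s r : G) (φ : L2Haar G H),
      Lp.compMeasurePreserving _ (measurePreserving_mul_left (Measure.haar : Measure G) s⁻¹)
        (Lp.compMeasurePreserving _ (measurePreserving_mul_left (Measure.haar : Measure G) r⁻¹) φ) =
      Lp.compMeasurePreserving _
        (measurePreserving_mul_left (Measure.haar : Measure G) (s * r)⁻¹) φ := fun s r φ => by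
    rw [← Lp.compMeasurePreserving_comp_apply]
    congr 2
    ext t
    simp [mul_assoc]
  have hone : ∀ φ : L2Haar G H,
      Lp.compMeasurePreserving _
        (measurePreserving_mul_left (Measure.haar : Measure G) (1 : G)⁻¹) φ = φ := fun φ => by
    refine Lp.ext ?_
    filter_upwards [Lp.coeFn_compMeasurePreserving φ
      (measurePreserving_mul_left (Measure.haar : Measure G) (1 : G)⁻¹)] with t ht
    rw [ht]
    simp
  { toFun := fun s =>
      { Lp.compMeasurePreservingₗᵢ ℂ _
          (measurePreserving_mul_left (Measure.haar : Measure G) s⁻¹) with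
        invFun := fun φ => Lp.compMeasurePreserving _
          (measurePreserving_mul_left (Measure.haar : Measure G) (s⁻¹)⁻¹) φ
        left_inv := fun φ => by
          refine (hcomp s⁻¹ s φ).trans ?_
          simp only [inv_mul_cancel]
          exact hone φ
        right_inv := fun φ => by
          refine (hcomp s s⁻¹ φ).trans ?_
          simp only [mul_inv_cancel]
          exact hone φ }
    map_one' := LinearIsometryEquiv.ext hone
    map_mul' := fun s r => LinearIsometryEquiv.ext fun φ => (hcomp s r φ).symm }

theorem leftTranslation_ae (s : G) (φ : L2Haar G H) :
    ∀ᵐ t ∂(Measure.haar : Measure G), leftTranslation s φ t = φ (s⁻¹ * t) :=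
  Lp.coeFn_compMeasurePreserving φ (measurePreserving_mul_left (Measure.haar : Measure G) s⁻¹)

theorem continuous_leftTranslation (φ : L2Haar G H) :
    Continuous fun s : G => leftTranslation s φ := by
  let g : C(G, C(G, G)) :=
    (ContinuousMap.mk (fun p : G × G => p.1⁻¹ * p.2) (by fun_prop)).curry
  exact Continuous.compMeasurePreservingLp (f := fun _ : G => φ) (g := g) continuous_const
    g.continuous (fun s => measurePreserving_mul_left (Measure.haar : Measure G) s⁻¹)
    ENNReal.ofNat_ne_top

theorem nontrivial_L2Haar [Nontrivial H] : Nontrivial (L2Haar G H) := by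
  obtain ⟨ξ, hξ⟩ := exists_ne (0 : H)
  obtain ⟨K, hK, hK1⟩ := exists_compact_mem_nhds (1 : G)
  have hpos : 0 < (Measure.haar : Measure G) K := Measure.measure_pos_of_mem_nhds _ hK1
  refine ⟨indicatorConstLp 2 hK.measurableSet hK.measure_lt_top.ne ξ, 0, fun h => ?_⟩
  have := congrArg norm h
  rw [norm_indicatorConstLp two_ne_zero ENNReal.ofNat_ne_top, norm_zero] at this
  have h' : 0 < ((Measure.haar : Measure G).real K) :=
    ENNReal.toReal_pos hpos.ne' hK.measure_lt_top.ne
  have : 0 < ‖ξ‖ * (Measure.haar : Measure G).real K ^ (1 / (2 : ℝ≥0∞).toReal) := by positivity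
  linarith

variable [CStarAlgebra A] [MulSemiringAction G A] [SMulCommClass G ℂ A] [StarSMul G A]
  [ContinuousSMul G A]

theorem continuous_rep_inv_smul (π : A →⋆ₐ[ℂ] (H →L[ℂ] H)) (h : A) :
    Continuous fun t : G => π (t⁻¹ • h) := by
  have hπ : Continuous π :=
    AddMonoidHomClass.continuous_of_bound π 1 fun a => by
      simpa using NonUnitalStarAlgHom.norm_apply_le π a
  exact hπ.comp (continuous_inv.smul continuous_const)

theorem norm_rep_inv_smul_le (π : A →⋆ₐ[ℂ] (H →L[ℂ] H)) (h : A) (t : G) :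
    ‖π (t⁻¹ • h)‖ ≤ ‖h‖ :=
  NonUnitalStarAlgHom.norm_apply_le (π.comp (actionHom t⁻¹)) h

/-- The representation `M_π` by multiplication operators, `(M_π(h)φ)(t) = π(t⁻¹ • h) φ(t)`. -/
def multiplicationRep (π : A →⋆ₐ[ℂ] (H →L[ℂ] H)) :
    A →⋆ₐ[ℂ] (L2Haar G H →L[ℂ] L2Haar G H) :=
  have hae : ∀ (h : A) (φ : L2Haar G H), ∀ᵐ t ∂(Measure.haar : Measure G),
      mulOperator (fun t => π (t⁻¹ • h)) (continuous_rep_inv_smul π h) ‖h‖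
        (norm_rep_inv_smul_le π h) φ t = π (t⁻¹ • h) (φ t) := fun h φ =>
    mulOperator_ae _ (continuous_rep_inv_smul π h) ‖h‖ (norm_rep_inv_smul_le π h) φ
  { toFun := fun h => mulOperator (fun t => π (t⁻¹ • h)) (continuous_rep_inv_smul π h) ‖h‖
      (norm_rep_inv_smul_le π h)
    map_one' := by
      ext1 φ
      refine Lp.ext ?_
      filter_upwards [hae 1 φ] with t ht
      rw [ht]
      simp
    map_mul' := fun a b => by
      ext1 φ
      refine Lp.ext ?_
      filter_upwards [hae (a * b) φ, hae a (mulOperator (fun t => π (t⁻¹ • b))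
        (continuous_rep_inv_smul π b) ‖b‖ (norm_rep_inv_smul_le π b) φ), hae b φ] with t h1 h2 h3
      rw [h1, mul_apply_eq_comp, h2, h3]
      simp
    map_zero' := by
      ext1 φ
      refine Lp.ext ?_
      filter_upwards [hae 0 φ, Lp.coeFn_zero H 2 (Measure.haar : Measure G)] with t ht h0
      rw [ht, zero_apply, h0]
      simp
    map_add' := fun a b => by
      ext1 φ
      refine Lp.ext ?_
      rw [add_apply]
      filter_upwards [hae (a + b) φ, hae a φ, hae b φ, Lp.coeFn_add (mulOperator
        (fun t => π (t⁻¹ • a)) (continuous_rep_inv_smul π a) ‖a‖ (norm_rep_inv_smul_le π a) φ)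
        (mulOperator (fun t => π (t⁻¹ • b)) (continuous_rep_inv_smul π b) ‖b‖
        (norm_rep_inv_smul_le π b) φ)] with t h1 h2 h3 h4
      rw [h1, h4, Pi.add_apply, h2, h3]
      simp
    commutes' := fun z => by
      ext1 φ
      refine Lp.ext ?_
      rw [Algebra.algebraMap_eq_smul_one (A := L2Haar G H →L[ℂ] L2Haar G H),
        smul_apply, one_apply_eq_self]
      filter_upwards [hae (algebraMap ℂ A z) φ, Lp.coeFn_smul z φ] with t h1 h2
      rw [h1, h2, Algebra.algebraMap_eq_smul_one, smul_comm, smul_one]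
      simp
    map_star' := fun a => by
      rw [ContinuousLinearMap.star_eq_adjoint, ContinuousLinearMap.eq_adjoint_iff]
      intro φ ψ
      rw [L2.inner_def, L2.inner_def]
      refine integral_congr_ae ?_
      filter_upwards [hae (star a) φ, hae a ψ] with t h1 h2
      rw [h1, h2, StarSMul.smul_star, map_star, ContinuousLinearMap.star_eq_adjoint,
        ContinuousLinearMap.adjoint_inner_left] }

theorem multiplicationRep_ae (π : A →⋆ₐ[ℂ] (H →L[ℂ] H)) (h : A) (φ : L2Haar G H) :
    ∀ᵐ t ∂(Measure.haar : Measure G), multiplicationRep π h φ t = π (t⁻¹ • h) (φ t) :=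
  mulOperator_ae _ (continuous_rep_inv_smul π h) ‖h‖ (norm_rep_inv_smul_le π h) φ

variable (G) in
/-- The covariant representation `(M_π, λ)` on `L²(G, H)`, which defines the `π`-regular
representation of `G ⋉ A`. -/
def regularRep (π : A →⋆ₐ[ℂ] (H →L[ℂ] H)) (hH : Nontrivial H) : CovariantRep G A where
  H := L2Haar G H
  nontriv := nontrivial_L2Haar
  rep := multiplicationRep π
  U := leftTranslation
  continuous_U := continuous_leftTranslation
  covariant s a φ := by
    refine Lp.ext ?_
    have h := (measurePreserving_mul_left (Measure.haar : Measure G) s⁻¹).quasiMeasurePreserving.ae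
      (multiplicationRep_ae π a φ)
    filter_upwards [leftTranslation_ae s (multiplicationRep π a φ), h, leftTranslation_ae s φ,
      multiplicationRep_ae π (s • a) (leftTranslation s φ)] with t h1 h2 h3 h4
    rw [h1, h2, h4, h3, smul_smul, mul_inv_rev, inv_inv]

end RegularRep

end

/-!
# Lower bounds in crossed products by proper actions

Put `T = v* v`, an element of `1 + G ⋉ J`. The point is that `T` is invertible. Then
`v (v* v)^(-1/2)` is an isometry by functional calculus (`star_mul_self_of_isUnit`), and it is not
unitary, since otherwise `v` would have a right inverse and all operators `Π_y(v)` would be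
surjective; here `Y` is nonempty because the zero ideal has a unit.

By hypothesis, `Π_y(T) ≥ c_y > 0` for every `y ∈ Y`. The regular representations alone are not known
to control the norm of the full crossed product, and the constants `c_y` depend on `y`. It is shown
that `R(T) ≥ d` for one constant `d > 0` and all covariant representations `R`
(`CovariantRep.smul_one_le_eval`), which is enough because the norm of `G ⋉ M` is the supremum of
the norms in the covariant representations (`isUnit_of_forall_smul_one_le_eval`). There are three
steps.

*Lower bounds near a point.* After a change of the base space, the isomorphism `J ≃ C₀(Y, K(H₀))` is
such that evaluation at `y` is equivalent to the restriction of `π_y` to `J`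
(`exists_adapted_trivialization`). If a representation `ρ` of `M` lives on a small neighbourhood `O`
of `y₀`, then constant sections over `O` define a representation `ρ'` which is a multiple of
`π_{y₀}` and differs from `ρ` by at most the oscillation of sections on `O`
(`IsSupportedIn.exists_multiple`). Because the action is proper, the sections `t • f(s)`, for
`s, t ∈ G` and `f ∈ C_c(G, J)`, are equicontinuous at `y₀`
(`eventually_forall_forall_norm_evalAt_smul_sub_le`), so the representations induced from `ρ` and
`ρ'` are close to each other at any given element of `G ⋉ J`, uniformly in `ρ`. Hence the lower
bound `c_{y₀}` for `Π_{y₀}(T)` passes, up to `ε`, to the representations induced from all such `ρ`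
(`exists_nhds_smul_one_le_inducedHom`).

*From induced representations to arbitrary ones.* Let `R = (rep, U)` be covariant on `H`, let `J_O`
be the ideal of the sections which vanish outside of a relatively compact set `O`, and let `P` be
the projection onto the closed span of `rep(J_O) H`. Properness of the action implies that the
projections `U_t P U_t⁻¹`, which commute with each other, are orthogonal as soon as the translations
differ by an element outside of a compact set. Therefore `t ↦ P U_t⁻¹ ξ` is square integrable
(`setIntegral_norm_sq_translatedProjection_le`), and this defines an intertwiner of `R` with a
representation induced from one which lives on `O` (`exists_intertwiner_inducedRep`). An intertwiner
transports a lower bound in the form that the negative part of `R(T) - d` vanishes on its range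
(`negPart_comp_eq_zero`); so this negative part vanishes on `U_t rep(J_O) H`, for all `t ∈ G`.

*Compactness.* Since `Y / G` is compact, the translates of finitely many sets `O` cover `Y`, and
these determine `d`. The spaces `U_t rep(J_O) H` then span a dense subspace of `rep(J) H`, and
`R(T)` is the identity on the orthogonal complement of `rep(J) H` because `T ∈ 1 + G ⋉ J`.
-/

open scoped InnerProductSpace

universe w

noncomputable section

/-! ### Lower bounds of self-adjoint operators and intertwiners -/

section LowerBounds

variable {H K : Type*} [NormedAddCommGroup H] [InnerProductSpace ℂ H] [CompleteSpace H]
  [NormedAddCommGroup K] [InnerProductSpace ℂ K] [CompleteSpace K]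

theorem isSelfAdjoint_ofReal_smul_one (c : ℝ) :
    IsSelfAdjoint ((c : ℂ) • (1 : H →L[ℂ] H)) := by
  rw [IsSelfAdjoint, star_smul, star_one]
  simp

theorem smul_one_le_iff_of_isSelfAdjoint {A : H →L[ℂ] H} (hA : IsSelfAdjoint A) (c : ℝ) :
    (c : ℂ) • (1 : H →L[ℂ] H) ≤ A ↔ ∀ x, c * ‖x‖ ^ 2 ≤ RCLike.re ⟪A x, x⟫_ℂ := by
  have hsa : IsSelfAdjoint (A - (c : ℂ) • (1 : H →L[ℂ] H)) :=
    hA.sub (isSelfAdjoint_ofReal_smul_one c)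
  have hre : ∀ x, RCLike.re ⟪(A - (c : ℂ) • (1 : H →L[ℂ] H)) x, x⟫_ℂ
      = RCLike.re ⟪A x, x⟫_ℂ - c * ‖x‖ ^ 2 := by
    intro x
    have : ((c : ℂ) • (1 : H →L[ℂ] H)) x = (c : ℂ) • x := by simp
    rw [sub_apply, smul_apply, one_apply_eq_self, inner_sub_left, inner_smul_left, map_sub,
      inner_self_eq_norm_sq_to_K]
    simp [← Complex.ofReal_pow]
  rw [ContinuousLinearMap.le_def]
  constructor
  · intro h x
    have := h.re_inner_nonneg_left x
    rw [hre] at this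
    linarith
  · intro h
    refine ⟨hsa.isSymmetric, fun x => ?_⟩
    rw [ContinuousLinearMap.reApplyInnerSelf_apply, hre]
    linarith [h x]

theorem isSelfAdjoint_of_smul_one_le {A : H →L[ℂ] H} {c : ℝ} (h : (c : ℂ) • (1 : H →L[ℂ] H) ≤ A) :
    IsSelfAdjoint A := by
  have h1 : IsSelfAdjoint (A - (c : ℂ) • (1 : H →L[ℂ] H)) := .of_nonneg (sub_nonneg.2 h)
  have h2 : IsSelfAdjoint ((c : ℂ) • (1 : H →L[ℂ] H)) := isSelfAdjoint_ofReal_smul_one c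
  simpa using h1.add h2

/-- If `X` intertwines a self-adjoint `A` with an operator `B ≥ c`, then the negative part of
`A - c` vanishes on the range of `X`. With `D = A - c` and `Y = X X*`, the operator
`D Y = X (B - c) X*` is positive, hence self-adjoint, so that `D` and its negative part `N` commute
with `Y`. The positive operator `√N (D Y) √N` is equal to `-N Y N`, which forces `N Y N = 0`. -/
theorem negPart_comp_eq_zero {A : H →L[ℂ] H} (hA : IsSelfAdjoint A) {B : K →L[ℂ] K} {c : ℝ}
    (hB : (c : ℂ) • (1 : K →L[ℂ] K) ≤ B) {X : K →L[ℂ] H} (hX : A ∘L X = X ∘L B) :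
    (A - (c : ℂ) • (1 : H →L[ℂ] H))⁻ ∘L X = 0 := by
  set D := A - (c : ℂ) • (1 : H →L[ℂ] H) with hD
  have hDsa : IsSelfAdjoint D := hA.sub (isSelfAdjoint_ofReal_smul_one c)
  have hBsa := isSelfAdjoint_of_smul_one_le hB
  set E := B - (c : ℂ) • (1 : K →L[ℂ] K) with hE
  have hE0 : 0 ≤ E := sub_nonneg.2 hB
  have hDX : D ∘L X = X ∘L E := by
    ext x
    have := congrArg (fun T : K →L[ℂ] H => T x) hX
    simp only [ContinuousLinearMap.comp_apply] at this
    simp [hD, hE, this]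
  set Y : H →L[ℂ] H := X ∘L X.adjoint with hY
  have hY0 : 0 ≤ Y := by
    rw [ContinuousLinearMap.nonneg_iff_isPositive]
    exact ContinuousLinearMap.isPositive_self_comp_adjoint X
  have hDY : D * Y = X ∘L E ∘L X.adjoint := by
    rw [hY, ← ContinuousLinearMap.comp_assoc, ← hDX]; rfl
  have hDY0 : 0 ≤ D * Y := by
    rw [hDY, ContinuousLinearMap.nonneg_iff_isPositive]
    exact ((ContinuousLinearMap.nonneg_iff_isPositive _).1 hE0).conj_adjoint X
  have hcomm : Commute D Y := by
    have h1 : IsSelfAdjoint (D * Y) := .of_nonneg hDY0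
    have h2 := h1.star_eq
    rw [star_mul, hDsa.star_eq, (IsSelfAdjoint.of_nonneg hY0).star_eq] at h2
    exact h2.symm
  set N := D⁻ with hN
  have hN0 : 0 ≤ N := CFC.negPart_nonneg D
  have hNsa : IsSelfAdjoint N := .of_nonneg hN0
  have hDN : D * N = - (N * N) := by
    conv_lhs => rw [← CFC.posPart_sub_negPart D hDsa]
    rw [sub_mul, CFC.posPart_mul_negPart, zero_sub]
  have hND : Commute D N := ((Commute.refl D).cfcₙ_real _).symm
  have hNY : Commute N Y := hcomm.cfcₙ_real _
  set k := CFC.sqrt N with hk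
  have hk0 : 0 ≤ k := CFC.sqrt_nonneg N
  have hksa : IsSelfAdjoint k := .of_nonneg hk0
  have hkk : k * k = N := CFC.sqrt_mul_sqrt_self N
  have hkD : Commute k (D * Y) := (hND.symm.mul_right hNY).cfcₙ_nnreal _
  have h1 : 0 ≤ k * (D * Y) * k := by
    have := star_left_conjugate_nonneg hDY0 k
    rwa [hksa.star_eq] at this
  have h2 : k * (D * Y) * k = - (N * Y * N) := by
    rw [hkD.eq, mul_assoc, hkk, mul_assoc, ← hNY.eq, ← mul_assoc, hDN, neg_mul, mul_assoc,
      mul_assoc, hNY.eq]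
  have h3 : 0 ≤ N * Y * N := by
    have := star_left_conjugate_nonneg hY0 N
    rwa [hNsa.star_eq] at this
  have h4 : N * Y * N = 0 := le_antisymm (by rw [h2] at h1; exact neg_nonneg.1 h1) h3
  have h5 : (N ∘L X) ∘L (N ∘L X).adjoint = 0 := by
    rw [ContinuousLinearMap.adjoint_comp, ← ContinuousLinearMap.star_eq_adjoint N, hNsa.star_eq]
    exact h4
  have h6 : (N ∘L X).adjoint = 0 := by
    ext x
    have := congrArg (fun T : H →L[ℂ] H => ⟪T x, x⟫_ℂ) h5
    simp only [ContinuousLinearMap.comp_apply (N ∘L X)] at this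
    rw [← ContinuousLinearMap.adjoint_inner_right] at this
    simpa using this
  have := congrArg ContinuousLinearMap.adjoint h6
  simpa using this

/-- If the negative part of `A - c` vanishes on a set with dense span, then `A ≥ c`. -/
theorem smul_one_le_of_negPart_eq_zero {A : H →L[ℂ] H} (hA : IsSelfAdjoint A) {c : ℝ}
    {s : Set H} (hs : (Submodule.span ℂ s).topologicalClosure = ⊤)
    (h : ∀ x ∈ s, (A - (c : ℂ) • (1 : H →L[ℂ] H))⁻ x = 0) : (c : ℂ) • (1 : H →L[ℂ] H) ≤ A := by
  have hDsa : IsSelfAdjoint (A - (c : ℂ) • (1 : H →L[ℂ] H)) :=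
    hA.sub (isSelfAdjoint_ofReal_smul_one c)
  have h0 : (A - (c : ℂ) • (1 : H →L[ℂ] H))⁻ = 0 := by
    refine ContinuousLinearMap.ext_on ?_ (g := 0) h
    rw [dense_iff_closure_eq, ← Submodule.topologicalClosure_coe, hs]
    simp
  rw [← sub_nonneg, ← CFC.posPart_sub_negPart _ hDsa, h0, sub_zero]
  exact CFC.posPart_nonneg _

/-- Intertwiners with dense joint range transport a lower bound. -/
theorem smul_one_le_of_intertwiners {ι : Type*} {L : Type*} [NormedAddCommGroup L]
    [InnerProductSpace ℂ L] [CompleteSpace L] {A : H →L[ℂ] H} (hA : IsSelfAdjoint A)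
    {B : L →L[ℂ] L} {c : ℝ} (hB : (c : ℂ) • (1 : L →L[ℂ] L) ≤ B) (X : ι → L →L[ℂ] H)
    (hX : ∀ i, A ∘L X i = X i ∘L B)
    (hd : (Submodule.span ℂ {x | ∃ i y, X i y = x}).topologicalClosure = ⊤) :
    (c : ℂ) • (1 : H →L[ℂ] H) ≤ A := by
  refine smul_one_le_of_negPart_eq_zero hA hd ?_
  rintro _ ⟨i, y, rfl⟩
  exact congrArg (fun T : L →L[ℂ] H => T y) (negPart_comp_eq_zero hA hB (hX i))

/-- Lower bounds are stable under perturbations of small norm. -/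
theorem smul_one_le_of_norm_sub_le {A B : H →L[ℂ] H} (hA : IsSelfAdjoint A) {c d : ℝ}
    (hB : (c : ℂ) • (1 : H →L[ℂ] H) ≤ B) (h : ‖A - B‖ ≤ d) :
    ((c - d : ℝ) : ℂ) • (1 : H →L[ℂ] H) ≤ A := by
  have hBsa := isSelfAdjoint_of_smul_one_le hB
  rw [smul_one_le_iff_of_isSelfAdjoint hA]
  rw [smul_one_le_iff_of_isSelfAdjoint hBsa] at hB
  intro x
  have h1 : |RCLike.re ⟪(A - B) x, x⟫_ℂ| ≤ d * ‖x‖ ^ 2 := by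
    refine (RCLike.abs_re_le_norm _).trans ((norm_inner_le_norm _ _).trans ?_)
    have := (A - B).le_of_opNorm_le h x
    nlinarith [norm_nonneg x]
  have h2 : RCLike.re ⟪A x, x⟫_ℂ = RCLike.re ⟪B x, x⟫_ℂ + RCLike.re ⟪(A - B) x, x⟫_ℂ := by
    rw [sub_apply, inner_sub_left, map_sub]; ring
  have := abs_le.1 h1
  nlinarith [hB x]

/-- An injective operator with closed range satisfies `X*X ≥ c` for some `c > 0`. -/
theorem exists_smul_one_le_adjoint_comp {X : H →L[ℂ] H} (hinj : Function.Injective X)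
    (hcl : IsClosed (Set.range X)) : ∃ c : ℝ, 0 < c ∧ (c : ℂ) • (1 : H →L[ℂ] H) ≤ star X * X := by
  -- the bound `k` for the inverse may be zero, so the constant is taken to be `(k + 1)⁻²`
  obtain ⟨k, hX⟩ := X.antilipschitz_of_injective_of_isClosed_range hinj hcl
  refine ⟨(((k : ℝ) + 1) ^ 2)⁻¹, by positivity, ?_⟩
  rw [smul_one_le_iff_of_isSelfAdjoint (IsSelfAdjoint.star_mul_self X)]
  intro x
  have h1 : ‖x‖ ≤ (k + 1) * ‖X x‖ := by
    have : ‖x‖ ≤ k * ‖X x‖ := by simpa using hX.le_mul_dist x 0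
    linarith [norm_nonneg (X x)]
  have h2 : RCLike.re ⟪(star X * X) x, x⟫_ℂ = ‖X x‖ ^ 2 := by
    rw [mul_apply_eq_comp, ContinuousLinearMap.star_eq_adjoint,
      ContinuousLinearMap.adjoint_inner_left, inner_self_eq_norm_sq_to_K]
    simp [← Complex.ofReal_pow]
  rw [h2, inv_mul_le_iff₀ (by positivity), ← mul_pow]
  exact pow_le_pow_left₀ (norm_nonneg _) h1 2

end LowerBounds

/-! ### Functions vanishing at infinity -/

section VanishingAtInfinity

variable {X : Type*} [TopologicalSpace X]

/-- The product of a real continuous function with values in `[-1, 1]` and a function vanishing at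
infinity. -/
def ZeroAtInftyContinuousMap.scalarMul {B : Type*} [NormedAddCommGroup B] [NormedSpace ℂ B]
    (g : C(X, ℝ)) (hg : ∀ x, |g x| ≤ 1) (F : C₀(X, B)) : C₀(X, B) where
  toFun x := (g x : ℂ) • F x
  continuous_toFun := by fun_prop
  zero_at_infty' := by
    refine squeeze_zero_norm (fun x => ?_) (tendsto_zero_iff_norm_tendsto_zero.1 F.zero_at_infty')
    rw [norm_smul]
    have := mul_le_mul_of_nonneg_right (hg x) (norm_nonneg (F x))
    simpa using this

@[simp] theorem ZeroAtInftyContinuousMap.scalarMul_apply {B : Type*} [NormedAddCommGroup B]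
    [NormedSpace ℂ B] (g : C(X, ℝ)) (hg : ∀ x, |g x| ≤ 1) (F : C₀(X, B)) (x : X) :
    F.scalarMul g hg x = (g x : ℂ) • F x := rfl

variable {B : Type*} [NormedAddCommGroup B]

theorem ZeroAtInftyContinuousMap.norm_apply_le (F : C₀(X, B)) (x : X) : ‖F x‖ ≤ ‖F‖ :=
  F.toBCF.norm_coe_le_norm x

theorem ZeroAtInftyContinuousMap.norm_le_of_forall (F : C₀(X, B)) {c : ℝ} (hc : 0 ≤ c)
    (h : ∀ x, ‖F x‖ ≤ c) : ‖F‖ ≤ c :=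
  (BoundedContinuousFunction.norm_le hc (f := F.toBCF)).2 h

theorem ZeroAtInftyContinuousMap.isCompact_setOf_le_norm (F : C₀(X, B)) {ε : ℝ} (hε : 0 < ε) :
    IsCompact {x | ε ≤ ‖F x‖} := by
  have h := F.zero_at_infty'.eventually (Metric.ball_mem_nhds (0 : B) hε)
  obtain ⟨K, hK, hKs⟩ := mem_cocompact.1 h
  refine hK.of_isClosed_subset (isClosed_le continuous_const F.continuous_toFun.norm)
    fun x hx => ?_
  by_contra hxK
  have h1 : ‖F x‖ < ε := by simpa using hKs hxK
  exact absurd hx (not_le.2 h1)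

/-- The range of a function vanishing at infinity is totally bounded. -/
theorem ZeroAtInftyContinuousMap.exists_finite_net (F : C₀(X, B)) {ε : ℝ} (hε : 0 < ε) :
    ∃ t : Set B, t.Finite ∧ ∀ x, ∃ b ∈ t, ‖F x - b‖ < ε := by
  have hK := (F.isCompact_setOf_le_norm hε).image F.continuous_toFun
  obtain ⟨t, ht, hKt⟩ := Metric.totallyBounded_iff.1 hK.totallyBounded ε hε
  refine ⟨insert 0 t, ht.insert 0, fun x => ?_⟩
  by_cases hx : ε ≤ ‖F x‖
  · have := hKt ⟨x, hx, rfl⟩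
    simp only [Set.mem_iUnion, Metric.mem_ball, dist_eq_norm] at this
    obtain ⟨b, hb, hb'⟩ := this
    exact ⟨b, Set.mem_insert_of_mem _ hb, hb'⟩
  · exact ⟨0, Set.mem_insert _ _, by simpa using hx⟩

/-- A function vanishing at infinity is, up to `ε`, a finite sum of its multiples by scalar
functions subordinate to a given open cover. -/
theorem ZeroAtInftyContinuousMap.exists_sum_scalarMul [T2Space X] [NormalSpace X]
    [NormedSpace ℂ B] {ι : Type*} (U : ι → Set X) (hU : ∀ i, IsOpen (U i))
    (hc : ⋃ i, U i = Set.univ) (F : C₀(X, B)) {ε : ℝ} (hε : 0 < ε) :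
    ∃ (t : Finset ι) (g : t → C(X, ℝ)) (hg : ∀ i x, |g i x| ≤ 1),
      (∀ (i : t), ∀ x ∉ U i, g i x = 0) ∧ ‖F - ∑ i, F.scalarMul (g i) (hg i)‖ ≤ ε := by
  have hK := F.isCompact_setOf_le_norm hε
  obtain ⟨t, ht⟩ := hK.elim_finite_subcover U hU (by rw [hc]; exact Set.subset_univ _)
  obtain ⟨f, hf⟩ := PartitionOfUnity.exists_isSubordinate_of_locallyFinite hK.isClosed
    (fun i : t => U i) (fun i => hU i) (locallyFinite_of_finite _)
    (ht.trans fun x hx => by simpa using hx)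
  have hg : ∀ i x, |f i x| ≤ 1 := fun i x => by
    rw [abs_of_nonneg (f.nonneg i x)]; exact f.le_one i x
  refine ⟨t, fun i => f i, hg, fun i x hx => ?_, ?_⟩
  · by_contra h
    exact hx (hf i (subset_tsupport _ h))
  · refine ZeroAtInftyContinuousMap.norm_le_of_forall _ hε.le fun x => ?_
    have hsum : (∑ i, F.scalarMul (f i) (hg i)) x = ((∑ i, f i x : ℝ) : ℂ) • F x := by
      have : ∀ s : Finset t, (∑ i ∈ s, F.scalarMul (f i) (hg i)) x
          = ((∑ i ∈ s, f i x : ℝ) : ℂ) • F x := by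
        intro s
        induction s using Finset.cons_induction with
        | empty => simp
        | cons a s ha ih => simp [Finset.sum_cons, ih, add_smul]
      exact this Finset.univ
    have hs1 := f.sum_le_one x
    have hs0 : 0 ≤ ∑ i, f i x := Finset.sum_nonneg fun i _ => f.nonneg i x
    rw [finsum_eq_sum_of_fintype] at hs1
    have hn : ‖(F - ∑ i, F.scalarMul (f i) (hg i)) x‖ = (1 - ∑ i, f i x) * ‖F x‖ := by
      rw [ZeroAtInftyContinuousMap.sub_apply, hsum]
      have : F x - ((∑ i, f i x : ℝ) : ℂ) • F x = ((1 - ∑ i, f i x : ℝ) : ℂ) • F x := by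
        rw [Complex.ofReal_sub, sub_smul, Complex.ofReal_one, one_smul]
      rw [this, norm_smul, Complex.norm_real, Real.norm_of_nonneg (by linarith)]
    rw [hn]
    by_cases hx : ε ≤ ‖F x‖
    · have := f.sum_eq_one (x := x) hx
      rw [finsum_eq_sum_of_fintype] at this
      rw [this]; simpa using hε.le
    · push Not at hx
      nlinarith [norm_nonneg (F x)]

end VanishingAtInfinity

/-! ### Functions with values in the compact operators -/

section CompactOperatorFunctions

variable {H : Type*} [NormedAddCommGroup H] [InnerProductSpace ℂ H]

theorem isCompactOperator_rankOne (x y : H) :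
    IsCompactOperator (InnerProductSpace.rankOne ℂ x y) := by
  rw [InnerProductSpace.rankOne_def']
  have : IsCompactOperator (ContinuousLinearMap.toSpanSingleton ℂ x) :=
    ⟨_, (isCompact_closedBall (0:ℂ) 1).image (ContinuousLinearMap.toSpanSingleton ℂ x).continuous,
      mem_of_superset (Metric.closedBall_mem_nhds _ one_pos) (Set.subset_preimage_image _ _)⟩
  exact this.comp_clm _

/-- The image of the unit ball under a compact operator is totally bounded. -/
theorem IsCompactOperator.exists_finite_net {k : H →L[ℂ] H} (hk : IsCompactOperator k) {ε : ℝ}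
    (hε : 0 < ε) : ∃ t : Set H, t.Finite ∧ ∀ x, ‖x‖ ≤ 1 → ∃ b ∈ t, ‖k x - b‖ < ε := by
  obtain ⟨K, hK, hkK⟩ := hk.image_closedBall_subset_compact (f := k.toLinearMap) 1
  obtain ⟨t, ht, hKt⟩ := Metric.totallyBounded_iff.1 hK.totallyBounded ε hε
  refine ⟨t, ht, fun x hx => ?_⟩
  have := hKt (hkK ⟨x, by simpa using hx, rfl⟩)
  simpa [dist_eq_norm] using this

variable [CompleteSpace H]

/-- The rank one operator `z ↦ ⟪y, z⟫ x` as an element of the algebra of compact operators. -/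
def compactRankOne (x y : H) : compactOperators H :=
  ⟨InnerProductSpace.rankOne ℂ x y, isCompactOperator_rankOne x y⟩

@[simp] theorem compactRankOne_apply (x y z : H) :
    (compactRankOne x y : H →L[ℂ] H) z = ⟪y, z⟫_ℂ • x := rfl

theorem mul_compactRankOne (k : compactOperators H) (x y : H) :
    k * compactRankOne x y = compactRankOne ((k : H →L[ℂ] H) x) y := by
  ext z
  simp

theorem compactRankOne_mul_compactRankOne {e : H} (he : ‖e‖ = 1) (x y : H) :
    compactRankOne x e * compactRankOne e y = compactRankOne x y := by
  ext z
  simp [he]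

/-- Left multiplication by finite-rank projections approximates the identity, uniformly on the
values of a function that vanishes at infinity. -/
theorem exists_finiteRank_approx {X : Type*} [TopologicalSpace X] (F : C₀(X, compactOperators H))
    {ε : ℝ} (hε : 0 < ε) : ∃ (n : ℕ) (w : Fin n → H),
      ∀ x, ‖(∑ i, compactRankOne (w i) (w i)) * F x - F x‖ ≤ ε := by
  -- finitely many compact operators approximate all values of `F`, and finitely many vectors
  -- approximate the images of the unit ball under these; project onto the span of these vectors
  obtain ⟨t, ht, hFt⟩ := F.exists_finite_net (half_pos hε)
  choose s hs hs' using fun k : compactOperators H =>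
    IsCompactOperator.exists_finite_net k.2 (half_pos hε)
  set T : Set H := ⋃ k ∈ t, s k
  have hT : T.Finite := ht.biUnion fun k _ => hs k
  set p : Submodule ℂ H := Submodule.span ℂ T
  have : FiniteDimensional ℂ p := FiniteDimensional.span_of_finite ℂ hT
  let b := stdOrthonormalBasis ℂ p
  refine ⟨_, fun i => (b i : H), fun x => ?_⟩
  have hq : ((∑ i, compactRankOne (b i : H) (b i : H) : compactOperators H) : H →L[ℂ] H)
      = p.starProjection := by
    rw [b.starProjection_eq_sum_rankOne]
    exact map_sum (NonUnitalStarSubalgebraClass.subtype (compactOperators H)) _ _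
  change ‖((∑ i, compactRankOne (b i : H) (b i : H) : compactOperators H) : H →L[ℂ] H)
    * (F x : H →L[ℂ] H) - F x‖ ≤ ε
  rw [hq]
  obtain ⟨k, hk, hkF⟩ := hFt x
  refine ContinuousLinearMap.opNorm_le_of_unit_norm hε.le fun ξ hξ => ?_
  obtain ⟨c, hc, hc'⟩ := hs' k ξ hξ.le
  have hcp : c ∈ p := Submodule.subset_span (Set.mem_biUnion hk hc)
  have h1 : ‖(F x : H →L[ℂ] H) ξ - c‖ ≤ ε := by
    have h2 : ‖(F x : H →L[ℂ] H) ξ - (k : H →L[ℂ] H) ξ‖ ≤ ε / 2 := by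
      have := ((F x - k : compactOperators H) : H →L[ℂ] H).le_opNorm ξ
      rw [hξ, mul_one] at this
      exact this.trans hkF.le
    have := norm_sub_le_norm_sub_add_norm_sub ((F x : H →L[ℂ] H) ξ) ((k : H →L[ℂ] H) ξ) c
    linarith
  have h3 : (p.starProjection * (F x : H →L[ℂ] H) - F x) ξ
      = - (pᗮ.starProjection ((F x : H →L[ℂ] H) ξ - c)) := by
    have := Submodule.starProjection_eq_self_iff.2 hcp
    simp [Submodule.starProjection_orthogonal', map_sub, this]
  rw [h3, norm_neg]
  exact (Submodule.norm_starProjection_apply_le _ _).trans h1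

end CompactOperatorFunctions

/-! ### Extension of representations from an ideal -/

section IdealExtension

variable {M : Type*} [CStarAlgebra M]

/-- `‖m‖² - m* m` is of the form `d* d`. In a representation which is not yet known to be bounded,
this identity is what bounds the operator of `m` by `‖m‖`. -/
theorem exists_star_mul_self_add_star_mul_self (m : M) :
    ∃ d : M, star m * m + star d * d = ((‖m‖ ^ 2 : ℝ) : ℂ) • (1 : M) := by
  let _ := CStarAlgebra.spectralOrder M
  have _ := CStarAlgebra.spectralOrderedRing M
  have h : 0 ≤ ((‖m‖ ^ 2 : ℝ) : ℂ) • (1 : M) - star m * m := by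
    have := CStarAlgebra.star_mul_le_algebraMap_norm_sq (a := m)
    rw [Algebra.algebraMap_eq_smul_one] at this
    rw [sub_nonneg, Complex.coe_smul]
    exact this
  refine ⟨CFC.sqrt (((‖m‖ ^ 2 : ℝ) : ℂ) • (1 : M) - star m * m), ?_⟩
  rw [(IsSelfAdjoint.of_nonneg (CFC.sqrt_nonneg
    (((‖m‖ ^ 2 : ℝ) : ℂ) • (1 : M) - star m * m))).star_eq, CFC.sqrt_mul_sqrt_self _ h]
  abel

variable {E : Type*} [NormedAddCommGroup E] [InnerProductSpace ℂ E] [CompleteSpace E]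

/-- A nondegenerate `*`-representation of a two-sided ideal extends to the whole algebra, by
`m • θ(a) ξ = θ(m a) ξ` on the dense span of the vectors `θ(a) ξ`. -/
theorem exists_extension_of_ideal (J : NonUnitalStarSubalgebra ℂ M)
    (hJ : ∀ a ∈ J, ∀ x : M, x * a ∈ J ∧ a * x ∈ J) (θ : J →⋆ₙₐ[ℂ] (E →L[ℂ] E))
    (hd : (Submodule.span ℂ {x | ∃ a ξ, θ a ξ = x}).topologicalClosure = ⊤) :
    ∃ ρ : M →⋆ₐ[ℂ] (E →L[ℂ] E), ∀ a : J, ρ a = θ a := by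
  -- `F m` maps a formal sum of pairs `(a, ξ)` to the sum of the vectors `θ (m a) ξ`; the extension
  -- is determined by `F 1 u ↦ F m u`
  let L : M → J → J := fun m a => ⟨m * a, (hJ a a.2 m).1⟩
  let F : M → ((J × E) →₀ ℂ) →ₗ[ℂ] E := fun m =>
    Finsupp.linearCombination ℂ fun p : J × E => θ (L m p.1) p.2
  have hF1 : ∀ m a ξ, F m (Finsupp.single (a, ξ) 1) = θ (L m a) ξ := fun m a ξ => by
    simp [F]
  -- the operators for `m` and for `star m` are formally adjoint to each other
  have hinner : ∀ m n u w, ⟪F m u, F n w⟫_ℂ = ⟪F 1 u, F (star m * n) w⟫_ℂ := by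
    intro m n u w
    have hs : ∀ p q : J × E, ⟪θ (L m p.1) p.2, θ (L n q.1) q.2⟫_ℂ
        = ⟪θ (L 1 p.1) p.2, θ (L (star m * n) q.1) q.2⟫_ℂ := by
      intro p q
      rw [← ContinuousLinearMap.adjoint_inner_right, ← ContinuousLinearMap.star_eq_adjoint,
        ← map_star, ← mul_apply_eq_comp, ← map_mul,
        ← ContinuousLinearMap.adjoint_inner_right (θ (L 1 p.1)),
        ← ContinuousLinearMap.star_eq_adjoint, ← map_star, ← mul_apply_eq_comp, ← map_mul]
      have h : star (L m p.1) * L n q.1 = star (L 1 p.1) * L (star m * n) q.1 := by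
        ext
        simp [L, mul_assoc]
      rw [h]
    induction u using Finsupp.induction_linear with
    | zero => simp
    | add f g hf hg => rw [map_add, map_add, inner_add_left, inner_add_left, hf, hg]
    | single p z =>
      induction w using Finsupp.induction_linear with
      | zero => simp
      | add f g hf hg => rw [map_add, map_add, inner_add_right, inner_add_right, hf, hg]
      | single q z' =>
        simp only [F, Finsupp.linearCombination_single, inner_smul_left, inner_smul_right, hs]
  have hadd : ∀ m n u, F (m + n) u = F m u + F n u := by
    intro m n u
    induction u using Finsupp.induction_linear with
    | zero => simp
    | add f g hf hg => rw [map_add, map_add, map_add, hf, hg]; abel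
    | single p z =>
      have : L (m + n) p.1 = L m p.1 + L n p.1 := by ext; simp [L, add_mul]
      simp only [F, Finsupp.linearCombination_single, this, map_add, add_apply, smul_add]
  have hsmul : ∀ (z : ℂ) m u, F (z • m) u = z • F m u := by
    intro z m u
    induction u using Finsupp.induction_linear with
    | zero => simp
    | add f g hf hg => rw [map_add, map_add, hf, hg, smul_add]
    | single p w =>
      have : L (z • m) p.1 = z • L m p.1 := by ext; simp [L]
      simp only [F, Finsupp.linearCombination_single, this, map_smul, smul_apply]
      rw [smul_comm]
  have hbound : ∀ m u, ‖F m u‖ ≤ ‖m‖ * ‖F 1 u‖ := by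
    intro m u
    obtain ⟨d, hd⟩ := exists_star_mul_self_add_star_mul_self m
    have h1 : ⟪F m u, F m u⟫_ℂ + ⟪F d u, F d u⟫_ℂ = ((‖m‖ ^ 2 : ℝ) : ℂ) * ⟪F 1 u, F 1 u⟫_ℂ := by
      rw [hinner m m, hinner d d, ← inner_add_right, ← hadd, hd, hsmul, inner_smul_right]
    have h2 : ‖F m u‖ ^ 2 + ‖F d u‖ ^ 2 = ‖m‖ ^ 2 * ‖F 1 u‖ ^ 2 := by
      have := congrArg RCLike.re h1
      rw [map_add, inner_self_eq_norm_sq, inner_self_eq_norm_sq] at this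
      rw [this]
      refine (RCLike.re_ofReal_mul (K := ℂ) _ _).trans ?_
      rw [inner_self_eq_norm_sq]
      rfl
    refine le_of_sq_le_sq ?_ (by positivity)
    rw [mul_pow]
    nlinarith [sq_nonneg ‖F d u‖]
  have hL1 : ∀ a, L 1 a = a := fun a => by ext; simp [L]
  have hdense : DenseRange (F 1) := by
    have h0 : LinearMap.range (F 1) = Submodule.span ℂ {x | ∃ a ξ, θ a ξ = x} := by
      rw [Finsupp.range_linearCombination]
      congr 1
      ext x
      constructor
      · rintro ⟨p, rfl⟩
        exact ⟨p.1, p.2, by simp [hL1]⟩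
      · rintro ⟨a, ξ, rfl⟩
        exact ⟨(a, ξ), by simp [hL1]⟩
    have : Dense ((Submodule.span ℂ {x | ∃ a ξ, θ a ξ = x} : Submodule ℂ E) : Set E) := by
      rw [dense_iff_closure_eq, ← Submodule.topologicalClosure_coe, hd]; simp
    rw [← h0] at this
    exact this
  let R : M → E →L[ℂ] E := fun m => (F m).extendOfNorm (F 1)
  have hR : ∀ m u, R m (F 1 u) = F m u := fun m u =>
    LinearMap.extendOfNorm_eq hdense ⟨_, hbound m⟩ u
  have hext : ∀ S T : E →L[ℂ] E, (∀ u, S (F 1 u) = T (F 1 u)) → S = T := fun S T h =>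
    DFunLike.coe_injective (hdense.equalizer S.continuous T.continuous (funext h))
  have hRF : ∀ m n u, R m (F n u) = F (m * n) u := by
    intro m n u
    induction u using Finsupp.induction_linear with
    | zero => simp
    | add f g hf hg => rw [map_add, map_add, map_add, hf, hg]
    | single p z =>
      have h1 : F n (Finsupp.single p z) = F 1 (Finsupp.single (L n p.1, p.2) z) := by
        simp [F, hL1]
      rw [h1, hR]
      have : L m (L n p.1) = L (m * n) p.1 := by ext; simp [L, mul_assoc]
      simp [F, this]
  have hθ : ∀ a : J, R a = θ a := by
    intro a
    refine hext _ _ fun u => ?_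
    rw [hR]
    induction u using Finsupp.induction_linear with
    | zero => simp
    | add f g hf hg => rw [map_add, map_add, map_add, hf, hg]
    | single p z =>
      have : L a p.1 = a * p.1 := by ext; simp [L]
      simp only [F, Finsupp.linearCombination_single, this, hL1, map_mul, map_smul,
        mul_apply_eq_comp]
  have hone : R 1 = 1 := hext _ _ fun u => by rw [hR]; rfl
  refine ⟨{ toFun := R
            map_one' := hone
            map_mul' := fun m n => hext _ _ fun u => by rw [mul_apply_eq_comp, hR, hR, hRF]
            map_zero' := hext _ _ fun u => by
              rw [hR]; simpa using hsmul 0 0 u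
            map_add' := fun m n => hext _ _ fun u => by rw [add_apply, hR, hR, hR, hadd]
            commutes' := fun z => hext _ _ fun u => by
              rw [hR, Algebra.algebraMap_eq_smul_one, hsmul, Algebra.algebraMap_eq_smul_one]; rfl
            map_star' := fun m => ?_ }, hθ⟩
  rw [ContinuousLinearMap.star_eq_adjoint, ContinuousLinearMap.eq_adjoint_iff]
  intro x y
  refine hdense.induction_on (p := fun x => ⟪R (star m) x, y⟫_ℂ = ⟪x, R m y⟫_ℂ) x
    (isClosed_eq (by fun_prop) (by fun_prop)) fun u => ?_
  refine hdense.induction_on (p := fun y => ⟪R (star m) (F 1 u), y⟫_ℂ = ⟪F 1 u, R m y⟫_ℂ) y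
    (isClosed_eq (by fun_prop) (by fun_prop)) fun w => ?_
  rw [hR, hR, hinner, star_star, mul_one]

end IdealExtension

/-! ### Intertwiners of covariant representations -/

section Intertwiners

variable {G : Type u} {A : Type v} [Group G] [TopologicalSpace G] [IsTopologicalGroup G]
  [CStarAlgebra A] [MulSemiringAction G A] [LocallyCompactSpace G] [MeasurableSpace G]
  [BorelSpace G]

/-- Evaluation of a bounded family of operators at a covariant representation. On the crossed
product, this is the integrated form of the covariant representation. -/
def CovariantRep.eval (R : CovariantRep G A) : CovariantFamilies G A →⋆ₐ[ℂ] (R.H →L[ℂ] R.H) where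
  toFun z := z R
  map_one' := rfl
  map_mul' _ _ := rfl
  map_zero' := rfl
  map_add' _ _ := rfl
  commutes' _ := rfl
  map_star' _ := rfl

theorem CovariantRep.norm_eval_le (R : CovariantRep G A) (z : CovariantFamilies G A) :
    ‖R.eval z‖ ≤ ‖z‖ :=
  NonUnitalStarAlgHom.norm_apply_le R.eval z

theorem CovariantRep.continuous_eval (R : CovariantRep G A) : Continuous R.eval :=
  AddMonoidHomClass.continuous_of_bound R.eval 1 fun z => by simpa using R.norm_eval_le z

theorem CovariantRep.eval_universalRep_apply (R : CovariantRep G A) (f : C_c(G, A)) (ξ : R.H) :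
    R.eval (universalRep f) ξ = ∫ s, R.rep (f s) (R.U s ξ) ∂(Measure.haar : Measure G) := rfl

theorem CovariantRep.integrated_comp {R₁ R₂ : CovariantRep G A} {X : R₁.H →L[ℂ] R₂.H}
    (hrep : ∀ a ξ, X (R₁.rep a ξ) = R₂.rep a (X ξ)) (hU : ∀ t ξ, X (R₁.U t ξ) = R₂.U t (X ξ))
    (f : C_c(G, A)) : X ∘L R₁.eval (universalRep f) = R₂.eval (universalRep f) ∘L X := by
  ext ξ
  rw [ContinuousLinearMap.comp_apply, ContinuousLinearMap.comp_apply, eval_universalRep_apply,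
    eval_universalRep_apply, ← X.integral_comp_comm (R₁.integrable_integrand f ξ)]
  simp only [hrep, hU]

/-- The adjoint of an intertwiner of covariant representations is an intertwiner. -/
theorem CovariantRep.adjoint_intertwines {R₁ R₂ : CovariantRep G A} {X : R₁.H →L[ℂ] R₂.H}
    (hrep : ∀ a ξ, X (R₁.rep a ξ) = R₂.rep a (X ξ)) (hU : ∀ t ξ, X (R₁.U t ξ) = R₂.U t (X ξ)) :
    (∀ a ξ, X.adjoint (R₂.rep a ξ) = R₁.rep a (X.adjoint ξ)) ∧
      ∀ t ξ, X.adjoint (R₂.U t ξ) = R₁.U t (X.adjoint ξ) := by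
  constructor
  · intro a ξ
    refine ext_inner_right ℂ fun η => ?_
    rw [ContinuousLinearMap.adjoint_inner_left, ← star_star a, map_star, map_star R₁.rep,
      ContinuousLinearMap.star_eq_adjoint, ContinuousLinearMap.adjoint_inner_left, ← hrep,
      ContinuousLinearMap.star_eq_adjoint, ContinuousLinearMap.adjoint_inner_left,
      ContinuousLinearMap.adjoint_inner_left]
  · intro t ξ
    refine ext_inner_right ℂ fun η => ?_
    have h1 : ∀ η, R₁.U t (R₁.U t⁻¹ η) = η := fun η => by
      have := congrArg (fun T : R₁.H ≃ₗᵢ[ℂ] R₁.H => T η) (map_mul R₁.U t t⁻¹)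
      rw [mul_inv_cancel, map_one] at this
      exact this.symm
    rw [ContinuousLinearMap.adjoint_inner_left]
    conv_lhs => rw [← h1 η, hU, LinearIsometryEquiv.inner_map_map]
    conv_rhs => rw [← h1 η, LinearIsometryEquiv.inner_map_map]
    rw [ContinuousLinearMap.adjoint_inner_left]

/-- An intertwiner of covariant representations intertwines their extensions to the crossed
product. -/
theorem CovariantRep.eval_comp {R₁ R₂ : CovariantRep G A} {X : R₁.H →L[ℂ] R₂.H}
    (hrep : ∀ a ξ, X (R₁.rep a ξ) = R₂.rep a (X ξ)) (hU : ∀ t ξ, X (R₁.U t ξ) = R₂.U t (X ξ))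
    (J : NonUnitalStarSubalgebra ℂ A) {z : CovariantFamilies G A} (hz : z ∈ crossedProductOf G J) :
    X ∘L R₁.eval z = R₂.eval z ∘L X := by
  -- the condition on `star z` makes the set of all good `z` a `*`-subalgebra
  let S : NonUnitalStarSubalgebra ℂ (CovariantFamilies G A) :=
    { carrier := {z | X ∘L R₁.eval z = R₂.eval z ∘L X ∧
        X ∘L R₁.eval (star z) = R₂.eval (star z) ∘L X}
      zero_mem' := by simp
      add_mem' := by
        rintro a b ⟨h1, h2⟩ ⟨h3, h4⟩
        simp only [Set.mem_ofPred_eq, star_add, map_add, ContinuousLinearMap.comp_add,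
          ContinuousLinearMap.add_comp, h1, h2, h3, h4, and_self]
      smul_mem' := by
        rintro c a ⟨h1, h2⟩
        simp only [Set.mem_ofPred_eq, star_smul, map_smul, ContinuousLinearMap.comp_smul,
          ContinuousLinearMap.smul_comp, h1, h2, and_self]
      mul_mem' := by
        rintro a b ⟨h1, h2⟩ ⟨h3, h4⟩
        constructor
        · rw [map_mul, map_mul, ContinuousLinearMap.mul_def, ContinuousLinearMap.mul_def,
            ← ContinuousLinearMap.comp_assoc, h1, ContinuousLinearMap.comp_assoc, h3,
            ContinuousLinearMap.comp_assoc]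
        · rw [star_mul, map_mul, map_mul, ContinuousLinearMap.mul_def, ContinuousLinearMap.mul_def,
            ← ContinuousLinearMap.comp_assoc, h4, ContinuousLinearMap.comp_assoc, h2,
            ContinuousLinearMap.comp_assoc]
      star_mem' := by
        rintro a ⟨h1, h2⟩
        exact ⟨h2, by rwa [star_star]⟩ }
  have hS : IsClosed (S : Set (CovariantFamilies G A)) := by
    refine IsClosed.inter (isClosed_eq ?_ ?_) (isClosed_eq ?_ ?_)
    · exact continuous_const.clm_comp R₁.continuous_eval
    · exact R₂.continuous_eval.clm_comp continuous_const
    · exact continuous_const.clm_comp (R₁.continuous_eval.comp continuous_star)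
    · exact (R₂.continuous_eval.comp continuous_star).clm_comp continuous_const
  have hle : crossedProductOf G J ≤ S := by
    refine NonUnitalStarSubalgebra.topologicalClosure_minimal _
      (NonUnitalStarAlgebra.adjoin_le ?_) hS
    rintro _ ⟨f, -, rfl⟩
    refine ⟨CovariantRep.integrated_comp hrep hU f, ?_⟩
    obtain ⟨h1, h2⟩ := CovariantRep.adjoint_intertwines hrep hU
    have := congrArg ContinuousLinearMap.adjoint (CovariantRep.integrated_comp h1 h2 f)
    rw [ContinuousLinearMap.adjoint_comp, ContinuousLinearMap.adjoint_comp,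
      ContinuousLinearMap.adjoint_adjoint, ← ContinuousLinearMap.star_eq_adjoint,
      ← ContinuousLinearMap.star_eq_adjoint, ← map_star, ← map_star] at this
    exact this.symm
  exact (hle hz).1

end Intertwiners

/-! ### Induced covariant representations -/

section Induction

variable {G : Type u} {A : Type v} [Group G] [TopologicalSpace G] [IsTopologicalGroup G]
  [T2Space G] [LocallyCompactSpace G] [MeasurableSpace G] [BorelSpace G]
  [CStarAlgebra A] [MulSemiringAction G A] [SMulCommClass G ℂ A] [StarSMul G A]
  [ContinuousSMul G A]

section

variable {E : Type w} [NormedAddCommGroup E] [InnerProductSpace ℂ E] [CompleteSpace E]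

theorem continuous_starAlgHom_inv_smul (ρ : A →⋆ₐ[ℂ] (E →L[ℂ] E)) (h : A) :
    Continuous fun t : G => ρ (t⁻¹ • h) := by
  have hρ : Continuous ρ :=
    AddMonoidHomClass.continuous_of_bound ρ 1 fun a => by
      simpa using NonUnitalStarAlgHom.norm_apply_le ρ a
  exact hρ.comp (continuous_inv.smul continuous_const)

theorem norm_starAlgHom_inv_smul_le (ρ : A →⋆ₐ[ℂ] (E →L[ℂ] E)) (h : A) (t : G) :
    ‖ρ (t⁻¹ • h)‖ ≤ ‖h‖ :=
  NonUnitalStarAlgHom.norm_apply_le (ρ.comp (actionHom t⁻¹)) h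

/-- The representation `(M(h)φ)(t) = ρ(t⁻¹ • h) φ(t)` on `L²(G, E)`, as in `multiplicationRep`, but
for a Hilbert space `E` in any universe. -/
def pointwiseRep (ρ : A →⋆ₐ[ℂ] (E →L[ℂ] E)) : A →⋆ₐ[ℂ] (L2Haar G E →L[ℂ] L2Haar G E) :=
  have hae : ∀ (h : A) (φ : L2Haar G E), ∀ᵐ t ∂(Measure.haar : Measure G),
      mulOperator (fun t => ρ (t⁻¹ • h)) (continuous_starAlgHom_inv_smul ρ h) ‖h‖
        (norm_starAlgHom_inv_smul_le ρ h) φ t = ρ (t⁻¹ • h) (φ t) := fun h φ =>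
    mulOperator_ae _ (continuous_starAlgHom_inv_smul ρ h) ‖h‖ (norm_starAlgHom_inv_smul_le ρ h) φ
  { toFun := fun h => mulOperator (fun t => ρ (t⁻¹ • h)) (continuous_starAlgHom_inv_smul ρ h) ‖h‖
      (norm_starAlgHom_inv_smul_le ρ h)
    map_one' := by
      ext1 φ
      refine Lp.ext ?_
      filter_upwards [hae 1 φ] with t ht
      rw [ht]
      simp
    map_mul' := fun a b => by
      ext1 φ
      refine Lp.ext ?_
      filter_upwards [hae (a * b) φ, hae a (mulOperator (fun t => ρ (t⁻¹ • b))
        (continuous_starAlgHom_inv_smul ρ b) ‖b‖ (norm_starAlgHom_inv_smul_le ρ b) φ), hae b φ]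
        with t h1 h2 h3
      rw [h1, mul_apply_eq_comp, h2, h3]
      simp
    map_zero' := by
      ext1 φ
      refine Lp.ext ?_
      filter_upwards [hae 0 φ, Lp.coeFn_zero E 2 (Measure.haar : Measure G)] with t ht h0
      rw [ht, zero_apply, h0]
      simp
    map_add' := fun a b => by
      ext1 φ
      refine Lp.ext ?_
      rw [add_apply]
      filter_upwards [hae (a + b) φ, hae a φ, hae b φ, Lp.coeFn_add (mulOperator
        (fun t => ρ (t⁻¹ • a)) (continuous_starAlgHom_inv_smul ρ a) ‖a‖
        (norm_starAlgHom_inv_smul_le ρ a) φ)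
        (mulOperator (fun t => ρ (t⁻¹ • b)) (continuous_starAlgHom_inv_smul ρ b) ‖b‖
        (norm_starAlgHom_inv_smul_le ρ b) φ)] with t h1 h2 h3 h4
      rw [h1, h4, Pi.add_apply, h2, h3]
      simp
    commutes' := fun z => by
      ext1 φ
      refine Lp.ext ?_
      rw [Algebra.algebraMap_eq_smul_one (A := L2Haar G E →L[ℂ] L2Haar G E),
        smul_apply, one_apply_eq_self]
      filter_upwards [hae (algebraMap ℂ A z) φ, Lp.coeFn_smul z φ] with t h1 h2
      rw [h1, h2, Algebra.algebraMap_eq_smul_one, smul_comm, smul_one]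
      simp
    map_star' := fun a => by
      rw [ContinuousLinearMap.star_eq_adjoint, ContinuousLinearMap.eq_adjoint_iff]
      intro φ ψ
      rw [L2.inner_def, L2.inner_def]
      refine integral_congr_ae ?_
      filter_upwards [hae (star a) φ, hae a ψ] with t h1 h2
      rw [h1, h2, StarSMul.smul_star, map_star, ContinuousLinearMap.star_eq_adjoint,
        ContinuousLinearMap.adjoint_inner_left] }

theorem pointwiseRep_ae (ρ : A →⋆ₐ[ℂ] (E →L[ℂ] E)) (h : A) (φ : L2Haar G E) :
    ∀ᵐ t ∂(Measure.haar : Measure G), pointwiseRep ρ h φ t = ρ (t⁻¹ • h) (φ t) :=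
  mulOperator_ae _ (continuous_starAlgHom_inv_smul ρ h) ‖h‖ (norm_starAlgHom_inv_smul_le ρ h) φ

end

variable {E : Type (max u v)} [NormedAddCommGroup E] [InnerProductSpace ℂ E] [CompleteSpace E]

variable (G) in
/-- The covariant representation induced from a representation `ρ`, on `L²(G, E)`. It agrees with
`regularRep`, except that the Hilbert space may be as large as those of covariant
representations, so that it is available for restrictions of covariant representations. -/
def inducedRep (ρ : A →⋆ₐ[ℂ] (E →L[ℂ] E)) (hE : Nontrivial E) : CovariantRep G A where
  H := L2Haar G E
  nontriv := nontrivial_L2Haar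
  rep := pointwiseRep ρ
  U := leftTranslation
  continuous_U := continuous_leftTranslation
  covariant s a φ := by
    refine Lp.ext ?_
    have h := (measurePreserving_mul_left (Measure.haar : Measure G) s⁻¹).quasiMeasurePreserving.ae
      (pointwiseRep_ae ρ a φ)
    filter_upwards [leftTranslation_ae s (pointwiseRep ρ a φ), h, leftTranslation_ae s φ,
      pointwiseRep_ae ρ (s • a) (leftTranslation s φ)] with t h1 h2 h3 h4
    rw [h1, h2, h4, h3, smul_smul, mul_inv_rev, inv_inv]

/-- If `V` intertwines representations of `A`, then pointwise application of `V` intertwines the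
associated representations on `L²` spaces. -/
theorem compLpL_intertwines {H : Type v} [NormedAddCommGroup H] [InnerProductSpace ℂ H]
    [CompleteSpace H] (π : A →⋆ₐ[ℂ] (H →L[ℂ] H)) (hH : Nontrivial H) (ρ : A →⋆ₐ[ℂ] (E →L[ℂ] E))
    (hE : Nontrivial E) (V : H →L[ℂ] E) (hV : ∀ a ξ, V (π a ξ) = ρ a (V ξ))
    (J : NonUnitalStarSubalgebra ℂ A) {z : CovariantFamilies G A} (hz : z ∈ crossedProductOf G J) :
    (V.compLpL 2 (Measure.haar : Measure G)) ∘L (regularRep G π hH).eval z =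
      (inducedRep G ρ hE).eval z ∘L (V.compLpL 2 (Measure.haar : Measure G)) := by
  refine CovariantRep.eval_comp (R₁ := regularRep G π hH) (R₂ := inducedRep G ρ hE) ?_ ?_ J hz
  · intro a φ
    refine Lp.ext ?_
    filter_upwards [V.coeFn_compLpL (multiplicationRep π a φ), multiplicationRep_ae π a φ,
      pointwiseRep_ae ρ a (V.compLpL 2 (Measure.haar : Measure G) φ), V.coeFn_compLpL φ]
      with t h1 h2 h3 h4
    refine h1.trans (Eq.trans ?_ h3.symm)
    rw [h2, h4, hV]
  · intro s φ
    refine Lp.ext ?_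
    have h := (measurePreserving_mul_left (Measure.haar : Measure G) s⁻¹).quasiMeasurePreserving.ae
      (V.coeFn_compLpL φ)
    filter_upwards [V.coeFn_compLpL (leftTranslation s φ), leftTranslation_ae s φ, h,
      leftTranslation_ae s (V.compLpL 2 (Measure.haar : Measure G) φ)] with t h1 h2 h3 h4
    refine h1.trans (Eq.trans ?_ h4.symm)
    rw [h2, h3]

end Induction

/-! ### Evaluation of sections at points -/

section Trivialization

variable {M H₀ : Type v} [CStarAlgebra M] [NormedAddCommGroup H₀] [InnerProductSpace ℂ H₀]
  [CompleteSpace H₀] {X : Type*} [TopologicalSpace X] {J : NonUnitalStarSubalgebra ℂ M}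
  (Φ : J ≃⋆ₐ[ℂ] C₀(X, compactOperators H₀))

theorem trivialization_add (a b : J) : Φ (a + b) = Φ a + Φ b := Φ.map_add' a b

theorem trivialization_mul (a b : J) : Φ (a * b) = Φ a * Φ b := Φ.map_mul' a b

theorem trivialization_star (a : J) : Φ (star a) = star (Φ a) := Φ.map_star' a

theorem trivialization_smul (c : ℂ) (a : J) : Φ (c • a) = c • Φ a := Φ.map_smul' c a

theorem trivialization_zero : Φ 0 = 0 := by
  have := trivialization_smul Φ 0 0
  rwa [zero_smul, zero_smul] at this

/-- The isomorphism `Φ` as a homomorphism of non-unital `*`-algebras, which makes the lemmas on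
such homomorphisms available. -/
def trivializationHom : J →⋆ₙₐ[ℂ] C₀(X, compactOperators H₀) where
  toFun a := Φ a
  map_smul' := trivialization_smul Φ
  map_zero' := trivialization_zero Φ
  map_add' := trivialization_add Φ
  map_mul' := trivialization_mul Φ
  map_star' := trivialization_star Φ

theorem norm_trivialization [IsClosed (J : Set M)] (a : J) : ‖Φ a‖ = ‖a‖ :=
  NonUnitalStarAlgHom.norm_map (trivializationHom Φ) Φ.injective a

/-- Evaluation at a point, as a representation of `J`. -/
def evalAt (x : X) : J →⋆ₙₐ[ℂ] (H₀ →L[ℂ] H₀) where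
  toFun a := Φ a x
  map_smul' c a := by rw [trivialization_smul]; rfl
  map_zero' := by rw [trivialization_zero]; rfl
  map_add' a b := by rw [trivialization_add]; rfl
  map_mul' a b := by rw [trivialization_mul]; rfl
  map_star' a := by rw [trivialization_star]; rfl

theorem evalAt_apply (x : X) (a : J) : evalAt Φ x a = Φ a x := rfl

theorem evalAt_eq_zero (x : X) (a : J) : evalAt Φ x a = 0 ↔ Φ a x = 0 := by
  rw [evalAt_apply]
  exact ZeroMemClass.coe_eq_zero

/-- At a point where some section does not vanish, the sections take all values. -/
theorem exists_trivialization_apply_eq {x : X} (hx : ∃ a, Φ a x ≠ 0) (k : compactOperators H₀) :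
    ∃ a, Φ a x = k := by
  obtain ⟨a, ha⟩ := hx
  have h0 : Tendsto (fun y => ‖Φ a y‖) (cocompact X) (nhds 0) :=
    tendsto_zero_iff_norm_tendsto_zero.1 (Φ a).zero_at_infty'
  -- the norm of `Φ a` is a scalar function vanishing at infinity which is nonzero at `x`
  let F : C₀(X, compactOperators H₀) :=
    { toFun := fun y => ((‖Φ a y‖ / ‖Φ a x‖ : ℝ) : ℂ) • k
      continuous_toFun := by
        have := (map_continuous (Φ a)).norm
        fun_prop
      zero_at_infty' := by
        have h1 : Tendsto (fun y => ((‖Φ a y‖ / ‖Φ a x‖ : ℝ) : ℂ)) (cocompact X) (nhds 0) := by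
          have h2 : Tendsto (fun y => ‖Φ a y‖ / ‖Φ a x‖) (cocompact X) (nhds 0) := by
            simpa using h0.div_const ‖Φ a x‖
          have := (Complex.continuous_ofReal.tendsto 0).comp h2
          rwa [Complex.ofReal_zero] at this
        simpa using h1.smul_const k }
  refine ⟨Φ.symm F, ?_⟩
  rw [StarAlgEquiv.apply_symm_apply]
  change ((‖Φ a x‖ / ‖Φ a x‖ : ℝ) : ℂ) • k = k
  rw [div_self (norm_ne_zero_iff.2 ha)]
  simp

variable {Φ} in
theorem exists_trivialization_apply_apply_eq [Nontrivial H₀] {x : X} (hx : ∃ a, Φ a x ≠ 0)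
    {ξ : H₀} (hξ : ξ ≠ 0) (η : H₀) : ∃ a, (Φ a x : H₀ →L[ℂ] H₀) ξ = η := by
  obtain ⟨a, ha⟩ := exists_trivialization_apply_eq Φ hx (compactRankOne ((‖ξ‖ ^ 2 : ℂ)⁻¹ • η) ξ)
  refine ⟨a, ?_⟩
  rw [ha, compactRankOne_apply, inner_self_eq_norm_sq_to_K, smul_smul]
  have : (‖ξ‖ : ℂ) ^ 2 ≠ 0 := by simpa using hξ
  change ((‖ξ‖ : ℂ) ^ 2 * ((‖ξ‖ : ℂ) ^ 2)⁻¹) • η = η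
  rw [mul_inv_cancel₀ this, one_smul]

/-- Evaluation at a point extends to an irreducible representation of `M`. -/
theorem exists_irreducible_extension [Nontrivial H₀]
    (hJ : ∀ a ∈ J, ∀ x : M, x * a ∈ J ∧ a * x ∈ J) {x : X} (hx : ∃ a, Φ a x ≠ 0) :
    ∃ κ : M →⋆ₐ[ℂ] (H₀ →L[ℂ] H₀), IsIrreducibleRep κ ∧ ∀ a : J, κ a = Φ a x := by
  obtain ⟨κ, hκ⟩ := exists_extension_of_ideal J hJ (evalAt Φ x) (by
    obtain ⟨ξ, hξ⟩ := exists_ne (0 : H₀)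
    refine top_unique fun η _ => ?_
    obtain ⟨a, ha⟩ := exists_trivialization_apply_apply_eq hx hξ η
    exact Submodule.le_topologicalClosure _ (Submodule.subset_span ⟨a, ξ, ha⟩))
  refine ⟨κ, ⟨inferInstance, fun p _ hp => ?_⟩, hκ⟩
  by_cases h : p = ⊥
  · exact .inl h
  · obtain ⟨ξ, hξp, hξ⟩ := p.ne_bot_iff.1 h
    refine .inr (top_unique fun η _ => ?_)
    obtain ⟨a, ha⟩ := exists_trivialization_apply_apply_eq hx hξ η
    have := hp a ξ hξp
    rw [hκ, evalAt_apply, ha] at this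
    exact this

/-- Vanishing at a point is preserved under multiplication by elements of `M`, because evaluation
at the point extends to `M`. -/
theorem apply_mul_eq_zero [Nontrivial H₀]
    (hJ : ∀ a ∈ J, ∀ x : M, x * a ∈ J ∧ a * x ∈ J) {x : X} {a : J} (ha : Φ a x = 0) (m : M) :
    Φ ⟨m * a, (hJ a a.2 m).1⟩ x = 0 ∧ Φ ⟨a * m, (hJ a a.2 m).2⟩ x = 0 := by
  by_cases hx : ∃ a, Φ a x ≠ 0
  · obtain ⟨κ, -, hκ⟩ := exists_irreducible_extension Φ hJ hx
    have ha' : κ a = 0 := by rw [hκ, ha]; rfl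
    constructor
    · refine Subtype.ext ((hκ _).symm.trans ?_)
      simp [ha']
    · refine Subtype.ext ((hκ _).symm.trans ?_)
      simp [ha']
  · push Not at hx
    exact ⟨hx _, hx _⟩

/-- The ideal of all elements of `J` which vanish outside of `O`. -/
def idealOn [Nontrivial H₀] (hJ : ∀ a ∈ J, ∀ x : M, x * a ∈ J ∧ a * x ∈ J) (O : Set X) :
    TwoSidedIdeal M :=
  .mk' {m | ∃ h : m ∈ J, ∀ x ∉ O, Φ ⟨m, h⟩ x = 0}
    ⟨zero_mem J, fun x _ => by
      have : (⟨0, zero_mem J⟩ : J) = 0 := rfl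
      rw [this, trivialization_zero]; rfl⟩
    (by
      rintro a b ⟨ha, ha'⟩ ⟨hb, hb'⟩
      refine ⟨add_mem ha hb, fun x hx => ?_⟩
      have : (⟨a + b, add_mem ha hb⟩ : J) = ⟨a, ha⟩ + ⟨b, hb⟩ := rfl
      rw [this, trivialization_add, ZeroAtInftyContinuousMap.add_apply, ha' x hx, hb' x hx,
        add_zero])
    (by
      rintro a ⟨ha, ha'⟩
      refine ⟨neg_mem ha, fun x hx => (evalAt_eq_zero Φ x _).1 ?_⟩
      have : (⟨-a, neg_mem ha⟩ : J) = -⟨a, ha⟩ := rfl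
      rw [this, map_neg, (evalAt_eq_zero Φ x _).2 (ha' x hx), neg_zero])
    (by
      rintro m a ⟨ha, ha'⟩
      exact ⟨(hJ a ha m).1, fun x hx => (apply_mul_eq_zero Φ hJ (ha' x hx) m).1⟩)
    (by
      rintro a m ⟨ha, ha'⟩
      exact ⟨(hJ a ha m).2, fun x hx => (apply_mul_eq_zero Φ hJ (ha' x hx) m).2⟩)

theorem mem_idealOn [Nontrivial H₀] (hJ : ∀ a ∈ J, ∀ x : M, x * a ∈ J ∧ a * x ∈ J) (O : Set X)
    (m : M) : m ∈ idealOn Φ hJ O ↔ ∃ h : m ∈ J, ∀ x ∉ O, Φ ⟨m, h⟩ x = 0 := by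
  rw [idealOn, TwoSidedIdeal.mem_mk']
  rfl

/-- If some section does not vanish at `x`, then there is one with support in a given neighbourhood
of `x`. -/
theorem exists_supported_apply_ne_zero [T2Space X] [NormalSpace X] {x : X} {O : Set X}
    (hO : IsOpen O) (hxO : x ∈ O) {a : J} (ha : Φ a x ≠ 0) :
    ∃ b, Φ b x ≠ 0 ∧ ∀ y ∉ O, Φ b y = 0 := by
  obtain ⟨g, hg0, hg1, hg⟩ := exists_continuous_zero_one_of_isClosed hO.isClosed_compl
    (isClosed_singleton (x := x)) (by simpa using hxO)
  have hg' : ∀ y, |g y| ≤ 1 := fun y => by rw [abs_of_nonneg (hg y).1]; exact (hg y).2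
  refine ⟨Φ.symm ((Φ a).scalarMul g hg'), ?_, fun y hy => ?_⟩
  · rw [StarAlgEquiv.apply_symm_apply, ZeroAtInftyContinuousMap.scalarMul_apply,
      hg1 (Set.mem_singleton x)]
    simpa using ha
  · rw [StarAlgEquiv.apply_symm_apply, ZeroAtInftyContinuousMap.scalarMul_apply, hg0 hy]
    simp

end Trivialization

/-! ### Decomposition and truncation of sections -/

section Trivialization

variable {M H₀ : Type v} [CStarAlgebra M] [NormedAddCommGroup H₀] [InnerProductSpace ℂ H₀]
  [CompleteSpace H₀] {X : Type*} [TopologicalSpace X] {J : NonUnitalStarSubalgebra ℂ M}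
  (Φ : J ≃⋆ₐ[ℂ] C₀(X, compactOperators H₀))

theorem norm_evalAt_le [IsClosed (J : Set M)] (x : X) (a : J) : ‖evalAt Φ x a‖ ≤ ‖a‖ :=
  ((Φ a).norm_apply_le x).trans (norm_trivialization Φ a).le

theorem norm_le_of_evalAt_le [IsClosed (J : Set M)] {a : J} {ε : ℝ} (hε : 0 ≤ ε)
    (h : ∀ x, ‖evalAt Φ x a‖ ≤ ε) : ‖a‖ ≤ ε :=
  (norm_trivialization Φ a).symm.le.trans ((Φ a).norm_le_of_forall hε h)

theorem continuous_evalAt (a : J) : Continuous fun x => evalAt Φ x a :=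
  continuous_subtype_val.comp (map_continuous (Φ a))

theorem isCompact_setOf_le_norm_evalAt (a : J) {ε : ℝ} (hε : 0 < ε) :
    IsCompact {x | ε ≤ ‖evalAt Φ x a‖} :=
  (Φ a).isCompact_setOf_le_norm hε

theorem exists_scalarMul (g : C(X, ℝ)) (hg : ∀ x, |g x| ≤ 1) (a : J) :
    ∃ b : J, ∀ x, evalAt Φ x b = (g x : ℂ) • evalAt Φ x a :=
  ⟨Φ.symm ((Φ a).scalarMul g hg), fun x => by
    rw [evalAt_apply, StarAlgEquiv.apply_symm_apply, ZeroAtInftyContinuousMap.scalarMul_apply]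
    rfl⟩

theorem eq_of_evalAt_eq {a b : J} (h : ∀ x, evalAt Φ x a = evalAt Φ x b) : a = b :=
  Φ.injective (DFunLike.ext _ _ fun x => Subtype.ext (h x))

/-- Up to `ε`, an element is a finite sum of elements supported in the members of a given open
cover. -/
theorem exists_sum_supported [IsClosed (J : Set M)] [T2Space X] [NormalSpace X] {ι : Type*}
    (U : ι → Set X) (hU : ∀ i, IsOpen (U i)) (hc : ⋃ i, U i = Set.univ) (a : J) {ε : ℝ}
    (hε : 0 < ε) : ∃ (t : Finset ι) (b : t → J),
      (∀ (i : t), ∀ x ∉ U i, evalAt Φ x (b i) = 0) ∧ ‖a - ∑ i, b i‖ ≤ ε := by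
  obtain ⟨t, g, hg, hgU, h⟩ := (Φ a).exists_sum_scalarMul U hU hc hε
  choose b hb using fun i => exists_scalarMul Φ (g i) (hg i) a
  refine ⟨t, b, fun i x hx => by rw [hb, hgU i x hx]; simp, ?_⟩
  have hΦb : ∀ i, Φ (b i) = (Φ a).scalarMul (g i) (hg i) := fun i =>
    DFunLike.ext _ _ fun x => Subtype.ext (hb i x)
  have h1 : Φ (a - ∑ i, b i) = Φ a - ∑ i, (Φ a).scalarMul (g i) (hg i) := by
    have h2 : Φ (a - ∑ i, b i) = trivializationHom Φ (a - ∑ i, b i) := rfl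
    rw [h2, map_sub, map_sum]
    congr 1
    exact Finset.sum_congr rfl fun i _ => hΦb i
  rwa [← norm_trivialization Φ, h1]

variable {Φ} in
/-- Truncation: an element is, up to `ε`, an element vanishing where the values are smaller than
`ε`. -/
theorem exists_truncation [IsClosed (J : Set M)] (a : J) {ε : ℝ} (hε : 0 < ε) :
    ∃ b : J, (∀ x, ‖evalAt Φ x a‖ < ε → evalAt Φ x b = 0) ∧ ‖a - b‖ ≤ ε := by
  have hmax : ∀ x, 0 < max ‖evalAt Φ x a‖ ε := fun x => lt_max_of_lt_right hε
  let g : C(X, ℝ) := ⟨fun x => 1 - ε / max ‖evalAt Φ x a‖ ε,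
    continuous_const.sub (continuous_const.div
      ((continuous_evalAt Φ a).norm.max continuous_const) fun x => (hmax x).ne')⟩
  have hle : ∀ x, ε / max ‖evalAt Φ x a‖ ε ≤ 1 := fun x =>
    (div_le_one (hmax x)).2 (le_max_right _ _)
  have hg : ∀ x, |g x| ≤ 1 := fun x => by
    have h0 : 0 ≤ ε / max ‖evalAt Φ x a‖ ε := div_nonneg hε.le (hmax x).le
    rw [abs_le]
    constructor <;> simp only [g, ContinuousMap.coe_mk] <;> linarith [hle x]
  obtain ⟨b, hb⟩ := exists_scalarMul Φ g hg a
  refine ⟨b, fun x hx => ?_, norm_le_of_evalAt_le Φ hε.le fun x => ?_⟩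
  · have : g x = 0 := by simp [g, max_eq_right hx.le, div_self hε.ne']
    rw [hb, this]
    simp
  · have : evalAt Φ x (a - b) = ((ε / max ‖evalAt Φ x a‖ ε : ℝ) : ℂ) • evalAt Φ x a := by
      rw [map_sub, hb]
      nth_rw 1 [← one_smul ℂ (evalAt Φ x a)]
      rw [← sub_smul]
      congr 1
      simp [g]
    rw [this, norm_smul, Complex.norm_real, Real.norm_of_nonneg (div_nonneg hε.le (hmax x).le),
      div_mul_eq_mul_div, div_le_iff₀ (hmax x)]
    exact mul_le_mul_of_nonneg_left (le_max_left _ _) hε.le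

/-- An irreducible representation which does not vanish on `J` factors, on `J`, through evaluation
at a point. -/
theorem exists_point_of_irreducible [IsClosed (J : Set M)] [T2Space X] [NormalSpace X]
    [Nontrivial H₀] (hJ : ∀ a ∈ J, ∀ x : M, x * a ∈ J ∧ a * x ∈ J) (σ : IrrepOf M)
    (hσ : ∃ a ∈ J, σ.rep a ≠ 0) :
    ∃ x : X, ∀ a : J, evalAt Φ x a = 0 → σ.rep (a : M) = 0 := by
  have hnorm : ∀ m, ‖σ.rep m‖ ≤ ‖m‖ := fun m => NonUnitalStarAlgHom.norm_apply_le σ.rep m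
  -- a point `x` such that the sections supported in any neighbourhood of `x` act nontrivially
  obtain ⟨x, hx⟩ : ∃ x : X, ∀ O, IsOpen O → x ∈ O →
      ∃ b : J, (∀ y ∉ O, evalAt Φ y b = 0) ∧ σ.rep (b : M) ≠ 0 := by
    by_contra! h
    obtain ⟨a, haJ, ha⟩ := hσ
    choose O hO hxO hb using h
    obtain ⟨t, b, hbO, hab⟩ := exists_sum_supported Φ O hO
      (Set.eq_univ_of_forall fun x => Set.mem_iUnion.2 ⟨x, hxO x⟩) ⟨a, haJ⟩
      (half_pos (norm_pos_iff.2 ha))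
    have h1 : σ.rep (((⟨a, haJ⟩ : J) - ∑ i, b i : J) : M) = σ.rep a := by
      have : (((⟨a, haJ⟩ : J) - ∑ i, b i : J) : M) = a - ∑ i, (b i : M) := by
        rw [AddSubgroupClass.coe_sub, AddSubmonoidClass.coe_finsetSum]
      rw [this, map_sub, map_sum, Finset.sum_eq_zero fun (i : t) _ => hb i (b i) (hbO i),
        sub_zero]
    have h2 := hnorm (((⟨a, haJ⟩ : J) - ∑ i, b i : J) : M)
    rw [h1] at h2
    have h3 : ‖σ.rep a‖ ≤ ‖σ.rep a‖ / 2 := h2.trans hab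
    linarith [norm_pos_iff.2 ha]
  refine ⟨x, fun a ha => ?_⟩
  -- a section `a` with `Φ a x = 0` is close to sections `a'` which vanish near `x`, so that
  -- `b c a'` is zero for all `c` if `b` is supported near `x`; this contradicts irreducibility
  by_contra hne
  set ε := ‖σ.rep (a : M)‖ / 2 with hε
  have hε0 : 0 < ε := half_pos (norm_pos_iff.2 hne)
  obtain ⟨a', ha', haa'⟩ := exists_truncation (Φ := Φ) a hε0
  have hne' : σ.rep (a' : M) ≠ 0 := by
    intro h0
    have h1 : σ.rep ((a - a' : J) : M) = σ.rep a := by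
      rw [AddSubgroupClass.coe_sub, map_sub, h0, sub_zero]
    have h2 := hnorm ((a - a' : J) : M)
    rw [h1] at h2
    have h3 : ‖σ.rep (a : M)‖ ≤ ‖σ.rep (a : M)‖ / 2 := h2.trans haa'
    linarith
  obtain ⟨b, hb, hb'⟩ := hx {y | ‖evalAt Φ y a‖ < ε}
    (isOpen_lt (continuous_evalAt Φ a).norm continuous_const) (by simpa [ha] using hε0)
  obtain ⟨c, hc⟩ := CStarSpectrum.exists_mul_mul_ne_zero σ hb' hne'
  apply hc
  have h0 : b * ⟨c * a', (hJ a' a'.2 c).1⟩ = 0 := eq_of_evalAt_eq Φ fun y => by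
    rw [map_mul, map_zero]
    by_cases hy : ‖evalAt Φ y a‖ < ε
    · have := (apply_mul_eq_zero Φ hJ ((evalAt_eq_zero Φ y a').1 (ha' y hy)) c).1
      rw [(evalAt_eq_zero Φ y _).2 this, mul_zero]
    · rw [hb y hy, zero_mul]
  have h1 : (b : M) * c * a' = ((b * ⟨c * a', (hJ a' a'.2 c).1⟩ : J) : M) := by
    simp [mul_assoc]
  rw [h1, h0]
  simp

end Trivialization

/-! ### The spectrum of the ideal and the base space -/

section Trivialization

variable {M H₀ : Type v} [CStarAlgebra M] [NormedAddCommGroup H₀] [InnerProductSpace ℂ H₀]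
  [CompleteSpace H₀] {X : Type*} [TopologicalSpace X] {J : NonUnitalStarSubalgebra ℂ M}
  (Φ : J ≃⋆ₐ[ℂ] C₀(X, compactOperators H₀))

theorem CStarSpectrum.mk_mem_nonvanishing (S : Set M) {H : Type v} [NormedAddCommGroup H]
    [InnerProductSpace ℂ H] [CompleteSpace H] (π : M →⋆ₐ[ℂ] (H →L[ℂ] H))
    (hπ : IsIrreducibleRep π) :
    CStarSpectrum.mk π hπ ∈ CStarSpectrum.nonvanishing S ↔ ∃ a ∈ S, π a ≠ 0 := Iff.rfl

theorem CStarSpectrum.exists_linearIsometryEquiv_of_mk_eq {H K : Type v} [NormedAddCommGroup H]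
    [InnerProductSpace ℂ H] [CompleteSpace H] [NormedAddCommGroup K]
    [InnerProductSpace ℂ K] [CompleteSpace K] {π : M →⋆ₐ[ℂ] (H →L[ℂ] H)}
    {hπ : IsIrreducibleRep π} {κ : M →⋆ₐ[ℂ] (K →L[ℂ] K)} {hκ : IsIrreducibleRep κ}
    (h : CStarSpectrum.mk π hπ = CStarSpectrum.mk κ hκ) :
    ∃ W : H ≃ₗᵢ[ℂ] K, ∀ a ξ, W (π a ξ) = κ a (W ξ) :=
  Quotient.exact (s := IrrepOf.setoid M) h

theorem starAlgHom_eq_zero_iff_of_intertwines {H K : Type*} [NormedAddCommGroup H]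
    [InnerProductSpace ℂ H] [NormedAddCommGroup K] [InnerProductSpace ℂ K] {S : H →L[ℂ] H}
    {T : K →L[ℂ] K} (W : H ≃ₗᵢ[ℂ] K) (hW : ∀ ξ, W (S ξ) = T (W ξ)) : S = 0 ↔ T = 0 := by
  constructor
  · rintro rfl
    ext ξ
    simpa using (hW (W.symm ξ)).symm
  · rintro rfl
    ext ξ
    simpa using hW ξ

/-- If the kernel of `κ` in `J` is contained in that of `π`, then `[π]` is in the closure of `[κ]`.
In a Hausdorff subspace of the spectrum, this means that `[κ] = [π]`. -/
theorem CStarSpectrum.specializes_of_ker_le (hJ : ∀ a ∈ J, ∀ x : M, x * a ∈ J ∧ a * x ∈ J)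
    {H K : Type v} [NormedAddCommGroup H]
    [InnerProductSpace ℂ H] [CompleteSpace H] [NormedAddCommGroup K]
    [InnerProductSpace ℂ K] [CompleteSpace K] {π : M →⋆ₐ[ℂ] (H →L[ℂ] H)}
    {hπ : IsIrreducibleRep π} {κ : M →⋆ₐ[ℂ] (K →L[ℂ] K)} {hκ : IsIrreducibleRep κ}
    (hπJ : ∃ a ∈ J, π a ≠ 0) (h : ∀ a ∈ J, κ a = 0 → π a = 0) :
    CStarSpectrum.mk κ hκ ⤳ CStarSpectrum.mk π hπ := by
  rw [specializes_iff_forall_open]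
  rintro _ ⟨I, rfl⟩ hI
  rw [CStarSpectrum.mk_mem_nonvanishing] at hI ⊢
  obtain ⟨i, hi, hi0⟩ := hI
  obtain ⟨a, ha, ha0⟩ := hπJ
  obtain ⟨c, hc⟩ := CStarSpectrum.exists_mul_mul_ne_zero ⟨H, π, hπ⟩ hi0 ha0
  refine ⟨i * c * a, I.mul_mem_right _ _ (I.mul_mem_right _ _ hi), fun h0 => hc ?_⟩
  exact h _ (hJ a ha (i * c)).1 h0

/-- Every point of the spectrum of `J` is the class of an extension of an evaluation to `M`. The
points of `X` play two roles, as points of the spectrum by means of `ι`, and as points at which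
sections are evaluated; these need not match, and `x` may be different from `y`. -/
theorem exists_point_mk_eq [IsClosed (J : Set M)] [T2Space X] [NormalSpace X]
    [Nontrivial H₀] (hJ : ∀ a ∈ J, ∀ x : M, x * a ∈ J ∧ a * x ∈ J) {ι : X → CStarSpectrum M}
    (hι : Topology.IsEmbedding ι) (hr : Set.range ι = CStarSpectrum.nonvanishing (J : Set M))
    {π : M →⋆ₐ[ℂ] (H₀ →L[ℂ] H₀)} (hπ : IsIrreducibleRep π) {y : X}
    (hy : CStarSpectrum.mk π hπ = ι y) :
    ∃ (x : X) (κ : M →⋆ₐ[ℂ] (H₀ →L[ℂ] H₀)) (hκ : IsIrreducibleRep κ),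
      (∀ a : J, κ a = evalAt Φ x a) ∧ CStarSpectrum.mk κ hκ = ι y := by
  have hπJ : ∃ a ∈ J, π a ≠ 0 := by
    have : ι y ∈ CStarSpectrum.nonvanishing (J : Set M) := hr ▸ Set.mem_range_self y
    rwa [← hy, CStarSpectrum.mk_mem_nonvanishing] at this
  obtain ⟨x, hx⟩ := exists_point_of_irreducible Φ hJ ⟨H₀, π, hπ⟩ hπJ
  have hx0 : ∃ a, Φ a x ≠ 0 := by
    by_contra! h
    obtain ⟨a, ha, ha0⟩ := hπJ
    exact ha0 (hx ⟨a, ha⟩ ((evalAt_eq_zero Φ x _).2 (h _)))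
  obtain ⟨κ, hκ, hκa⟩ := exists_irreducible_extension Φ hJ hx0
  have hsp : CStarSpectrum.mk κ hκ ⤳ CStarSpectrum.mk π hπ :=
    CStarSpectrum.specializes_of_ker_le hJ hπJ fun a ha h0 => hx ⟨a, ha⟩ (by
      rw [← h0, hκa ⟨a, ha⟩]; rfl)
  obtain ⟨z, hz⟩ : CStarSpectrum.mk κ hκ ∈ Set.range ι := by
    rw [hr, CStarSpectrum.mk_mem_nonvanishing]
    obtain ⟨a, ha⟩ := hx0
    refine ⟨a, a.2, fun h0 => ha ((evalAt_eq_zero Φ x a).1 ?_)⟩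
    rw [← h0, hκa]; rfl
  rw [← hz, hy, hι.isInducing.specializes_iff] at hsp
  exact ⟨x, κ, hκ, hκa, by rw [← hz, hsp.eq]⟩

variable [IsClosed (J : Set M)] [T2Space X] [NormalSpace X] [Nontrivial H₀]

/-- The point of the spectrum with the label `y` is evaluation at `τ y`, for an open embedding `τ`
of the base space into itself. If `X` is not locally compact at some point, then all functions in
`C₀(X, K(H₀))` vanish there; this is why `τ` is only claimed to reach the points where some section
does not vanish. -/
theorem exists_isOpenEmbedding_spectrum
    (hJ : ∀ a ∈ J, ∀ x : M, x * a ∈ J ∧ a * x ∈ J) {ι : X → CStarSpectrum M}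
    (hι : Topology.IsEmbedding ι) (hr : Set.range ι = CStarSpectrum.nonvanishing (J : Set M))
    (π : X → M →⋆ₐ[ℂ] (H₀ →L[ℂ] H₀)) (hπ : ∀ y, IsIrreducibleRep (π y))
    (hπι : ∀ y, CStarSpectrum.mk (π y) (hπ y) = ι y) :
    ∃ τ : X → X, Topology.IsOpenEmbedding τ ∧ (∀ x, (∃ a, Φ a x ≠ 0) → x ∈ Set.range τ) ∧
      ∀ y, ∃ W : H₀ ≃ₗᵢ[ℂ] H₀, ∀ (a : J) ξ, W (evalAt Φ (τ y) a ξ) = π y a (W ξ) := by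
  choose τ κ hκ hκe hκι using fun y => exists_point_mk_eq Φ hJ hι hr (hπ y) (hπι y)
  have hW : ∀ y, ∃ W : H₀ ≃ₗᵢ[ℂ] H₀, ∀ (a : J) ξ,
      W (evalAt Φ (τ y) a ξ) = π y a (W ξ) := by
    intro y
    obtain ⟨W, hW⟩ := CStarSpectrum.exists_linearIsometryEquiv_of_mk_eq
      ((hκι y).trans (hπι y).symm)
    exact ⟨W, fun a ξ => by rw [← hκe, hW]⟩
  have hzero : ∀ y (a : J), evalAt Φ (τ y) a = 0 ↔ π y a = 0 := by
    intro y a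
    obtain ⟨W, hW⟩ := hW y
    exact starAlgHom_eq_zero_iff_of_intertwines W (hW a)
  have hπJ : ∀ y, ∃ a : J, π y a ≠ 0 := by
    intro y
    have : ι y ∈ CStarSpectrum.nonvanishing (J : Set M) := hr ▸ Set.mem_range_self y
    rw [← hπι, CStarSpectrum.mk_mem_nonvanishing] at this
    obtain ⟨a, ha, h⟩ := this
    exact ⟨⟨a, ha⟩, h⟩
  have hrange : ∀ x, (∃ a, Φ a x ≠ 0) → x ∈ Set.range τ := by
    intro x hx
    obtain ⟨κ', hκ', hκa'⟩ := exists_irreducible_extension Φ hJ hx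
    obtain ⟨y, hy⟩ : CStarSpectrum.mk κ' hκ' ∈ Set.range ι := by
      rw [hr, CStarSpectrum.mk_mem_nonvanishing]
      obtain ⟨a, ha⟩ := hx
      exact ⟨a, a.2, fun h0 => ha ((evalAt_eq_zero Φ x a).1 (by rw [← h0, hκa']; rfl))⟩
    obtain ⟨W, hW⟩ := CStarSpectrum.exists_linearIsometryEquiv_of_mk_eq
      (hy.symm.trans (hκι y).symm)
    refine ⟨y, ?_⟩
    by_contra hne
    obtain ⟨a, ha⟩ := hx
    obtain ⟨b, hb, hb'⟩ := exists_supported_apply_ne_zero Φ (O := {τ y}ᶜ)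
      isClosed_singleton.isOpen_compl (x := x) (fun h => hne h.symm) ha
    have h1 := hb' (τ y) (by simp)
    rw [← evalAt_eq_zero, ← hκe] at h1
    rw [← starAlgHom_eq_zero_iff_of_intertwines W (hW b), hκa'] at h1
    exact hb ((evalAt_eq_zero Φ x b).1 h1)
  have hinj : Function.Injective τ := by
    intro y y' h
    obtain ⟨a, ha⟩ := hπJ y
    have hsp : ι y ⤳ ι y' := by
      rw [← hπι, ← hπι]
      refine CStarSpectrum.specializes_of_ker_le hJ ?_ fun a ha h0 => ?_
      · obtain ⟨a, ha⟩ := hπJ y'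
        exact ⟨a, a.2, ha⟩
      · exact (hzero y' ⟨a, ha⟩).1 (h ▸ (hzero y ⟨a, ha⟩).2 h0)
    rw [hι.isInducing.specializes_iff] at hsp
    exact hsp.eq
  have hcont : Continuous τ := by
    refine continuous_def.2 fun O hO => ?_
    -- the preimage of `O` is given by the ideal of the sections which vanish outside of `O`
    have : τ ⁻¹' O = ι ⁻¹' (CStarSpectrum.nonvanishing (idealOn Φ hJ O : Set M)) := by
      ext y
      rw [Set.mem_preimage, Set.mem_preimage, ← hπι, CStarSpectrum.mk_mem_nonvanishing]
      constructor
      · intro hy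
        obtain ⟨a, ha⟩ := hπJ y
        rw [Ne, ← hzero, evalAt_eq_zero] at ha
        obtain ⟨b, hb, hb'⟩ := exists_supported_apply_ne_zero Φ hO hy ha
        refine ⟨b, (mem_idealOn Φ hJ O b).2 ⟨b.2, hb'⟩, ?_⟩
        rwa [Ne, ← hzero, evalAt_eq_zero]
      · rintro ⟨b, hb, hb0⟩
        obtain ⟨hbJ, hbO⟩ := (mem_idealOn Φ hJ O b).1 hb
        by_contra hy
        exact hb0 ((hzero y ⟨b, hbJ⟩).1 ((evalAt_eq_zero Φ _ _).2 (hbO _ hy)))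
    rw [this]
    exact hι.continuous.isOpen_preimage _ ⟨_, rfl⟩
  have hopen : IsOpenMap τ := by
    intro V hV
    obtain ⟨_, ⟨I, rfl⟩, rfl⟩ := hι.isInducing.isOpen_iff.1 hV
    have : τ '' (ι ⁻¹' CStarSpectrum.nonvanishing (I : Set M)) =
        ⋃ (i : I) (a : J), {x | evalAt Φ x ⟨i * a, (hJ a a.2 i).1⟩ ≠ 0} := by
      ext x
      simp only [Set.mem_iUnion]
      constructor
      · rintro ⟨y, hy, rfl⟩
        rw [Set.mem_preimage, ← hπι, CStarSpectrum.mk_mem_nonvanishing] at hy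
        obtain ⟨i, hi, hi0⟩ := hy
        obtain ⟨a, ha⟩ := hπJ y
        obtain ⟨c, hc⟩ := CStarSpectrum.exists_mul_mul_ne_zero ⟨H₀, π y, hπ y⟩ hi0 ha
        exact ⟨⟨i * c, I.mul_mem_right _ _ hi⟩, a, fun h0 => hc ((hzero y _).1 h0)⟩
      · rintro ⟨i, a, hx⟩
        obtain ⟨y, rfl⟩ := hrange x ⟨_, fun h0 => hx ((evalAt_eq_zero Φ x _).2 h0)⟩
        refine ⟨y, ?_, rfl⟩
        rw [Set.mem_preimage, ← hπι, CStarSpectrum.mk_mem_nonvanishing]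
        refine ⟨i, i.2, fun h0 => hx ((hzero y _).2 ?_)⟩
        rw [map_mul, h0, zero_mul]
    rw [this]
    exact isOpen_iUnion fun i => isOpen_iUnion fun a =>
      isOpen_ne_fun (continuous_evalAt Φ _) continuous_const
  exact ⟨τ, .of_continuous_injective_isOpenMap hcont hinj hopen, hrange, hW⟩

/-- A trivialization can be pulled back along an open embedding whose range contains all points
where some section does not vanish. -/
theorem exists_trivialization_comp {τ : X → X} (hτ : Topology.IsOpenEmbedding τ)
    (hr : ∀ x, (∃ a, Φ a x ≠ 0) → x ∈ Set.range τ) :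
    ∃ Ψ : J ≃⋆ₐ[ℂ] C₀(X, compactOperators H₀), ∀ y (a : J), evalAt Ψ y a = evalAt Φ (τ y) a := by
  have hvanish : ∀ a, Tendsto (fun y => Φ a (τ y)) (cocompact X) (nhds 0) := by
    intro a
    rw [tendsto_zero_iff_norm_tendsto_zero, Metric.tendsto_nhds]
    intro ε hε
    have hK : IsCompact (τ ⁻¹' {x | ε ≤ ‖Φ a x‖}) := by
      refine hτ.isInducing.isCompact_iff.2 ?_
      rw [Set.image_preimage_eq_of_subset]
      · exact (Φ a).isCompact_setOf_le_norm hε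
      · intro x hx
        refine hr x ⟨a, fun h0 => ?_⟩
        have h1 : ε ≤ ‖Φ a x‖ := hx
        rw [h0, norm_zero] at h1
        linarith
    filter_upwards [hK.compl_mem_cocompact] with y hy
    rw [dist_zero_right, norm_norm]
    exact not_le.1 hy
  let F : J → C₀(X, compactOperators H₀) := fun a =>
    ⟨⟨fun y => Φ a (τ y), (map_continuous (Φ a)).comp hτ.continuous⟩, hvanish a⟩
  have hF : ∀ a y, F a y = Φ a (τ y) := fun _ _ => rfl
  have hinj : Function.Injective F := by
    intro a b hab
    suffices h : Φ a = Φ b from Φ.injective h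
    refine DFunLike.ext _ _ fun x => ?_
    by_cases hx : x ∈ Set.range τ
    · obtain ⟨y, rfl⟩ := hx
      rw [← hF, ← hF, hab]
    · have : ∀ a, Φ a x = 0 := fun a => by
        by_contra h
        exact hx (hr x ⟨a, h⟩)
      rw [this, this]
  have hsurj : Function.Surjective F := by
    intro f
    let g : X → compactOperators H₀ := Function.extend τ f 0
    have hg : ∀ y, g (τ y) = f y := fun y => hτ.injective.extend_apply _ _ y
    have hsmall : ∀ ε > 0, ∃ K : Set X, IsCompact K ∧ K ⊆ Set.range τ ∧
        ∀ x ∉ K, ‖g x‖ < ε := by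
      intro ε hε
      refine ⟨_, (f.isCompact_setOf_le_norm hε).image hτ.continuous, Set.image_subset_range _ _,
        fun x hx => ?_⟩
      by_cases hxr : x ∈ Set.range τ
      · obtain ⟨y, rfl⟩ := hxr
        rw [hg]
        exact not_le.1 fun h => hx ⟨y, h, rfl⟩
      · have : g x = 0 := Function.extend_apply' _ _ x fun ⟨y, hy⟩ => hxr ⟨y, hy⟩
        rw [this, norm_zero]
        exact hε
    have hgc : Continuous g := by
      rw [continuous_iff_continuousAt]
      intro x
      by_cases hxr : x ∈ Set.range τ
      · obtain ⟨y, rfl⟩ := hxr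
        rw [← hτ.continuousAt_iff]
        have : g ∘ τ = f := funext hg
        rw [this]
        exact (map_continuous f).continuousAt
      · have h0 : g x = 0 := Function.extend_apply' _ _ x fun ⟨y, hy⟩ => hxr ⟨y, hy⟩
        rw [ContinuousAt, h0, Metric.tendsto_nhds]
        intro ε hε
        obtain ⟨K, hK, hKr, hKε⟩ := hsmall ε hε
        filter_upwards [hK.isClosed.isOpen_compl.mem_nhds fun hxK => hxr (hKr hxK)] with z hz
        rw [dist_zero_right]
        exact hKε z hz
    have hg0 : Tendsto g (cocompact X) (nhds 0) := by
      rw [Metric.tendsto_nhds]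
      intro ε hε
      obtain ⟨K, hK, -, hKε⟩ := hsmall ε hε
      filter_upwards [hK.compl_mem_cocompact] with z hz
      rw [dist_zero_right]
      exact hKε z hz
    refine ⟨Φ.symm ⟨⟨g, hgc⟩, hg0⟩, DFunLike.ext _ _ fun y => ?_⟩
    rw [hF, StarAlgEquiv.apply_symm_apply]
    exact hg y
  let e : J ≃ C₀(X, compactOperators H₀) := Equiv.ofBijective F ⟨hinj, hsurj⟩
  refine ⟨{ e with
            map_mul' := fun a b => DFunLike.ext _ _ fun y => ?_
            map_add' := fun a b => DFunLike.ext _ _ fun y => ?_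
            map_star' := fun a => DFunLike.ext _ _ fun y => ?_
            map_smul' := fun c a => DFunLike.ext _ _ fun y => ?_ }, fun y a => rfl⟩
  · exact congrArg (fun f : C₀(X, compactOperators H₀) => f (τ y)) (trivialization_mul Φ a b)
  · exact congrArg (fun f : C₀(X, compactOperators H₀) => f (τ y)) (trivialization_add Φ a b)
  · exact congrArg (fun f : C₀(X, compactOperators H₀) => f (τ y)) (trivialization_star Φ a)
  · exact congrArg (fun f : C₀(X, compactOperators H₀) => f (τ y)) (trivialization_smul Φ c a)

/-- After a change of the base space, a trivialization is compatible with the given points of the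
spectrum. -/
theorem exists_adapted_trivialization (Φ : J ≃⋆ₐ[ℂ] C₀(X, compactOperators H₀))
    (hJ : ∀ a ∈ J, ∀ x : M, x * a ∈ J ∧ a * x ∈ J) {ι : X → CStarSpectrum M}
    (hι : Topology.IsEmbedding ι) (hr : Set.range ι = CStarSpectrum.nonvanishing (J : Set M))
    (π : X → M →⋆ₐ[ℂ] (H₀ →L[ℂ] H₀)) (hπ : ∀ y, IsIrreducibleRep (π y))
    (hπι : ∀ y, CStarSpectrum.mk (π y) (hπ y) = ι y) :
    ∃ Ψ : J ≃⋆ₐ[ℂ] C₀(X, compactOperators H₀),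
      ∀ y, ∃ W : H₀ ≃ₗᵢ[ℂ] H₀, ∀ (a : J) ξ, W (evalAt Ψ y a ξ) = π y a (W ξ) := by
  obtain ⟨τ, hτ, hτr, hW⟩ := exists_isOpenEmbedding_spectrum Φ hJ hι hr π hπ hπι
  obtain ⟨Ψ, hΨ⟩ := exists_trivialization_comp Φ hτ hτr
  exact ⟨Ψ, fun y => by simpa only [hΨ] using hW y⟩

end Trivialization

/-! ### Representations supported near a point -/

section LocalStructure

variable {M H₀ : Type v} [CStarAlgebra M] [NormedAddCommGroup H₀] [InnerProductSpace ℂ H₀]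
  [CompleteSpace H₀] {X : Type*} [TopologicalSpace X] {J : NonUnitalStarSubalgebra ℂ M}
  (Φ : J ≃⋆ₐ[ℂ] C₀(X, compactOperators H₀))
  {E : Type w} [NormedAddCommGroup E] [InnerProductSpace ℂ E] [CompleteSpace E]

/-- A representation of `M` is supported in `O` if the elements of `J` which vanish outside of `O`
act nondegenerately. In particular, it is then nondegenerate on `J`. -/
def IsSupportedIn (ρ : M →⋆ₐ[ℂ] (E →L[ℂ] E)) (O : Set X) : Prop :=
  (Submodule.span ℂ {x | ∃ a : J, (∀ y ∉ O, evalAt Φ y a = 0) ∧ ∃ ξ, ρ a ξ = x}).topologicalClosure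
    = ⊤

/-- On `J`, the representations `ρ` and `ρ'` differ by at most the oscillation on `O` with respect
to the value at `x₀`. -/
def IsOscillationBounded (ρ ρ' : M →⋆ₐ[ℂ] (E →L[ℂ] E)) (x₀ : X) (O : Set X) : Prop :=
  ∀ (a : J) (ε : ℝ), 0 ≤ ε → (∀ y ∈ O, ‖evalAt Φ y a - evalAt Φ x₀ a‖ ≤ ε) → ‖ρ a - ρ' a‖ ≤ ε

/-- The constant section with the value `k`, cut off by a compactly supported function. -/
theorem exists_apply_eq_smul {g : C(X, ℝ)} (hg : HasCompactSupport g) (k : compactOperators H₀) :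
    ∃ a : J, ∀ x, evalAt Φ x a = (g x : ℂ) • (k : H₀ →L[ℂ] H₀) := by
  let F : C₀(X, compactOperators H₀) :=
    { toFun := fun x => (g x : ℂ) • k
      continuous_toFun := by fun_prop
      zero_at_infty' := by
        refine tendsto_const_nhds.congr' ?_
        filter_upwards [hg.isCompact.compl_mem_cocompact] with x hx
        rw [image_eq_zero_of_notMem_tsupport hx]
        simp }
  refine ⟨Φ.symm F, fun x => ?_⟩
  rw [evalAt_apply, StarAlgEquiv.apply_symm_apply]
  rfl

variable {Φ} [IsClosed (J : Set M)]

/-- In a representation which is supported in `O`, the norm of `ρ a` is bounded by the supremum of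
the norms of the values of `a` on `O`: truncation of `a` outside of `O` does not change `ρ a`. -/
theorem IsSupportedIn.norm_apply_le {ρ : M →⋆ₐ[ℂ] (E →L[ℂ] E)} {O : Set X}
    (hρ : IsSupportedIn Φ ρ O) {a : J} {ε : ℝ} (hε : 0 ≤ ε) (ha : ∀ y ∈ O, ‖evalAt Φ y a‖ ≤ ε) :
    ‖ρ a‖ ≤ ε := by
  refine le_of_forall_pos_le_add fun δ hδ => ?_
  -- the values of norm larger than `c` are scaled down to the norm `c`; as `c > 0`, the quotient
  -- is continuous
  set c := ε + δ with hc
  have hc0 : 0 < c := by positivity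
  have hmax : ∀ x, 0 < max ‖evalAt Φ x a‖ c := fun x => lt_max_of_lt_right hc0
  let g : C(X, ℝ) :=
    { toFun := fun x => c / max ‖evalAt Φ x a‖ c
      continuous_toFun := continuous_const.div
        ((continuous_evalAt Φ a).norm.max continuous_const) fun x => (hmax x).ne' }
  have hg : ∀ x, |g x| ≤ 1 := fun x => by
    change |c / max ‖evalAt Φ x a‖ c| ≤ 1
    rw [abs_of_nonneg (div_nonneg hc0.le (hmax x).le)]
    exact div_le_one_of_le₀ (le_max_right _ _) (hmax x).le
  obtain ⟨b, hb⟩ := exists_scalarMul Φ g hg a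
  have hbn : ‖b‖ ≤ c := by
    refine norm_le_of_evalAt_le Φ hc0.le fun x => ?_
    rw [hb, norm_smul, Complex.norm_real, Real.norm_eq_abs]
    change |c / max ‖evalAt Φ x a‖ c| * _ ≤ _
    rw [abs_of_nonneg (div_nonneg hc0.le (hmax x).le), div_mul_eq_mul_div, div_le_iff₀ (hmax x)]
    exact mul_le_mul_of_nonneg_left (le_max_left _ _) hc0.le
  have hab : ρ a = ρ b := by
    refine ContinuousLinearMap.ext_on
      ((Submodule.dense_iff_topologicalClosure_eq_top (R := ℂ)).2 hρ) ?_
    rintro _ ⟨d, hd, ξ, rfl⟩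
    have : a * d = b * d := by
      refine eq_of_evalAt_eq Φ fun x => ?_
      rw [map_mul, map_mul]
      by_cases hx : x ∈ O
      · have h1 : g x = 1 := by
          change c / max ‖evalAt Φ x a‖ c = 1
          rw [max_eq_right ((ha x hx).trans (by linarith)), div_self hc0.ne']
        rw [hb, h1]
        simp
      · rw [hd x hx, mul_zero, mul_zero]
    rw [← mul_apply_eq_comp, ← mul_apply_eq_comp, ← map_mul, ← map_mul]
    exact congrArg (fun z : J => ρ z ξ) this
  rw [hab]
  exact (NonUnitalStarAlgHom.norm_apply_le ρ (b : M)).trans hbn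

theorem IsSupportedIn.apply_eq_of_eqOn {ρ : M →⋆ₐ[ℂ] (E →L[ℂ] E)} {O : Set X}
    (hρ : IsSupportedIn Φ ρ O) {a b : J} (h : ∀ y ∈ O, evalAt Φ y a = evalAt Φ y b) :
    ρ a = ρ b := by
  have h1 : ‖ρ ((a - b : J) : M)‖ ≤ 0 := hρ.norm_apply_le le_rfl fun y hy => by
    rw [map_sub, h y hy, sub_self, norm_zero]
  rw [norm_le_zero_iff] at h1
  rw [← sub_eq_zero, ← map_sub]
  exact h1

/-- A representation which is supported where a compactly supported function is `1` induces a
representation of the compact operators, by means of constant sections. -/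
theorem IsSupportedIn.exists_hom {ρ : M →⋆ₐ[ℂ] (E →L[ℂ] E)} {O : Set X}
    (hρ : IsSupportedIn Φ ρ O) {g : C(X, ℝ)} (hg : HasCompactSupport g) (hgO : ∀ y ∈ O, g y = 1) :
    ∃ κ : compactOperators H₀ →⋆ₙₐ[ℂ] (E →L[ℂ] E), ∀ (k : compactOperators H₀) (a : J),
      (∀ y ∈ O, Φ a y = k) → κ k = ρ a := by
  choose c hc using exists_apply_eq_smul Φ hg
  have hcO : ∀ k, ∀ y ∈ O, evalAt Φ y (c k) = k := fun k y hy => by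
    rw [hc, hgO y hy]
    simp
  have key : ∀ (k : compactOperators H₀) (a : J),
      (∀ y ∈ O, evalAt Φ y a = k) → ρ (c k) = ρ a := fun k a ha =>
    hρ.apply_eq_of_eqOn fun y hy => by rw [ha y hy, hcO k y hy]
  refine ⟨{ toFun := fun k => ρ (c k)
            map_smul' := fun z k => ?_
            map_zero' := ?_
            map_add' := fun k l => ?_
            map_mul' := fun k l => ?_
            map_star' := fun k => ?_ }, fun k a ha => key k a fun y hy =>
              congrArg Subtype.val (ha y hy)⟩
  · refine (key _ (z • c k) fun y hy => ?_).trans (map_smul ρ z (c k : M))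
    rw [map_smul, hcO k y hy]
    rfl
  · refine (key _ 0 fun y hy => ?_).trans (map_zero ρ)
    rw [map_zero]
    rfl
  · refine (key _ (c k + c l) fun y hy => ?_).trans (map_add ρ (c k : M) (c l))
    rw [map_add, hcO k y hy, hcO l y hy]
    rfl
  · refine (key _ (c k * c l) fun y hy => ?_).trans (map_mul ρ (c k : M) (c l))
    rw [map_mul, hcO k y hy, hcO l y hy]
    rfl
  · refine (key _ (star (c k)) fun y hy => ?_).trans (map_star ρ (c k : M))
    rw [map_star, hcO k y hy]
    rfl

/-- Elements close to a constant section are approximated by the value of the induced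
representation of the compact operators. -/
theorem IsSupportedIn.norm_sub_le {ρ : M →⋆ₐ[ℂ] (E →L[ℂ] E)} {O : Set X}
    (hρ : IsSupportedIn Φ ρ O) {g : C(X, ℝ)} (hg : HasCompactSupport g) (hgO : ∀ y ∈ O, g y = 1)
    {κ : compactOperators H₀ →⋆ₙₐ[ℂ] (E →L[ℂ] E)}
    (hκ : ∀ (k : compactOperators H₀) (a : J), (∀ y ∈ O, Φ a y = k) → κ k = ρ a)
    (k : compactOperators H₀) (a : J) {ε : ℝ} (hε : 0 ≤ ε)
    (h : ∀ y ∈ O, ‖evalAt Φ y a - (k : H₀ →L[ℂ] H₀)‖ ≤ ε) : ‖ρ a - κ k‖ ≤ ε := by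
  obtain ⟨b, hb⟩ := exists_apply_eq_smul Φ hg k
  have hbO : ∀ y ∈ O, evalAt Φ y b = k := fun y hy => by
    rw [hb, hgO y hy]
    simp
  rw [hκ k b fun y hy => Subtype.ext (hbO y hy), ← map_sub]
  exact hρ.norm_apply_le (a := a - b) hε fun y hy => by
    rw [map_sub, hbO y hy]
    exact h y hy

/-- The rank one operators `z ↦ ⟪e, z⟫ y`, with a fixed unit vector `e`, act nondegenerately. -/
theorem IsSupportedIn.dense_rankOne {ρ : M →⋆ₐ[ℂ] (E →L[ℂ] E)} {O : Set X}
    (hρ : IsSupportedIn Φ ρ O) {g : C(X, ℝ)} (hg : HasCompactSupport g) (hgO : ∀ y ∈ O, g y = 1)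
    {κ : compactOperators H₀ →⋆ₙₐ[ℂ] (E →L[ℂ] E)}
    (hκ : ∀ (k : compactOperators H₀) (a : J), (∀ y ∈ O, Φ a y = k) → κ k = ρ a)
    {e : H₀} (he : ‖e‖ = 1) :
    (Submodule.span ℂ {x | ∃ y η, κ (compactRankOne y e) η = x}).topologicalClosure = ⊤ := by
  rw [eq_top_iff, ← hρ]
  refine Submodule.topologicalClosure_minimal _ (Submodule.span_le.2 ?_)
    (Submodule.isClosed_topologicalClosure _)
  rintro _ ⟨a, -, ξ, rfl⟩
  refine Metric.mem_closure_iff.2 fun ε hε => ?_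
  obtain ⟨n, w, hw⟩ := exists_finiteRank_approx (Φ a) (ε := ε / (2 * (‖ξ‖ + 1)))
    (by positivity)
  set p := ∑ i, compactRankOne (w i) (w i) with hp
  refine ⟨κ p (ρ a ξ), ?_, ?_⟩
  · rw [hp, map_sum, sum_apply]
    refine sum_mem fun i _ => ?_
    rw [← compactRankOne_mul_compactRankOne he, map_mul, mul_apply_eq_comp]
    exact Submodule.subset_span ⟨_, _, rfl⟩
  · obtain ⟨b, hb⟩ := exists_apply_eq_smul Φ hg p
    have hbO : ∀ y ∈ O, evalAt Φ y b = p := fun y hy => by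
      rw [hb, hgO y hy]
      simp
    have h1 : ‖ρ ((b * a - a : J) : M)‖ ≤ ε / (2 * (‖ξ‖ + 1)) :=
      hρ.norm_apply_le (by positivity) fun y hy => by
        rw [map_sub, map_mul, hbO y hy]
        exact hw y
    have h2 : ρ ((b * a - a : J) : M) ξ = κ p (ρ a ξ) - ρ a ξ := by
      rw [hκ p b fun y hy => Subtype.ext (hbO y hy), ← mul_apply_eq_comp, ← map_mul,
        ← sub_apply, ← map_sub]
      rfl
    rw [dist_comm, dist_eq_norm, ← h2]
    refine ((ρ _).le_of_opNorm_le h1 ξ).trans_lt ?_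
    rw [div_mul_eq_mul_div, div_lt_iff₀ (by positivity)]
    nlinarith [norm_nonneg ξ]

/-- A representation `ρ` which is supported in a small neighbourhood of `x₀` is close to a multiple
`ρ'` of the irreducible representation `π` which corresponds to `x₀`. That `ρ'` is a multiple of `π`
is expressed by intertwiners `V η` from `π` to `ρ'` whose ranges span a dense subspace. On `J`, the
representation `ρ'` is `a ↦ κ (Φ a x₀)`, where `κ` is the action of the constant sections. -/
theorem IsSupportedIn.exists_multiple [Nontrivial H₀]
    (hJ : ∀ a ∈ J, ∀ x : M, x * a ∈ J ∧ a * x ∈ J)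
    {ρ : M →⋆ₐ[ℂ] (E →L[ℂ] E)} {O : Set X}
    (hρ : IsSupportedIn Φ ρ O) {g : C(X, ℝ)} (hg : HasCompactSupport g) (hgO : ∀ y ∈ O, g y = 1)
    {x₀ : X} (hx₀ : ∃ a, Φ a x₀ ≠ 0) {π : M →⋆ₐ[ℂ] (H₀ →L[ℂ] H₀)} {W : H₀ ≃ₗᵢ[ℂ] H₀}
    (hW : ∀ (a : J) ξ, W (evalAt Φ x₀ a ξ) = π a (W ξ)) :
    ∃ ρ' : M →⋆ₐ[ℂ] (E →L[ℂ] E), IsOscillationBounded Φ ρ ρ' x₀ O ∧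
      ∃ V : E → H₀ →L[ℂ] E, (∀ η m ξ, V η (π m ξ) = ρ' m (V η ξ)) ∧
        (Submodule.span ℂ {x | ∃ η ξ, V η ξ = x}).topologicalClosure = ⊤ := by
  obtain ⟨κ, hκ⟩ := hρ.exists_hom hg hgO
  obtain ⟨e₀, he₀⟩ := exists_ne (0 : H₀)
  obtain ⟨e, he⟩ : ∃ e : H₀, ‖e‖ = 1 := ⟨_, norm_smul_inv_norm (𝕜 := ℂ) he₀⟩
  have hd := hρ.dense_rankOne hg hgO hκ he
  let θ : J →⋆ₙₐ[ℂ] (E →L[ℂ] E) := κ.comp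
    { toFun := fun a => Φ a x₀
      map_smul' := fun c a => by rw [trivialization_smul]; rfl
      map_zero' := by rw [trivialization_zero]; rfl
      map_add' := fun a b => by rw [trivialization_add]; rfl
      map_mul' := fun a b => by rw [trivialization_mul]; rfl
      map_star' := fun a => by rw [trivialization_star]; rfl }
  have hθ : ∀ a, θ a = κ (Φ a x₀) := fun _ => rfl
  obtain ⟨ρ', hρ'⟩ := exists_extension_of_ideal J hJ θ (by
    rw [eq_top_iff, ← hd]
    refine Submodule.topologicalClosure_mono (Submodule.span_mono ?_)
    rintro _ ⟨y, η, rfl⟩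
    obtain ⟨a, ha⟩ := exists_trivialization_apply_eq Φ hx₀ (compactRankOne y e)
    exact ⟨a, η, by rw [hθ, ha]⟩)
  have hadd : ∀ x y : H₀, compactRankOne (x + y) e = compactRankOne x e + compactRankOne y e :=
    fun x y => by ext z; simp
  have hsmul : ∀ (c : ℂ) (x : H₀), compactRankOne (c • x) e = c • compactRankOne x e :=
    fun c x => by
      ext z
      change ⟪e, z⟫_ℂ • c • x = c • ⟪e, z⟫_ℂ • x
      rw [smul_comm]
  have hnorm : ∀ x : H₀, ‖compactRankOne x e‖ ≤ ‖x‖ := fun x =>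
    ContinuousLinearMap.opNorm_le_bound _ (norm_nonneg _) fun z => by
      change ‖⟪e, z⟫_ℂ • x‖ ≤ _
      rw [norm_smul, mul_comm]
      refine mul_le_mul_of_nonneg_left ((norm_inner_le_norm _ _).trans ?_) (norm_nonneg _)
      rw [he, one_mul]
  let V : E → H₀ →L[ℂ] E := fun η => LinearMap.mkContinuous
    { toFun := fun ξ => κ (compactRankOne (W.symm ξ) e) η
      map_add' := fun ξ ξ' => by rw [map_add, hadd, map_add, add_apply]
      map_smul' := fun c ξ => by rw [map_smul, hsmul, map_smul, smul_apply, RingHom.id_apply] }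
    ‖η‖ (fun ξ => by
      refine ((κ _).le_opNorm η).trans ?_
      rw [mul_comm]
      refine mul_le_mul_of_nonneg_left ?_ (norm_nonneg _)
      refine (NonUnitalStarAlgHom.norm_apply_le κ _).trans ((hnorm _).trans_eq ?_)
      exact W.symm.norm_map ξ)
  have hV : ∀ η ξ, V η ξ = κ (compactRankOne (W.symm ξ) e) η := fun _ _ => rfl
  refine ⟨ρ', fun a ε hε ha => ?_, V, ?_, ?_⟩
  · rw [hρ', hθ]
    exact hρ.norm_sub_le hg hgO hκ _ a hε ha
  · have hVJ : ∀ η (a : J) ξ, V η (π a ξ) = ρ' a (V η ξ) := by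
      intro η a ξ
      have h1 : W.symm (π a ξ) = evalAt Φ x₀ a (W.symm ξ) := by
        rw [LinearIsometryEquiv.symm_apply_eq, hW, W.apply_symm_apply]
      rw [hV, hV, h1, hρ', hθ, ← mul_apply_eq_comp, ← map_mul, mul_compactRankOne, evalAt_apply]
    intro η m ξ
    have he0 : W e ≠ 0 := fun h => by
      have := W.norm_map e
      rw [h, he, norm_zero] at this
      exact zero_ne_one this
    obtain ⟨b, hb⟩ := exists_trivialization_apply_apply_eq hx₀ (ξ := e)
      (fun h => by rw [h, norm_zero] at he; exact zero_ne_one he) (W.symm ξ)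
    have hξ : ξ = π b (W e) := by
      rw [← hW, evalAt_apply, hb, W.apply_symm_apply]
    rw [hξ, ← mul_apply_eq_comp, ← map_mul]
    refine (hVJ η ⟨m * b, (hJ b b.2 m).1⟩ (W e)).trans ?_
    rw [map_mul, mul_apply_eq_comp, hVJ]
  · rw [eq_top_iff, ← hd]
    refine Submodule.topologicalClosure_mono (Submodule.span_mono ?_)
    rintro _ ⟨y, η, rfl⟩
    exact ⟨η, W y, by rw [hV, W.symm_apply_apply]⟩

end LocalStructure

/-! ### Density of ranges in `L²` spaces -/

section Density

variable {α : Type*} [MeasurableSpace α] {μ : Measure α}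
  {H : Type*} [NormedAddCommGroup H] [InnerProductSpace ℂ H]
  {E : Type*} [NormedAddCommGroup E] [InnerProductSpace ℂ E]

/-- The map from a vector `c` to the function in `L²` which is `c` on a given set of finite measure
and zero elsewhere. -/
def indicatorConstLpL {s : Set α} (hs : MeasurableSet s) (hμs : μ s ≠ ∞) : E →L[ℂ] Lp E 2 μ :=
  LinearMap.mkContinuous
    { toFun := fun c => indicatorConstLp 2 hs hμs c
      map_add' := fun _ _ => indicatorConstLp_add.symm
      map_smul' := fun z c => by
        rw [RingHom.id_apply, indicatorConstLp, indicatorConstLp, ← MemLp.toLp_const_smul]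
        refine MemLp.toLp_congr _ _ (Eventually.of_forall fun x => ?_)
        by_cases hx : x ∈ s <;> simp [hx] }
    (μ.real s ^ (1 / (2 : ℝ≥0∞).toReal)) fun c => by
      rw [LinearMap.coe_mk, AddHom.coe_mk,
        norm_indicatorConstLp two_ne_zero ENNReal.ofNat_ne_top, mul_comm]

theorem compLpL_indicatorConstLp (V : H →L[ℂ] E) {s : Set α} (hs : MeasurableSet s)
    (hμs : μ s ≠ ∞) (ξ : H) :
    V.compLpL 2 μ (indicatorConstLp 2 hs hμs ξ) = indicatorConstLp 2 hs hμs (V ξ) := by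
  refine Lp.ext ?_
  filter_upwards [V.coeFn_compLpL (indicatorConstLp 2 hs hμs ξ),
    indicatorConstLp_coeFn (p := 2) (hs := hs) (hμs := hμs) (c := ξ),
    indicatorConstLp_coeFn (p := 2) (hs := hs) (hμs := hμs) (c := V ξ)] with x h1 h2 h3
  rw [h1, h2, h3]
  by_cases hx : x ∈ s <;> simp [hx]

/-- If the ranges of operators `V i` span a dense subspace, then so do the ranges of their pointwise
applications on `L²`. -/
theorem dense_range_compLpL {ι : Type*} (V : ι → H →L[ℂ] E)
    (hd : (Submodule.span ℂ {x | ∃ i ξ, V i ξ = x}).topologicalClosure = ⊤) :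
    (Submodule.span ℂ {x | ∃ i φ, (V i).compLpL 2 μ φ = x}).topologicalClosure = ⊤ := by
  set S := (Submodule.span ℂ {x | ∃ i φ, (V i).compLpL 2 μ φ = x}).topologicalClosure with hS
  refine top_unique fun φ _ => ?_
  refine Lp.induction (p := 2) (μ := μ) ENNReal.ofNat_ne_top (fun φ : Lp E 2 μ => φ ∈ S)
    (fun c s hs hμs => ?_) (fun f g hf hg _ h1 h2 => add_mem h1 h2)
    (Submodule.isClosed_topologicalClosure _) φ
  rw [Lp.simpleFunc.coe_indicatorConst]
  have hle : (Submodule.span ℂ {x | ∃ i ξ, V i ξ = x}).topologicalClosure ≤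
      S.comap (indicatorConstLpL (E := E) hs hμs.ne).toLinearMap := by
    refine Submodule.topologicalClosure_minimal _ (Submodule.span_le.2 ?_) ?_
    · rintro _ ⟨i, ξ, rfl⟩
      refine Submodule.le_topologicalClosure _ (Submodule.subset_span
        ⟨i, indicatorConstLp 2 hs hμs.ne ξ, ?_⟩)
      rw [compLpL_indicatorConstLp]
      rfl
    · exact (Submodule.isClosed_topologicalClosure _).preimage
        (indicatorConstLpL (E := E) hs hμs.ne).continuous
  rw [hd] at hle
  exact hle (Submodule.mem_top (x := c))

end Density

/-! ### Continuity of induction -/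

section InducedEstimates

variable {G : Type u} {A : Type v} [Group G] [TopologicalSpace G] [IsTopologicalGroup G]
  [T2Space G] [LocallyCompactSpace G] [MeasurableSpace G] [BorelSpace G]
  [CStarAlgebra A] [MulSemiringAction G A] [SMulCommClass G ℂ A] [StarSMul G A]
  [ContinuousSMul G A]
  {E : Type (max u v)} [NormedAddCommGroup E] [InnerProductSpace ℂ E] [CompleteSpace E]

theorem norm_pointwiseRep_sub_le {ρ ρ' : A →⋆ₐ[ℂ] (E →L[ℂ] E)} {a : A} {ε : ℝ} (hε : 0 ≤ ε)
    (h : ∀ t : G, ‖ρ (t • a) - ρ' (t • a)‖ ≤ ε) :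
    ‖pointwiseRep (G := G) ρ a - pointwiseRep ρ' a‖ ≤ ε := by
  refine ContinuousLinearMap.opNorm_le_bound _ hε fun φ => ?_
  refine Lp.norm_le_mul_norm_of_ae_le_mul ?_
  rw [sub_apply]
  filter_upwards [pointwiseRep_ae ρ a φ, pointwiseRep_ae ρ' a φ,
    Lp.coeFn_sub (pointwiseRep ρ a φ) (pointwiseRep ρ' a φ)] with t h1 h2 h3
  rw [h3, Pi.sub_apply, h1, h2, ← sub_apply]
  exact ContinuousLinearMap.le_of_opNorm_le _ (h t⁻¹) _

/-- If `ρ` and `ρ'` are close to each other on the orbits of all values of `f`, then so are the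
induced representations at `f`. The operators are regarded as operators on `L²(G, E)`, the common
Hilbert space of the two induced representations. -/
theorem norm_eval_universalRep_sub_le {ρ ρ' : A →⋆ₐ[ℂ] (E →L[ℂ] E)} (hE : Nontrivial E)
    (f : C_c(G, A)) {ε : ℝ} (hε : 0 ≤ ε)
    (h : ∀ s t : G, ‖ρ (t • f s) - ρ' (t • f s)‖ ≤ ε) :
    ‖(show L2Haar G E →L[ℂ] L2Haar G E from (inducedRep G ρ hE).eval (universalRep f)) -
      (show L2Haar G E →L[ℂ] L2Haar G E from (inducedRep G ρ' hE).eval (universalRep f))‖ ≤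
      (Measure.haar : Measure G).real (tsupport f) * ε := by
  refine ContinuousLinearMap.opNorm_le_bound _ (by positivity) fun φ => ?_
  have h1 : ((show L2Haar G E →L[ℂ] L2Haar G E from (inducedRep G ρ hE).eval (universalRep f)) -
      (show L2Haar G E →L[ℂ] L2Haar G E from (inducedRep G ρ' hE).eval (universalRep f))) φ =
      ∫ s, (pointwiseRep ρ (f s) (leftTranslation s φ) -
        pointwiseRep ρ' (f s) (leftTranslation s φ)) ∂(Measure.haar : Measure G) :=
    (integral_sub ((inducedRep G ρ hE).integrable_integrand f φ)
      ((inducedRep G ρ' hE).integrable_integrand f φ)).symm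
  rw [h1]
  have hm : MeasurableSet (tsupport f) := (isClosed_tsupport _).measurableSet
  have hfin : (Measure.haar : Measure G) (tsupport f) ≠ ∞ :=
    f.hasCompactSupport.isCompact.measure_lt_top.ne
  refine (norm_integral_le_of_norm_le (g := (tsupport f).indicator fun _ => ε * ‖φ‖)
    ((integrable_indicator_iff hm).2 (integrableOn_const hfin))
    (Eventually.of_forall fun s => ?_)).trans_eq ?_
  · by_cases hs : s ∈ tsupport f
    · rw [Set.indicator_of_mem hs, ← sub_apply]
      refine (ContinuousLinearMap.le_of_opNorm_le _ (norm_pointwiseRep_sub_le hε (h s)) _).trans ?_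
      rw [LinearIsometryEquiv.norm_map]
    · rw [image_eq_zero_of_notMem_tsupport hs]
      simp [hs]
  · rw [integral_indicator hm, setIntegral_const, smul_eq_mul, mul_assoc]

end InducedEstimates

/-! ### Equicontinuity of translated sections -/

section Equicontinuity

variable {G : Type u} {M H₀ : Type v} [Group G] [TopologicalSpace G] [CStarAlgebra M]
  [MulSemiringAction G M] [SMulCommClass G ℂ M] [StarSMul G M] [ContinuousSMul G M]
  [NormedAddCommGroup H₀] [InnerProductSpace ℂ H₀]
  [CompleteSpace H₀] {X : Type*} [TopologicalSpace X] {J : NonUnitalStarSubalgebra ℂ M}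
  {Φ : J ≃⋆ₐ[ℂ] C₀(X, compactOperators H₀)} [IsClosed (J : Set M)]

theorem continuous_evalAt_uncurry : Continuous fun p : X × J => evalAt Φ p.1 p.2 := by
  rw [continuous_iff_continuousAt]
  rintro ⟨x, a⟩
  rw [ContinuousAt, Metric.tendsto_nhds]
  intro ε hε
  have h1 := Metric.tendsto_nhds.1 ((continuous_evalAt Φ a).tendsto x) (ε / 2) (half_pos hε)
  have h2 := Metric.ball_mem_nhds a (half_pos hε)
  rw [nhds_prod_eq]
  filter_upwards [h1.prod_mk h2] with p hp
  obtain ⟨hp1, hp2⟩ := hp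
  calc dist (evalAt Φ p.1 p.2) (evalAt Φ x a)
      ≤ dist (evalAt Φ p.1 p.2) (evalAt Φ p.1 a) + dist (evalAt Φ p.1 a) (evalAt Φ x a) :=
        dist_triangle _ _ _
    _ < ε / 2 + ε / 2 := by
        refine add_lt_add_of_le_of_lt ?_ hp1
        rw [dist_eq_norm, ← map_sub]
        refine (norm_evalAt_le Φ _ _).trans ?_
        rw [← dist_eq_norm]
        exact (Metric.mem_ball.1 hp2).le
    _ = ε := add_halves ε

/-- For a proper action, the sections `t • b`, for `t ∈ G`, are equicontinuous: for `t` outside of a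
compact set they are uniformly small near a given point. -/
theorem eventually_forall_norm_evalAt_smul_sub_le [LocallyCompactSpace X] [MulAction G X]
    (hprop : IsProperAction G X) (hJinv : ∀ t : G, ∀ a ∈ J, t • a ∈ J)
    (hinv : ∀ (t : G) (x : X) (a : J), ‖evalAt Φ x ⟨t • a, hJinv t a a.2⟩‖ = ‖evalAt Φ (t • x) a‖)
    (b : J) (x₀ : X) {ε : ℝ} (hε : 0 < ε) :
    ∀ᶠ y in nhds x₀, ∀ t : G, ‖evalAt Φ y ⟨t • b, hJinv t b b.2⟩ -
      evalAt Φ x₀ ⟨t • b, hJinv t b b.2⟩‖ ≤ ε := by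
  obtain ⟨N, hN, hNx⟩ := exists_compact_mem_nhds x₀
  have hcomp := hprop _ ((isCompact_setOf_le_norm_evalAt Φ b (half_pos hε)).union hN)
  have hcont : Continuous fun p : X × G => evalAt Φ p.1 ⟨p.2 • b, hJinv p.2 b b.2⟩ :=
    continuous_evalAt_uncurry.comp (continuous_fst.prodMk
      ((continuous_snd.smul continuous_const).subtype_mk _))
  have h1 := hcomp.eventually_forall_of_forall_eventually (x₀ := x₀)
    (P := fun y t => ‖evalAt Φ y ⟨t • b, hJinv t b b.2⟩ -
      evalAt Φ x₀ ⟨t • b, hJinv t b b.2⟩‖ ≤ ε) (by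
    intro t _
    have hc : Continuous fun p : X × G => ‖evalAt Φ p.1 ⟨p.2 • b, hJinv p.2 b b.2⟩ -
        evalAt Φ x₀ ⟨p.2 • b, hJinv p.2 b b.2⟩‖ :=
      (hcont.sub (hcont.comp (continuous_const.prodMk continuous_snd))).norm
    have := (hc.tendsto (x₀, t)).eventually_lt_const (u := ε) (by simpa using hε)
    filter_upwards [this] with p hp using hp.le)
  filter_upwards [h1, hNx] with y hy hyN t
  by_cases ht : t ∈ {t : G | ∃ y ∈ {x | ε / 2 ≤ ‖evalAt Φ x b‖} ∪ N,
      t • y ∈ {x | ε / 2 ≤ ‖evalAt Φ x b‖} ∪ N}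
  · exact hy t ht
  · have key : ∀ z ∈ N, ‖evalAt Φ z ⟨t • b, hJinv t b b.2⟩‖ ≤ ε / 2 := by
      intro z hz
      rw [hinv]
      by_contra! hlt
      exact ht ⟨z, .inr hz, .inl hlt.le⟩
    calc _ ≤ _ := norm_sub_le _ _
      _ ≤ ε / 2 + ε / 2 := add_le_add (key y hyN) (key x₀ (mem_of_mem_nhds hNx))
      _ = ε := add_halves ε

/-- Equicontinuity of the sections `t • f s`, for a continuous compactly supported `f`. -/
theorem eventually_forall_forall_norm_evalAt_smul_sub_le [LocallyCompactSpace X] [MulAction G X]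
    (hprop : IsProperAction G X) (hJinv : ∀ t : G, ∀ a ∈ J, t • a ∈ J)
    (hinv : ∀ (t : G) (x : X) (a : J), ‖evalAt Φ x ⟨t • a, hJinv t a a.2⟩‖ = ‖evalAt Φ (t • x) a‖)
    {f : G → J} (hf : Continuous f) (hfc : HasCompactSupport f) (x₀ : X) {ε : ℝ} (hε : 0 < ε) :
    ∀ᶠ y in nhds x₀, ∀ s t : G, ‖evalAt Φ y ⟨t • f s, hJinv t (f s) (f s).2⟩ -
      evalAt Φ x₀ ⟨t • f s, hJinv t (f s) (f s).2⟩‖ ≤ ε := by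
  have hε3 : 0 < ε / 3 := by positivity
  have hn : ∀ (x : X) (t : G) (a b : J), ‖evalAt Φ x ⟨t • a, hJinv t a a.2⟩ -
      evalAt Φ x ⟨t • b, hJinv t b b.2⟩‖ ≤ ‖a - b‖ := by
    intro x t a b
    have : (⟨t • a, hJinv t a a.2⟩ - ⟨t • b, hJinv t b b.2⟩ : J) =
        ⟨t • ((a - b : J) : M), hJinv t _ (a - b).2⟩ := Subtype.ext (smul_sub t (a : M) b).symm
    rw [← map_sub, this, hinv]
    exact norm_evalAt_le Φ _ _
  have h1 := (hfc.isCompact).eventually_forall_of_forall_eventually (x₀ := x₀)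
    (P := fun y s => ∀ t : G, ‖evalAt Φ y ⟨t • f s, hJinv t (f s) (f s).2⟩ -
      evalAt Φ x₀ ⟨t • f s, hJinv t (f s) (f s).2⟩‖ ≤ ε) (by
    intro s _
    have h2 := eventually_forall_norm_evalAt_smul_sub_le hprop hJinv hinv (f s) x₀ hε3
    have h3 := Metric.tendsto_nhds.1 (hf.tendsto s) (ε / 3) hε3
    rw [nhds_prod_eq]
    filter_upwards [h2.prod_mk h3] with p hp t
    obtain ⟨hp1, hp2⟩ := hp
    rw [dist_eq_norm] at hp2
    have e1 := hn p.1 t (f p.2) (f s)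
    have e2 := hp1 t
    have e3 := hn x₀ t (f s) (f p.2)
    rw [norm_sub_rev (f s)] at e3
    refine (norm_sub_le_norm_sub_add_norm_sub _
      (evalAt Φ p.1 ⟨t • f s, hJinv t (f s) (f s).2⟩) _).trans ?_
    have e4 := norm_sub_le_norm_sub_add_norm_sub (evalAt Φ p.1 ⟨t • f s, hJinv t (f s) (f s).2⟩)
      (evalAt Φ x₀ ⟨t • f s, hJinv t (f s) (f s).2⟩)
      (evalAt Φ x₀ ⟨t • f p.2, hJinv t (f p.2) (f p.2).2⟩)
    linarith)
  filter_upwards [h1] with y hy s t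
  by_cases hs : s ∈ tsupport f
  · exact hy s hs t
  · have : (⟨t • f s, hJinv t (f s) (f s).2⟩ : J) = 0 := Subtype.ext (by
      rw [image_eq_zero_of_notMem_tsupport hs]
      exact smul_zero t)
    rw [this, map_zero, map_zero, sub_zero, norm_zero]
    exact hε.le

end Equicontinuity

/-! ### Lower bounds in induced representations -/

section InducedHom

variable {G : Type u} {A : Type v} [Group G] [TopologicalSpace G] [IsTopologicalGroup G]
  [T2Space G] [LocallyCompactSpace G] [MeasurableSpace G] [BorelSpace G]
  [CStarAlgebra A] [MulSemiringAction G A] [SMulCommClass G ℂ A] [StarSMul G A]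
  [ContinuousSMul G A]
  {E : Type (max u v)} [NormedAddCommGroup E] [InnerProductSpace ℂ E] [CompleteSpace E]

variable (G) in
/-- Evaluation at an induced covariant representation, as a homomorphism into the operators on
`L²(G, E)`. This target does not depend on `ρ`, so that different representations on the same space
can be compared. -/
def inducedHom (ρ : A →⋆ₐ[ℂ] (E →L[ℂ] E)) (hE : Nontrivial E) :
    CovariantFamilies G A →⋆ₐ[ℂ] (L2Haar G E →L[ℂ] L2Haar G E) :=
  (inducedRep G ρ hE).eval

theorem norm_inducedHom_le (ρ : A →⋆ₐ[ℂ] (E →L[ℂ] E)) (hE : Nontrivial E)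
    (z : CovariantFamilies G A) : ‖inducedHom G ρ hE z‖ ≤ ‖z‖ :=
  (inducedRep G ρ hE).norm_eval_le z

/-- If `ρ` is a multiple of `π`, in the sense that the ranges of intertwiners `V i` from `π` to `ρ`
span a dense subspace, then a lower bound in the `π`-regular representation is a lower
bound in the representation induced from `ρ`. -/
theorem smul_one_le_inducedHom {H : Type v} [NormedAddCommGroup H] [InnerProductSpace ℂ H]
    [CompleteSpace H] (π : A →⋆ₐ[ℂ] (H →L[ℂ] H)) (hH : Nontrivial H) (ρ : A →⋆ₐ[ℂ] (E →L[ℂ] E))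
    (hE : Nontrivial E) {ι : Type*} (V : ι → H →L[ℂ] E) (hV : ∀ i a ξ, V i (π a ξ) = ρ a (V i ξ))
    (hd : (Submodule.span ℂ {x | ∃ i ξ, V i ξ = x}).topologicalClosure = ⊤)
    {J : NonUnitalStarSubalgebra ℂ A} {T : CovariantFamilies G A} (hT : IsSelfAdjoint T)
    (hTJ : T - 1 ∈ crossedProductOf G J) {c : ℝ}
    (hc : (c : ℂ) • (1 : (regularRep G π hH).H →L[ℂ] (regularRep G π hH).H) ≤
      (regularRep G π hH).eval T) :
    (c : ℂ) • (1 : L2Haar G E →L[ℂ] L2Haar G E) ≤ inducedHom G ρ hE T := by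
  refine smul_one_le_of_intertwiners (L := L2Haar G H) (hT.map (inducedHom G ρ hE)) hc
    (fun i => (V i).compLpL 2 (Measure.haar : Measure G)) (fun i => ?_) (dense_range_compLpL V hd)
  have h := compLpL_intertwines π hH ρ hE (V i) (hV i) J hTJ
  rw [map_sub, map_sub, map_one, map_one] at h
  ext1 φ
  have h' : (V i).compLpL 2 (Measure.haar : Measure G)
        (show L2Haar G H from (regularRep G π hH).eval T φ) -
      (V i).compLpL 2 (Measure.haar : Measure G) φ =
      inducedHom G ρ hE T ((V i).compLpL 2 (Measure.haar : Measure G) φ) -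
      (V i).compLpL 2 (Measure.haar : Measure G) φ :=
    (map_sub _ _ _).symm.trans (DFunLike.congr_fun h φ)
  exact (sub_left_injective h').symm

end InducedHom

section LowerBound

variable {G : Type u} {M H₀ : Type v} [Group G] [TopologicalSpace G] [IsTopologicalGroup G]
  [T2Space G] [LocallyCompactSpace G] [MeasurableSpace G] [BorelSpace G] [CStarAlgebra M]
  [MulSemiringAction G M] [SMulCommClass G ℂ M] [StarSMul G M] [ContinuousSMul G M]
  [NormedAddCommGroup H₀] [InnerProductSpace ℂ H₀]
  [CompleteSpace H₀] {X : Type*} [TopologicalSpace X] {J : NonUnitalStarSubalgebra ℂ M}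
  {Φ : J ≃⋆ₐ[ℂ] C₀(X, compactOperators H₀)}

theorem IsSupportedIn.mono {E : Type*} [NormedAddCommGroup E] [InnerProductSpace ℂ E]
    [CompleteSpace E] {ρ : M →⋆ₐ[ℂ] (E →L[ℂ] E)} {O O' : Set X} (h : IsSupportedIn Φ ρ O)
    (hO : O ⊆ O') : IsSupportedIn Φ ρ O' := by
  refine top_unique (h.symm.le.trans (Submodule.topologicalClosure_mono (Submodule.span_mono ?_)))
  rintro _ ⟨a, ha, ξ, rfl⟩
  exact ⟨a, fun y hy => ha y fun h => hy (hO h), ξ, rfl⟩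

theorem IsOscillationBounded.mono {E : Type*} [NormedAddCommGroup E] [InnerProductSpace ℂ E]
    [CompleteSpace E] {ρ ρ' : M →⋆ₐ[ℂ] (E →L[ℂ] E)} {x₀ : X} {O O' : Set X}
    (h : IsOscillationBounded Φ ρ ρ' x₀ O) (hO : O ⊆ O') : IsOscillationBounded Φ ρ ρ' x₀ O' :=
  fun a ε hε ha => h a ε hε fun y hy => ha y (hO hy)

variable [IsClosed (J : Set M)] [LocallyCompactSpace X] [MulAction G X]

/-- The induced representations of two representations which are close to each other in a small
neighbourhood of `x₀` are close to each other at any given element of `G ⋉ J`. -/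
theorem exists_nhds_norm_inducedHom_sub_le
    (hprop : IsProperAction G X) (hJinv : ∀ t : G, ∀ a ∈ J, t • a ∈ J)
    (hinv : ∀ (t : G) (x : X) (a : J), ‖evalAt Φ x ⟨t • a, hJinv t a a.2⟩‖ = ‖evalAt Φ (t • x) a‖)
    {z : CovariantFamilies G M} (hz : z ∈ crossedProductOf G J) (x₀ : X) {ε : ℝ} (hε : 0 < ε) :
    ∃ O ∈ nhds x₀, ∀ (E : Type (max u v)) [NormedAddCommGroup E] [InnerProductSpace ℂ E]
      [CompleteSpace E] (hE : Nontrivial E) (ρ ρ' : M →⋆ₐ[ℂ] (E →L[ℂ] E)),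
      IsOscillationBounded Φ ρ ρ' x₀ O → ‖inducedHom G ρ hE z - inducedHom G ρ' hE z‖ ≤ ε := by
  -- the elements with the claimed property form a closed `*`-subalgebra, so that it is enough to
  -- consider functions in `C_c(G, J)`
  let P : CovariantFamilies G M → ℝ → Prop := fun z ε =>
    ∃ O ∈ nhds x₀, ∀ (E : Type (max u v)) [NormedAddCommGroup E] [InnerProductSpace ℂ E]
      [CompleteSpace E] (hE : Nontrivial E) (ρ ρ' : M →⋆ₐ[ℂ] (E →L[ℂ] E)),
      IsOscillationBounded Φ ρ ρ' x₀ O → ‖inducedHom G ρ hE z - inducedHom G ρ' hE z‖ ≤ ε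
  let S : NonUnitalStarSubalgebra ℂ (CovariantFamilies G M) :=
    { carrier := {z | ∀ ε > 0, P z ε}
      zero_mem' := fun ε hε => ⟨Set.univ, univ_mem, fun E _ _ _ hE ρ ρ' _ => by
        rw [map_zero, map_zero, sub_zero, norm_zero]
        exact hε.le⟩
      add_mem' := by
        intro a b ha hb ε hε
        obtain ⟨O, hO, h1⟩ := ha (ε / 2) (half_pos hε)
        obtain ⟨O', hO', h2⟩ := hb (ε / 2) (half_pos hε)
        refine ⟨O ∩ O', inter_mem hO hO', fun E _ _ _ hE ρ ρ' h => ?_⟩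
        have e1 := h1 E hE ρ ρ' (h.mono Set.inter_subset_left)
        have e2 := h2 E hE ρ ρ' (h.mono Set.inter_subset_right)
        rw [map_add, map_add, add_sub_add_comm]
        exact (norm_add_le _ _).trans ((add_le_add e1 e2).trans_eq (add_halves ε))
      smul_mem' := by
        intro c a ha ε hε
        obtain ⟨O, hO, h1⟩ := ha (ε / (‖c‖ + 1)) (by positivity)
        refine ⟨O, hO, fun E _ _ _ hE ρ ρ' h => ?_⟩
        have e1 := h1 E hE ρ ρ' h
        rw [map_smul, map_smul, ← smul_sub, norm_smul]
        rw [le_div_iff₀ (by positivity)] at e1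
        nlinarith [norm_nonneg (inducedHom G ρ hE a - inducedHom G ρ' hE a), norm_nonneg c]
      mul_mem' := by
        intro a b ha hb ε hε
        have hδ : 0 < ε / (‖a‖ + ‖b‖ + 1) := by positivity
        obtain ⟨O, hO, h1⟩ := ha _ hδ
        obtain ⟨O', hO', h2⟩ := hb _ hδ
        refine ⟨O ∩ O', inter_mem hO hO', fun E _ _ _ hE ρ ρ' h => ?_⟩
        have e1 := h1 E hE ρ ρ' (h.mono Set.inter_subset_left)
        have e2 := h2 E hE ρ ρ' (h.mono Set.inter_subset_right)
        have h3 : inducedHom G ρ hE (a * b) - inducedHom G ρ' hE (a * b) =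
            (inducedHom G ρ hE a - inducedHom G ρ' hE a) * inducedHom G ρ hE b +
            inducedHom G ρ' hE a * (inducedHom G ρ hE b - inducedHom G ρ' hE b) := by
          rw [map_mul, map_mul]
          noncomm_ring
        rw [h3]
        refine (norm_add_le _ _).trans ((add_le_add (norm_mul_le _ _) (norm_mul_le _ _)).trans ?_)
        have e3 := norm_inducedHom_le (G := G) ρ hE b
        have e4 := norm_inducedHom_le (G := G) ρ' hE a
        have e5 : ε / (‖a‖ + ‖b‖ + 1) * (‖a‖ + ‖b‖ + 1) = ε := div_mul_cancel₀ _ (by positivity)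
        have e6 := mul_le_mul e1 e3 (norm_nonneg _) hδ.le
        have e7 := mul_le_mul e4 e2 (norm_nonneg _) (norm_nonneg a)
        nlinarith
      star_mem' := by
        intro a ha ε hε
        obtain ⟨O, hO, h1⟩ := ha ε hε
        refine ⟨O, hO, fun E _ _ _ hE ρ ρ' h => ?_⟩
        rw [map_star, map_star, ← star_sub, norm_star]
        exact h1 E hE ρ ρ' h }
  have hS : IsClosed (S : Set (CovariantFamilies G M)) := by
    rw [← closure_subset_iff_isClosed]
    intro z hz ε hε
    obtain ⟨w, hw, hzw⟩ := Metric.mem_closure_iff.1 hz (ε / 3) (by positivity)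
    obtain ⟨O, hO, h1⟩ := hw (ε / 3) (by positivity)
    refine ⟨O, hO, fun E _ _ _ hE ρ ρ' h => ?_⟩
    have e1 := h1 E hE ρ ρ' h
    have e2 := norm_inducedHom_le (G := G) ρ hE (z - w)
    have e3 := norm_inducedHom_le (G := G) ρ' hE (z - w)
    rw [dist_eq_norm] at hzw
    have h3 : inducedHom G ρ hE z - inducedHom G ρ' hE z =
        inducedHom G ρ hE (z - w) + (inducedHom G ρ hE w - inducedHom G ρ' hE w) -
        inducedHom G ρ' hE (z - w) := by
      rw [map_sub, map_sub]
      abel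
    rw [h3]
    have e4 := norm_sub_le (inducedHom G ρ hE (z - w) +
      (inducedHom G ρ hE w - inducedHom G ρ' hE w)) (inducedHom G ρ' hE (z - w))
    have e5 := norm_add_le (inducedHom G ρ hE (z - w))
      (inducedHom G ρ hE w - inducedHom G ρ' hE w)
    linarith
  have hle : crossedProductOf G J ≤ S := by
    refine NonUnitalStarSubalgebra.topologicalClosure_minimal _
      (NonUnitalStarAlgebra.adjoin_le ?_) hS
    rintro _ ⟨f, hf, rfl⟩ ε hε
    have hμ : 0 < (Measure.haar : Measure G).real (tsupport f) + 1 :=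
      add_pos_of_nonneg_of_pos measureReal_nonneg one_pos
    have h0 : HasCompactSupport fun s => (⟨f s, hf s⟩ : J) :=
      f.hasCompactSupport.mono fun s hs h => hs (Subtype.ext h)
    have h1 := eventually_forall_forall_norm_evalAt_smul_sub_le hprop hJinv hinv
      (f := fun s => (⟨f s, hf s⟩ : J)) (f.continuous.subtype_mk _) h0 x₀ (div_pos hε hμ)
    refine ⟨_, h1, fun E _ _ _ hE ρ ρ' h => ?_⟩
    -- `hy` holds for all `y` in the neighbourhood, which is the set of such `y`
    refine (norm_eval_universalRep_sub_le hE f (div_pos hε hμ).le fun s t =>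
      h ⟨t • f s, hJinv t _ (hf s)⟩ _ (div_pos hε hμ).le fun y hy => hy s t).trans ?_
    rw [mul_div_assoc', div_le_iff₀ hμ]
    nlinarith
  exact hle hz ε hε

/-- A lower bound for `T ∈ 1 + G ⋉ J` in the regular representation for a point `x₀` is, up to
`ε`, a lower bound in the representations induced from those which are supported near `x₀`. -/
theorem exists_nhds_smul_one_le_inducedHom [T2Space X] [Nontrivial H₀]
    (hJ : ∀ a ∈ J, ∀ x : M, x * a ∈ J ∧ a * x ∈ J)
    (hprop : IsProperAction G X) (hJinv : ∀ t : G, ∀ a ∈ J, t • a ∈ J)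
    (hinv : ∀ (t : G) (x : X) (a : J), ‖evalAt Φ x ⟨t • a, hJinv t a a.2⟩‖ = ‖evalAt Φ (t • x) a‖)
    {T : CovariantFamilies G M} (hT : IsSelfAdjoint T) (hTJ : T - 1 ∈ crossedProductOf G J)
    {x₀ : X} (hx₀ : ∃ a, Φ a x₀ ≠ 0) {π : M →⋆ₐ[ℂ] (H₀ →L[ℂ] H₀)} {W : H₀ ≃ₗᵢ[ℂ] H₀}
    (hW : ∀ (a : J) ξ, W (evalAt Φ x₀ a ξ) = π a (W ξ)) (hH : Nontrivial H₀) {c : ℝ}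
    (hc : (c : ℂ) • (1 : (regularRep G π hH).H →L[ℂ] (regularRep G π hH).H) ≤
      (regularRep G π hH).eval T) {ε : ℝ} (hε : 0 < ε) :
    ∃ O ∈ nhds x₀, ∀ (E : Type (max u v)) [NormedAddCommGroup E] [InnerProductSpace ℂ E]
      [CompleteSpace E] (hE : Nontrivial E) (ρ : M →⋆ₐ[ℂ] (E →L[ℂ] E)),
      IsSupportedIn Φ ρ O →
      ((c - ε : ℝ) : ℂ) • (1 : L2Haar G E →L[ℂ] L2Haar G E) ≤ inducedHom G ρ hE T := by
  obtain ⟨O, hO, h⟩ := exists_nhds_norm_inducedHom_sub_le hprop hJinv hinv hTJ x₀ hε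
  obtain ⟨N, hN, hNx⟩ := exists_compact_mem_nhds x₀
  obtain ⟨g, hg1, -, hg, -⟩ := exists_continuous_one_zero_of_isCompact hN isClosed_empty
    (Set.disjoint_empty N)
  refine ⟨N ∩ O, inter_mem hNx hO, fun E _ _ _ hE ρ hρ => ?_⟩
  obtain ⟨ρ', hρ', V, hV, hd⟩ := hρ.exists_multiple hJ hg
    (fun y hy => hg1 hy.1) hx₀ hW
  have h1 := h E hE ρ ρ' (hρ'.mono Set.inter_subset_right)
  rw [map_sub, map_sub, map_one, map_one, sub_sub_sub_cancel_right] at h1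
  exact smul_one_le_of_norm_sub_le (hT.map (inducedHom G ρ hE))
    (smul_one_le_inducedHom π hH ρ' hE V hV hd hT hTJ hc) h1

end LowerBound

/-! ### Essential subspaces of ideals -/

section Subrepresentation

variable {A : Type*} [CStarAlgebra A] {H : Type*} [NormedAddCommGroup H] [InnerProductSpace ℂ H]
  [CompleteSpace H] (rep : A →⋆ₐ[ℂ] (H →L[ℂ] H))

theorem inner_starAlgHom_apply_left (a : A) (ξ η : H) :
    ⟪rep a ξ, η⟫_ℂ = ⟪ξ, rep (star a) η⟫_ℂ := by
  rw [map_star, ContinuousLinearMap.star_eq_adjoint, ContinuousLinearMap.adjoint_inner_right]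

/-- The restriction of a representation to a closed invariant subspace. -/
def subrepresentation (K : Submodule ℂ H) [CompleteSpace K]
    (hK : ∀ a, ∀ ξ ∈ K, rep a ξ ∈ K) : A →⋆ₐ[ℂ] (K →L[ℂ] K) where
  toFun a := ((rep a).comp K.subtypeL).codRestrict K fun ξ => hK a ξ ξ.2
  map_one' := by
    ext ξ
    exact congrArg (fun T : H →L[ℂ] H => T ξ) (map_one rep)
  map_mul' a b := by
    ext ξ
    exact congrArg (fun T : H →L[ℂ] H => T ξ) (map_mul rep a b)
  map_zero' := by
    ext ξ
    exact congrArg (fun T : H →L[ℂ] H => T ξ) (map_zero rep)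
  map_add' a b := by
    ext ξ
    exact congrArg (fun T : H →L[ℂ] H => T ξ) (map_add rep a b)
  commutes' z := by
    ext ξ
    refine (congrArg (fun T : H →L[ℂ] H => T ξ) (AlgHomClass.commutes rep z)).trans ?_
    rw [Algebra.algebraMap_eq_smul_one, Algebra.algebraMap_eq_smul_one]
    rfl
  map_star' a := by
    rw [ContinuousLinearMap.star_eq_adjoint, ContinuousLinearMap.eq_adjoint_iff]
    intro ξ η
    refine (inner_starAlgHom_apply_left rep (star a) (ξ : H) (η : H)).trans ?_
    rw [star_star]
    rfl

theorem coe_subrepresentation_apply {K : Submodule ℂ H} [CompleteSpace K]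
    (hK : ∀ a, ∀ ξ ∈ K, rep a ξ ∈ K) (a : A) (ξ : K) :
    (subrepresentation rep K hK a ξ : H) = rep a ξ := rfl

theorem starProjection_apply_comm {K : Submodule ℂ H} [CompleteSpace K]
    (hK : ∀ a, ∀ ξ ∈ K, rep a ξ ∈ K) (a : A) (ξ : H) :
    K.starProjection (rep a ξ) = rep a (K.starProjection ξ) := by
  refine Submodule.eq_starProjection_of_mem_orthogonal
    (hK a _ (Submodule.starProjection_apply_mem K ξ)) ?_
  rw [← map_sub, Submodule.mem_orthogonal']
  intro η hη
  rw [inner_starAlgHom_apply_left]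
  exact (Submodule.mem_orthogonal' _ _).1 (Submodule.sub_starProjection_mem_orthogonal ξ) _
    (hK _ _ hη)

/-- The essential subspace of an ideal: the closed span of `rep I H`. -/
def essentialSubspace (I : TwoSidedIdeal A) : Submodule ℂ H :=
  (Submodule.span ℂ {x | ∃ a ∈ I, ∃ ξ, rep a ξ = x}).topologicalClosure

instance (I : TwoSidedIdeal A) : CompleteSpace (essentialSubspace rep I) :=
  Submodule.topologicalClosure.completeSpace _

theorem apply_mem_essentialSubspace {I : TwoSidedIdeal A} {a : A} (ha : a ∈ I) (ξ : H) :
    rep a ξ ∈ essentialSubspace rep I :=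
  Submodule.le_topologicalClosure _ (Submodule.subset_span ⟨a, ha, ξ, rfl⟩)

/-- An operator which maps `rep I H` into a closed subspace maps the essential subspace into it. -/
theorem essentialSubspace_le_comap {I : TwoSidedIdeal A} {H' : Type*} [NormedAddCommGroup H']
    [InnerProductSpace ℂ H'] (T : H →L[ℂ] H') {K : Submodule ℂ H'} (hK : IsClosed (K : Set H'))
    (h : ∀ a ∈ I, ∀ ξ, T (rep a ξ) ∈ K) : ∀ ξ ∈ essentialSubspace rep I, T ξ ∈ K := by
  have : essentialSubspace rep I ≤ K.comap T.toLinearMap := by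
    refine Submodule.topologicalClosure_minimal _ (Submodule.span_le.2 ?_)
      (hK.preimage T.continuous)
    rintro _ ⟨a, ha, ξ, rfl⟩
    exact h a ha ξ
  exact this

theorem isClosed_essentialSubspace (I : TwoSidedIdeal A) :
    IsClosed (essentialSubspace rep I : Set H) :=
  Submodule.isClosed_topologicalClosure _

theorem essentialSubspace_invariant (I : TwoSidedIdeal A) (a : A) :
    ∀ ξ ∈ essentialSubspace rep I, rep a ξ ∈ essentialSubspace rep I :=
  essentialSubspace_le_comap rep (rep a) (isClosed_essentialSubspace rep I) fun b hb ξ => by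
    rw [← mul_apply_eq_comp, ← map_mul]
    exact apply_mem_essentialSubspace rep (I.mul_mem_left _ _ hb) ξ

theorem mem_orthogonal_essentialSubspace (I : TwoSidedIdeal A) {η : H} :
    η ∈ (essentialSubspace rep I)ᗮ ↔ ∀ a ∈ I, ∀ ξ, ⟪rep a ξ, η⟫_ℂ = 0 := by
  refine ⟨fun h a ha ξ => h _ (apply_mem_essentialSubspace rep ha ξ), fun h => ?_⟩
  rw [essentialSubspace, Submodule.orthogonal_closure, Submodule.mem_orthogonal]
  intro x hx
  induction hx using Submodule.span_induction with
  | mem x hx =>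
    obtain ⟨a, ha, ξ, rfl⟩ := hx
    exact h a ha ξ
  | zero => exact inner_zero_left _
  | add x y _ _ hx hy => rw [inner_add_left, hx, hy, add_zero]
  | smul c x _ hx => rw [inner_smul_left, hx, mul_zero]

/-- The ideal acts nondegenerately on its essential subspace. -/
theorem dense_subrepresentation_essentialSubspace (I : TwoSidedIdeal A) :
    (Submodule.span ℂ {x | ∃ a ∈ I, ∃ ξ, subrepresentation rep (essentialSubspace rep I)
      (essentialSubspace_invariant rep I) a ξ = x}).topologicalClosure = ⊤ := by
  rw [Submodule.topologicalClosure_eq_top_iff, Submodule.eq_bot_iff]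
  intro ζ hζ
  have h1 : ∀ a ∈ I, rep (star a) ζ = 0 := by
    intro a ha
    have hmem := essentialSubspace_invariant rep I (star a) ζ ζ.2
    have h2 := (Submodule.mem_orthogonal _ _).1 hζ _
      (Submodule.subset_span ⟨a, ha, ⟨rep (star a) ζ, hmem⟩, rfl⟩)
    rw [Submodule.coe_inner, coe_subrepresentation_apply, inner_starAlgHom_apply_left,
      inner_self_eq_zero] at h2
    exact h2
  have h3 : (ζ : H) ∈ (essentialSubspace rep I)ᗮ := by
    refine (mem_orthogonal_essentialSubspace rep I).2 fun a ha ξ => ?_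
    rw [inner_starAlgHom_apply_left, h1 a ha, inner_zero_right]
  exact Subtype.ext (inner_self_eq_zero.1 ((Submodule.mem_orthogonal _ _).1 h3 ζ ζ.2))

end Subrepresentation

/-! ### Translated projections -/

section Averaging

variable {G : Type u} {A : Type v} [Group G] [TopologicalSpace G] [IsTopologicalGroup G]
  [CStarAlgebra A] [MulSemiringAction G A]

namespace CovariantRep

variable (R : CovariantRep G A)

theorem U_mul_apply (s t : G) (ξ : R.H) : R.U (s * t) ξ = R.U s (R.U t ξ) := by
  rw [map_mul]
  rfl

theorem U_inv_apply_U_apply (t : G) (ξ : R.H) : R.U t⁻¹ (R.U t ξ) = ξ := by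
  rw [← U_mul_apply, inv_mul_cancel, map_one]
  rfl

theorem U_apply_U_inv_apply (t : G) (ξ : R.H) : R.U t (R.U t⁻¹ ξ) = ξ := by
  rw [← U_mul_apply, mul_inv_cancel, map_one]
  rfl

theorem inner_U_apply_left (t : G) (ξ η : R.H) : ⟪R.U t ξ, η⟫_ℂ = ⟪ξ, R.U t⁻¹ η⟫_ℂ := by
  conv_lhs => rw [← R.U_apply_U_inv_apply t η, LinearIsometryEquiv.inner_map_map]

theorem continuous_U_apply {X : Type*} [TopologicalSpace X] {f : X → G} (hf : Continuous f)
    {φ : X → R.H} (hφ : Continuous φ) : Continuous fun x => R.U (f x) (φ x) := by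
  rw [continuous_iff_continuousAt]
  intro x
  rw [ContinuousAt, tendsto_iff_norm_sub_tendsto_zero]
  have h1 : Tendsto (fun y => ‖φ y - φ x‖ + ‖R.U (f y) (φ x) - R.U (f x) (φ x)‖) (nhds x)
      (nhds 0) := by
    have h2 : Continuous fun y => ‖φ y - φ x‖ + ‖R.U (f y) (φ x) - R.U (f x) (φ x)‖ :=
      ((hφ.sub continuous_const).norm).add
        ((((R.continuous_U (φ x)).comp hf).sub continuous_const).norm)
    simpa using h2.tendsto x
  refine squeeze_zero (fun _ => norm_nonneg _) (fun y => ?_) h1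
  refine (norm_sub_le_norm_sub_add_norm_sub _ (R.U (f y) (φ x)) _).trans_eq ?_
  rw [← map_sub, LinearIsometryEquiv.norm_map]

variable (I : TwoSidedIdeal A)

/-- The translate `U_t P U_t⁻¹` of the projection `P` onto the essential subspace of an ideal, as a
function. -/
def translatedProjection (t : G) (ξ : R.H) : R.H :=
  R.U t ((essentialSubspace R.rep I).starProjection (R.U t⁻¹ ξ))

theorem continuous_translatedProjection (ξ : R.H) :
    Continuous fun t => R.translatedProjection I t ξ :=
  R.continuous_U_apply continuous_id
    ((essentialSubspace R.rep I).starProjection.continuous.comp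
      ((R.continuous_U ξ).comp continuous_inv))

theorem norm_translatedProjection (t : G) (ξ : R.H) : ‖R.translatedProjection I t ξ‖ =
    ‖(essentialSubspace R.rep I).starProjection (R.U t⁻¹ ξ)‖ :=
  LinearIsometryEquiv.norm_map _ _

theorem translatedProjection_rep (t : G) (a : A) (ξ : R.H) :
    R.translatedProjection I t (R.rep a ξ) = R.rep a (R.translatedProjection I t ξ) := by
  rw [translatedProjection, R.covariant,
    starProjection_apply_comm R.rep (essentialSubspace_invariant R.rep I), R.covariant,
    smul_smul, mul_inv_cancel, one_smul]
  rfl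

theorem inner_translatedProjection_left (t : G) (ξ η : R.H) :
    ⟪R.translatedProjection I t ξ, η⟫_ℂ = ⟪ξ, R.translatedProjection I t η⟫_ℂ := by
  rw [translatedProjection, inner_U_apply_left, Submodule.inner_starProjection_left_eq_right]
  conv_lhs => rw [inner_U_apply_left, inv_inv]
  rfl

theorem inner_translatedProjection_self (t : G) (ξ : R.H) :
    ⟪ξ, R.translatedProjection I t ξ⟫_ℂ = (‖R.translatedProjection I t ξ‖ : ℂ) ^ 2 := by
  have h : R.translatedProjection I t (R.translatedProjection I t ξ) =
      R.translatedProjection I t ξ := by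
    rw [translatedProjection, translatedProjection, U_inv_apply_U_apply,
      Submodule.starProjection_eq_self_iff.2 (Submodule.starProjection_apply_mem _ _)]
  rw [← h, ← inner_translatedProjection_left, h, inner_self_eq_norm_sq_to_K]
  rfl

theorem norm_translatedProjection_le (t : G) (ξ : R.H) :
    ‖R.translatedProjection I t ξ‖ ≤ ‖ξ‖ := by
  rw [norm_translatedProjection]
  exact (Submodule.norm_starProjection_apply_le _ _).trans_eq (LinearIsometryEquiv.norm_map _ _)

/-- The translated projections are projections onto essential subspaces of ideals, so that they
commute with each other. This is only needed in the form of the estimate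
`⟪P_s ξ, P_t ξ⟫ = ⟪P_s P_t ξ, P_t ξ⟫ ≤ ‖P_t ξ‖²`. -/
theorem re_inner_translatedProjection_le (s t : G) (ξ : R.H) :
    RCLike.re ⟪R.translatedProjection I s ξ, R.translatedProjection I t ξ⟫_ℂ ≤
      ‖R.translatedProjection I t ξ‖ ^ 2 := by
  have hmem : ∀ (r : G), ∀ ζ ∈ essentialSubspace R.rep I,
      R.translatedProjection I r ζ ∈ essentialSubspace R.rep I := by
    intro r
    refine essentialSubspace_le_comap R.rep
      (((R.U r).toContinuousLinearEquiv : R.H →L[ℂ] R.H) ∘L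
        (essentialSubspace R.rep I).starProjection ∘L
        ((R.U r⁻¹).toContinuousLinearEquiv : R.H →L[ℂ] R.H))
      (isClosed_essentialSubspace R.rep I) fun a ha ζ => ?_
    change R.translatedProjection I r (R.rep a ζ) ∈ _
    rw [translatedProjection_rep]
    exact apply_mem_essentialSubspace R.rep ha _
  have key : ∀ (r : G) (ζ : R.H),
      RCLike.re ⟪R.translatedProjection I r ζ, (essentialSubspace R.rep I).starProjection ζ⟫_ℂ ≤
        ‖(essentialSubspace R.rep I).starProjection ζ‖ ^ 2 := by
    intro r ζ
    set p := (essentialSubspace R.rep I).starProjection ζ with hp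
    have hpm : p ∈ essentialSubspace R.rep I := Submodule.starProjection_apply_mem _ _
    rw [inner_translatedProjection_left, ← Submodule.starProjection_eq_self_iff.2 (hmem r p hpm),
      ← Submodule.inner_starProjection_left_eq_right, ← hp]
    refine (RCLike.re_le_norm _).trans ((norm_inner_le_norm _ _).trans ?_)
    rw [pow_two]
    exact mul_le_mul_of_nonneg_left (R.norm_translatedProjection_le I r p) (norm_nonneg _)
  have h1 : R.translatedProjection I s ξ =
      R.U t (R.translatedProjection I (t⁻¹ * s) (R.U t⁻¹ ξ)) := by
    rw [translatedProjection, translatedProjection, ← U_mul_apply, ← U_mul_apply,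
      mul_inv_cancel_left]
    congr 3
    group
  rw [norm_translatedProjection, h1, translatedProjection, translatedProjection,
    LinearIsometryEquiv.inner_map_map]
  exact key (t⁻¹ * s) (R.U t⁻¹ ξ)

/-- If the ideal `I` and its translate by `r` have product zero, then their essential subspaces are
orthogonal to each other. -/
theorem starProjection_U_apply_eq_zero {r : G} (h : ∀ a ∈ I, ∀ b ∈ I, star b * (r • a) = 0) :
    ∀ ζ ∈ essentialSubspace R.rep I,
      (essentialSubspace R.rep I).starProjection (R.U r ζ) = 0 := by
  intro ζ hζ
  rw [Submodule.starProjection_apply_eq_zero_iff]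
  refine essentialSubspace_le_comap R.rep ((R.U r).toContinuousLinearEquiv : R.H →L[ℂ] R.H)
    (Submodule.isClosed_orthogonal _) (fun a ha ξ => ?_) ζ hζ
  change R.U r (R.rep a ξ) ∈ _
  refine (mem_orthogonal_essentialSubspace R.rep I).2 fun b hb η => ?_
  rw [R.covariant, inner_starAlgHom_apply_left, ← mul_apply_eq_comp, ← map_mul, h a ha b hb,
    map_zero]
  exact inner_zero_right _

end CovariantRep

end Averaging

/-! ### Square integrability of translated projections -/

/-- A continuous function with integral zero over all compact sets is zero. -/
theorem eq_zero_of_forall_setIntegral_isCompact_eq_zero {G : Type*} [TopologicalSpace G]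
    [LocallyCompactSpace G] [T2Space G] [MeasurableSpace G] [BorelSpace G] {μ : Measure G}
    [μ.IsOpenPosMeasure] [IsFiniteMeasureOnCompacts μ] {E : Type*} [NormedAddCommGroup E]
    [NormedSpace ℝ E] [CompleteSpace E] {g : G → E} (hg : Continuous g)
    (h : ∀ N, IsCompact N → ∫ t in N, g t ∂μ = 0) (s : G) : g s = 0 := by
  by_contra hs
  have hpos : 0 < ‖g s‖ / 2 := half_pos (norm_pos_iff.2 hs)
  obtain ⟨N, hN, hNs, hNc⟩ := local_compact_nhds
    ((Metric.tendsto_nhds.1 (hg.tendsto s)) _ hpos)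
  have hμ0 : 0 < μ.real N :=
    ENNReal.toReal_pos (Measure.measure_pos_of_mem_nhds _ hN).ne' hNc.measure_lt_top.ne
  have h1 : ‖∫ t in N, (g t - g s) ∂μ‖ ≤ ‖g s‖ / 2 * μ.real N :=
    norm_setIntegral_le_of_norm_le_const hNc.measure_lt_top fun t ht => by
      rw [← dist_eq_norm]
      exact (hNs ht).le
  rw [integral_sub (hg.continuousOn.integrableOn_compact hNc)
    (integrableOn_const hNc.measure_lt_top.ne), h N hNc, setIntegral_const, zero_sub, norm_neg,
    norm_smul, Real.norm_eq_abs, abs_of_pos hμ0] at h1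
  nlinarith [norm_pos_iff.2 hs]

section Averaging

variable {G : Type u} {A : Type v} [Group G] [TopologicalSpace G] [IsTopologicalGroup G]
  [T2Space G] [LocallyCompactSpace G] [MeasurableSpace G] [BorelSpace G]
  [CStarAlgebra A] [MulSemiringAction G A]

namespace CovariantRep

variable (R : CovariantRep G A) (I : TwoSidedIdeal A)

/-- Let `P_t` be the translated projections, and assume that the ideal and its translate by `r` have
product zero for `r` outside of a compact set `A₀` of measure `C`. Then the square integral `q` of
`t ↦ P_t ξ` over any compact set is at most `C ‖ξ‖²`. Indeed, if `η` is the integral of `P_t ξ`,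
then `q = ⟪ξ, η⟫ ≤ ‖ξ‖ ‖η‖`, and `‖η‖² ≤ C q` because `⟪P_s ξ, P_t ξ⟫` is at most `‖P_t ξ‖²` for
`s ∈ t A₀` and is zero otherwise. -/
theorem setIntegral_norm_sq_translatedProjection_le {A₀ : Set G} (hA₀ : IsCompact A₀)
    (hdisj : ∀ r ∉ A₀, ∀ a ∈ I, ∀ b ∈ I, star b * (r • a) = 0) {N : Set G} (hN : IsCompact N)
    (ξ : R.H) : ∫ t in N, ‖R.translatedProjection I t ξ‖ ^ 2 ∂(Measure.haar : Measure G) ≤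
      (Measure.haar : Measure G).real A₀ * ‖ξ‖ ^ 2 := by
  set μ := (Measure.haar : Measure G)
  set F := fun t => R.translatedProjection I t ξ with hF
  have hFc : Continuous F := R.continuous_translatedProjection I ξ
  have hint : IntegrableOn F N μ := hFc.continuousOn.integrableOn_compact hN
  set η := ∫ t in N, F t ∂μ with hη
  have horth : ∀ s t, s ∉ (fun r => t * r) '' A₀ → ⟪F s, F t⟫_ℂ = 0 := by
    intro s t hst
    have hr : t⁻¹ * s ∉ A₀ := fun h => hst ⟨_, h, mul_inv_cancel_left t s⟩
    have h1 := R.starProjection_U_apply_eq_zero I (hdisj _ hr) _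
      (Submodule.starProjection_apply_mem (essentialSubspace R.rep I) (R.U s⁻¹ ξ))
    rw [hF]
    dsimp only
    rw [translatedProjection, translatedProjection, ← inv_inv t, ← inner_U_apply_left, inv_inv,
      ← U_mul_apply, ← Submodule.inner_starProjection_left_eq_right, h1, inner_zero_left]
  have hpt : ∀ t, RCLike.re ⟪η, F t⟫_ℂ ≤ μ.real A₀ * ‖F t‖ ^ 2 := by
    intro t
    have hS : IsCompact ((fun r => t * r) '' A₀) := hA₀.image (continuous_const_mul t)
    have h1 : RCLike.re ⟪F t, η⟫_ℂ = ∫ s in N, RCLike.re ⟪F t, F s⟫_ℂ ∂μ := by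
      rw [hη, ← integral_inner hint, ← integral_re (hint.const_inner (F t))]
    rw [inner_re_symm, h1]
    have h2 : ∫ s in N, RCLike.re ⟪F t, F s⟫_ℂ ∂μ ≤
        ∫ s in N, ((fun r => t * r) '' A₀).indicator (fun _ => ‖F t‖ ^ 2) s ∂μ := by
      refine integral_mono (hint.const_inner (F t)).re
        (((integrable_indicator_iff hS.measurableSet).2
          (integrableOn_const hS.measure_lt_top.ne)).integrableOn) fun s => ?_
      by_cases hs : s ∈ (fun r => t * r) '' A₀
      · rw [Set.indicator_of_mem hs]
        dsimp only
        rw [inner_re_symm]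
        exact R.re_inner_translatedProjection_le I s t ξ
      · rw [Set.indicator_of_notMem hs]
        dsimp only
        rw [inner_re_symm, horth s t hs, map_zero]
    refine h2.trans ?_
    refine (setIntegral_le_integral ((integrable_indicator_iff hS.measurableSet).2
      (integrableOn_const hS.measure_lt_top.ne)) (Eventually.of_forall fun s =>
        Set.indicator_nonneg (fun _ _ => by positivity) s)).trans_eq ?_
    rw [integral_indicator hS.measurableSet, setIntegral_const, smul_eq_mul]
    congr 1
    -- the Haar measure is left invariant, so that `t A₀` has the measure of `A₀`
    rw [measureReal_def, measureReal_def, Set.image_mul_left, measure_preimage_mul]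
  set q := ∫ t in N, ‖F t‖ ^ 2 ∂μ with hq
  have hq0 : 0 ≤ q := integral_nonneg fun t => by positivity
  have hqi : IntegrableOn (fun t => ‖F t‖ ^ 2) N μ :=
    (hFc.norm.pow 2).continuousOn.integrableOn_compact hN
  have h1 : ‖η‖ ^ 2 ≤ μ.real A₀ * q := by
    have h2 : RCLike.re ⟪η, η⟫_ℂ = ∫ t in N, RCLike.re ⟪η, F t⟫_ℂ ∂μ := by
      conv_lhs => rw [hη, ← hη, ← integral_inner hint, ← integral_re (hint.const_inner η)]
    rw [inner_self_eq_norm_sq (𝕜 := ℂ)] at h2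
    rw [h2, hq, ← integral_const_mul]
    exact integral_mono (hint.const_inner η).re (hqi.const_mul _) hpt
  have h3 : q ≤ ‖ξ‖ * ‖η‖ := by
    have h4 : RCLike.re ⟪ξ, η⟫_ℂ = q := by
      rw [hη, ← integral_inner hint, ← integral_re (hint.const_inner ξ), hq]
      refine integral_congr_ae (Eventually.of_forall fun t => ?_)
      dsimp only
      rw [hF]
      dsimp only
      rw [R.inner_translatedProjection_self I t ξ, ← Complex.ofReal_pow]
      rfl
    rw [← h4]
    exact (RCLike.re_le_norm _).trans (norm_inner_le_norm _ _)
  have h5 : q * q ≤ q * (μ.real A₀ * ‖ξ‖ ^ 2) := by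
    calc q * q ≤ (‖ξ‖ * ‖η‖) * (‖ξ‖ * ‖η‖) := mul_le_mul h3 h3 hq0 (by positivity)
      _ = ‖ξ‖ ^ 2 * ‖η‖ ^ 2 := by ring
      _ ≤ ‖ξ‖ ^ 2 * (μ.real A₀ * q) := mul_le_mul_of_nonneg_left h1 (by positivity)
      _ = q * (μ.real A₀ * ‖ξ‖ ^ 2) := by ring
  rcases hq0.eq_or_lt with h0 | h0
  · rw [← h0]
    exact mul_nonneg measureReal_nonneg (by positivity)
  · exact le_of_mul_le_mul_left h5 h0

end CovariantRep

end Averaging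

/-! ### Intertwiners with induced representations -/

section Decomposition

variable {G : Type u} {A : Type v} [Group G] [TopologicalSpace G] [IsTopologicalGroup G]
  [CStarAlgebra A] [MulSemiringAction G A]

namespace CovariantRep

variable (R : CovariantRep G A) (I : TwoSidedIdeal A)

/-- The representation of `A` on the essential subspace of an ideal. -/
def essentialRep :
    A →⋆ₐ[ℂ] (essentialSubspace R.rep I →L[ℂ] essentialSubspace R.rep I) :=
  subrepresentation R.rep (essentialSubspace R.rep I) (essentialSubspace_invariant R.rep I)

/-- The function `t ↦ P U_t⁻¹ ξ` on `G`, where `P` is the projection onto the essential subspace of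
an ideal. -/
def component (ξ : R.H) (t : G) : essentialSubspace R.rep I :=
  (essentialSubspace R.rep I).orthogonalProjectionOnto (R.U t⁻¹ ξ)

theorem continuous_component (ξ : R.H) : Continuous (R.component I ξ) :=
  (essentialSubspace R.rep I).orthogonalProjectionOnto.continuous.comp
    ((R.continuous_U ξ).comp continuous_inv)

theorem norm_component (ξ : R.H) (t : G) :
    ‖R.component I ξ t‖ = ‖R.translatedProjection I t ξ‖ :=
  (R.norm_translatedProjection I t ξ).symm

theorem component_rep (a : A) (ξ : R.H) (t : G) :
    R.component I (R.rep a ξ) t = R.essentialRep I (t⁻¹ • a) (R.component I ξ t) := by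
  refine Subtype.ext ?_
  change (essentialSubspace R.rep I).starProjection (R.U t⁻¹ (R.rep a ξ)) =
    R.rep (t⁻¹ • a) ((essentialSubspace R.rep I).starProjection (R.U t⁻¹ ξ))
  rw [R.covariant, starProjection_apply_comm R.rep (essentialSubspace_invariant R.rep I)]

theorem component_U (s : G) (ξ : R.H) (t : G) :
    R.component I (R.U s ξ) t = R.component I ξ (s⁻¹ * t) := by
  rw [component, component, ← U_mul_apply, mul_inv_rev, inv_inv]

theorem inner_component (ζ : essentialSubspace R.rep I) (ξ : R.H) (t : G) :
    ⟪ζ, R.component I ξ t⟫_ℂ = ⟪R.U t ζ, ξ⟫_ℂ := by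
  rw [component, Submodule.inner_orthogonalProjectionOnto_eq_of_mem_left, inner_U_apply_left]

/-- The vectors `ξ` for which `t ↦ P U_t⁻¹ ξ` has compact support. For these, it is a continuous
function in `L²`, also if `G` is not σ-compact. -/
def compactlySupportedVectors : Submodule ℂ R.H where
  carrier := {ξ | HasCompactSupport (R.component I ξ)}
  add_mem' {ξ η} hξ hη := by
    have : R.component I (ξ + η) = R.component I ξ + R.component I η := by
      ext1 t
      rw [Pi.add_apply, component, component, component, map_add, map_add]
    rw [Set.mem_ofPred_eq, this]
    exact HasCompactSupport.add hξ hη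
  zero_mem' := by
    have : R.component I 0 = 0 := by
      ext1 t
      rw [Pi.zero_apply, component, map_zero, map_zero]
    rw [Set.mem_ofPred_eq, this]
    exact HasCompactSupport.zero
  smul_mem' c ξ hξ := by
    have : R.component I (c • ξ) = fun t => c • R.component I ξ t := by
      ext1 t
      rw [component, component, map_smul, map_smul]
    rw [Set.mem_ofPred_eq, this]
    exact HasCompactSupport.mono hξ fun t ht h => ht (by
      dsimp only
      rw [h, smul_zero])

theorem mem_compactlySupportedVectors {ξ : R.H} :
    ξ ∈ R.compactlySupportedVectors I ↔ HasCompactSupport (R.component I ξ) := Iff.rfl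

theorem rep_mem_compactlySupportedVectors (a : A) {ξ : R.H}
    (hξ : ξ ∈ R.compactlySupportedVectors I) : R.rep a ξ ∈ R.compactlySupportedVectors I :=
  HasCompactSupport.mono hξ fun t ht h => ht (by rw [component_rep, h, map_zero])

theorem U_mem_compactlySupportedVectors [T2Space G] (s : G) {ξ : R.H}
    (hξ : ξ ∈ R.compactlySupportedVectors I) : R.U s ξ ∈ R.compactlySupportedVectors I := by
  have : R.component I (R.U s ξ) = R.component I ξ ∘ Homeomorph.mulLeft s⁻¹ :=
    funext fun t => R.component_U I s ξ t
  rw [mem_compactlySupportedVectors, this]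
  exact HasCompactSupport.comp_homeomorph hξ _

variable {I} {A₀ : Set G} (hA₀ : IsCompact A₀)
  (hdisj : ∀ r ∉ A₀, ∀ a ∈ I, ∀ b ∈ I, star b * (r • a) = 0)

include hA₀ hdisj

/-- The vectors in the translates of the essential subspace have compactly supported components, and
the components of a vector which is orthogonal to all of these are zero. -/
theorem dense_compactlySupportedVectors [T2Space G] :
    Dense (R.compactlySupportedVectors I : Set R.H) := by
  rw [Submodule.dense_iff_topologicalClosure_eq_top, Submodule.topologicalClosure_eq_top_iff,
    Submodule.eq_bot_iff]
  intro η hη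
  have h1 : ∀ t (ζ : essentialSubspace R.rep I), R.U t ζ ∈ R.compactlySupportedVectors I := by
    intro t ζ
    refine HasCompactSupport.intro (K := (fun r => t * r⁻¹) '' A₀)
      (hA₀.image (continuous_const.mul continuous_inv)) fun s hs => ?_
    have hr : s⁻¹ * t ∉ A₀ := fun h => hs ⟨_, h, by group⟩
    refine Subtype.ext ?_
    change (essentialSubspace R.rep I).starProjection (R.U s⁻¹ (R.U t ζ)) = 0
    rw [← U_mul_apply]
    exact R.starProjection_U_apply_eq_zero I (hdisj _ hr) ζ ζ.2
  have h2 : R.component I η = 0 := by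
    ext1 t
    refine ext_inner_left ℂ fun ζ => ?_
    rw [inner_component, Pi.zero_apply, inner_zero_right]
    exact (Submodule.mem_orthogonal _ _).1 hη _ (h1 t ζ)
  have h3 : η ∈ R.compactlySupportedVectors I := by
    rw [mem_compactlySupportedVectors, h2]
    exact HasCompactSupport.zero
  exact inner_self_eq_zero.1 ((Submodule.mem_orthogonal _ _).1 hη _ h3)

variable [T2Space G] [LocallyCompactSpace G] [MeasurableSpace G] [BorelSpace G]
  [SMulCommClass G ℂ A] [StarSMul G A] [ContinuousSMul G A]

/-- The map `ξ ↦ (t ↦ P U_t⁻¹ ξ)` extends to a bounded intertwiner of `R` with the covariant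
representation induced from the essential subspace, and its kernel is orthogonal to all translates
of the essential subspace. -/
theorem exists_intertwiner_inducedRep :
    ∃ W : R.H →L[ℂ] L2Haar G (essentialSubspace R.rep I),
      (∀ a ξ, W (R.rep a ξ) = pointwiseRep (R.essentialRep I) a (W ξ)) ∧
      (∀ t ξ, W (R.U t ξ) = leftTranslation t (W ξ)) ∧
      ∀ η, W η = 0 → ∀ t (ζ : essentialSubspace R.rep I), ⟪R.U t ζ, η⟫_ℂ = 0 := by
  set μ := (Measure.haar : Measure G)
  have hmem : ∀ ξ : R.compactlySupportedVectors I, MemLp (R.component I (ξ : R.H)) 2 μ := fun ξ =>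
    (R.continuous_component I ξ).memLp_of_hasCompactSupport ξ.2
  let W₀ : R.compactlySupportedVectors I →ₗ[ℂ] L2Haar G (essentialSubspace R.rep I) :=
    { toFun := fun ξ => (hmem ξ).toLp _
      map_add' := fun ξ η => by
        rw [← MemLp.toLp_add]
        refine MemLp.toLp_congr _ _ (Eventually.of_forall fun t => ?_)
        rw [Pi.add_apply, component, component, component, Submodule.coe_add, map_add, map_add]
      map_smul' := fun c ξ => by
        rw [RingHom.id_apply, ← MemLp.toLp_const_smul]
        refine MemLp.toLp_congr _ _ (Eventually.of_forall fun t => ?_)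
        rw [Pi.smul_apply, component, component, Submodule.coe_smul, map_smul, map_smul] }
  have hW₀ : ∀ ξ, ∀ᵐ t ∂μ, W₀ ξ t = R.component I ξ t := fun ξ => (hmem ξ).coeFn_toLp
  have hd : DenseRange (R.compactlySupportedVectors I).subtype := by
    rw [DenseRange, Submodule.coe_subtype, Subtype.range_coe]
    exact R.dense_compactlySupportedVectors hA₀ hdisj
  have hbound : ∀ ξ, ‖W₀ ξ‖ ≤ √(μ.real A₀) * ‖(R.compactlySupportedVectors I).subtype ξ‖ := by
    intro ξ
    refine abs_le_of_sq_le_sq' ?_ (by positivity) |>.2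
    rw [mul_pow, Real.sq_sqrt measureReal_nonneg, ← inner_self_eq_norm_sq (𝕜 := ℂ), L2.inner_def]
    refine le_trans (le_of_eq ?_)
      (R.setIntegral_norm_sq_translatedProjection_le I hA₀ hdisj ξ.2.isCompact (ξ : R.H))
    have h1 : ∫ t, ⟪W₀ ξ t, W₀ ξ t⟫_ℂ ∂μ =
        ∫ t, ((‖R.translatedProjection I t ξ‖ ^ 2 : ℝ) : ℂ) ∂μ := by
      refine integral_congr_ae ?_
      filter_upwards [hW₀ ξ] with t ht
      rw [ht, inner_self_eq_norm_sq_to_K, norm_component, Complex.ofReal_pow]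
      rfl
    rw [h1, integral_complex_ofReal, RCLike.re_to_complex, Complex.ofReal_re]
    refine (setIntegral_eq_integral_of_forall_compl_eq_zero fun t ht => ?_).symm
    rw [← norm_component, image_eq_zero_of_notMem_tsupport ht, norm_zero, sq, zero_mul]
  set W := W₀.extendOfNorm (R.compactlySupportedVectors I).subtype
  have hW : ∀ ξ : R.compactlySupportedVectors I, W (ξ : R.H) = W₀ ξ := fun ξ =>
    LinearMap.extendOfNorm_eq hd ⟨_, hbound⟩ ξ
  have hWae : ∀ ξ ∈ R.compactlySupportedVectors I, ∀ᵐ t ∂μ, W ξ t = R.component I ξ t :=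
    fun ξ hξ => by
      rw [hW ⟨ξ, hξ⟩]
      exact hW₀ ⟨ξ, hξ⟩
  have hdense := R.dense_compactlySupportedVectors hA₀ hdisj
  refine ⟨W, fun a ξ => ?_, fun s ξ => ?_, fun η hη t ζ => ?_⟩
  · refine hdense.induction (P := fun ξ => W (R.rep a ξ) = pointwiseRep (R.essentialRep I) a (W ξ))
      (fun ξ hξ => ?_) (isClosed_eq (W.continuous.comp (R.rep a).continuous)
        ((pointwiseRep (R.essentialRep I) a).continuous.comp W.continuous)) ξ
    refine Lp.ext ?_
    filter_upwards [hWae _ (R.rep_mem_compactlySupportedVectors I a hξ), hWae _ hξ,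
      pointwiseRep_ae (R.essentialRep I) a (W ξ)] with t h1 h2 h3
    rw [h1, h3, h2, component_rep]
  · refine hdense.induction (P := fun ξ => W (R.U s ξ) = leftTranslation s (W ξ))
      (fun ξ hξ => ?_) (isClosed_eq (W.continuous.comp (R.U s).continuous)
        ((leftTranslation s).continuous.comp W.continuous)) ξ
    refine Lp.ext ?_
    have h := (measurePreserving_mul_left μ s⁻¹).quasiMeasurePreserving.ae (hWae _ hξ)
    filter_upwards [hWae _ (R.U_mem_compactlySupportedVectors I s hξ), h,
      leftTranslation_ae s (W ξ)] with t h1 h2 h3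
    rw [h1, h3, h2, component_U]
  · -- for `ξ` in the domain of `W₀`, the integral of `⟪U_t ζ, ξ⟫` over a compact set `N` is the
    -- inner product of `W ξ` with the constant function `ζ` on `N`; this identity extends by
    -- continuity
    have hint : ∀ ξ N, IsCompact N → IntegrableOn (fun t => ⟪R.U t ζ, ξ⟫_ℂ) N μ := fun ξ N hN =>
      ((R.continuous_U ζ).inner continuous_const).continuousOn.integrableOn_compact hN
    refine eq_zero_of_forall_setIntegral_isCompact_eq_zero (μ := μ)
      (g := fun t => ⟪R.U t ζ, η⟫_ℂ) ((R.continuous_U ζ).inner continuous_const) (fun N hN => ?_) t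
    have hUi : IntegrableOn (fun t => R.U t (ζ : R.H)) N μ :=
      (R.continuous_U ζ).continuousOn.integrableOn_compact hN
    have hNfin : μ N ≠ ∞ := hN.measure_lt_top.ne
    have hflip : ∀ ξ, ∫ t in N, ⟪R.U t ζ, ξ⟫_ℂ ∂μ = ⟪∫ t in N, R.U t (ζ : R.H) ∂μ, ξ⟫_ℂ := by
      intro ξ
      rw [← inner_conj_symm, ← integral_inner hUi, ← integral_conj]
      simp only [inner_conj_symm]
    have key : ⟪indicatorConstLp 2 hN.measurableSet hNfin ζ, W η⟫_ℂ =
        ⟪∫ t in N, R.U t (ζ : R.H) ∂μ, η⟫_ℂ := by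
      refine hdense.induction (P := fun ξ => ⟪indicatorConstLp 2 hN.measurableSet hNfin ζ, W ξ⟫_ℂ =
        ⟪∫ t in N, R.U t (ζ : R.H) ∂μ, ξ⟫_ℂ) (fun ξ hξ => ?_)
        (isClosed_eq (continuous_const.inner W.continuous)
          (continuous_const.inner continuous_id)) η
      rw [L2.inner_indicatorConstLp_eq_setIntegral_inner, ← hflip]
      refine setIntegral_congr_ae hN.measurableSet ?_
      filter_upwards [hWae _ hξ] with t ht _
      rw [ht, inner_component]
    rw [hflip, ← key, hη, inner_zero_right]

/-- A lower bound in the representation which is induced from the essential subspace of an ideal is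
a lower bound on the translates of the essential subspace, which are contained in the closure of
the range of the adjoint of the intertwiner `W`. -/
theorem negPart_apply_U_apply_eq_zero {J : NonUnitalStarSubalgebra ℂ A}
    {T : CovariantFamilies G A} (hT : IsSelfAdjoint T) (hTJ : T - 1 ∈ crossedProductOf G J) {c : ℝ}
    (hE : Nontrivial (essentialSubspace R.rep I))
    (hc : (c : ℂ) • (1 : L2Haar G (essentialSubspace R.rep I) →L[ℂ] _) ≤
      inducedHom G (R.essentialRep I) hE T) (t : G) (ζ : essentialSubspace R.rep I) :
    (R.eval T - (c : ℂ) • (1 : R.H →L[ℂ] R.H))⁻ (R.U t ζ) = 0 := by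
  obtain ⟨W, hW1, hW2, hW3⟩ := R.exists_intertwiner_inducedRep hA₀ hdisj
  set B := (R.eval T - (c : ℂ) • (1 : R.H →L[ℂ] R.H))⁻ with hB
  have hadj := CovariantRep.adjoint_intertwines (R₁ := R)
    (R₂ := inducedRep G (R.essentialRep I) hE) (X := W) hW1 hW2
  have h1 := CovariantRep.eval_comp (R₁ := inducedRep G (R.essentialRep I) hE) (R₂ := R)
    hadj.1 hadj.2 J hTJ
  have h2 : R.eval T ∘L W.adjoint = W.adjoint ∘L inducedHom G (R.essentialRep I) hE T := by
    rw [map_sub, map_sub, map_one, map_one] at h1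
    ext1 φ
    have h' : W.adjoint (inducedHom G (R.essentialRep I) hE T φ) - W.adjoint φ =
        R.eval T (W.adjoint φ) - W.adjoint φ :=
      (map_sub W.adjoint _ _).symm.trans (DFunLike.congr_fun h1 φ)
    exact (sub_left_injective h').symm
  have h3 : B ∘L W.adjoint = 0 := negPart_comp_eq_zero (hT.map R.eval) hc h2
  have hBsa : IsSelfAdjoint B := .of_nonneg (CFC.negPart_nonneg _)
  have h4 : ∀ ξ, W (B ξ) = 0 := by
    intro ξ
    refine ext_inner_left ℂ fun φ => ?_
    rw [← ContinuousLinearMap.adjoint_inner_left, ← hBsa.star_eq,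
      ContinuousLinearMap.star_eq_adjoint, ContinuousLinearMap.adjoint_inner_right,
      inner_zero_right]
    have := DFunLike.congr_fun h3 φ
    rw [ContinuousLinearMap.comp_apply, zero_apply] at this
    rw [this, inner_zero_left]
  refine ext_inner_right ℂ fun ξ => ?_
  rw [inner_zero_left, ← hBsa.star_eq, ContinuousLinearMap.star_eq_adjoint,
    ContinuousLinearMap.adjoint_inner_left]
  exact hW3 _ (h4 ξ) t ζ

end CovariantRep

end Decomposition

/-! ### Uniform lower bounds in all covariant representations -/

section UniformBound

variable {G : Type u} {A : Type v} [Group G] [TopologicalSpace G] [IsTopologicalGroup G]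
  [LocallyCompactSpace G] [MeasurableSpace G] [BorelSpace G]
  [CStarAlgebra A] [MulSemiringAction G A]

/-- The crossed product of an ideal annihilates the vectors which the ideal annihilates. -/
theorem CovariantRep.eval_apply_eq_zero (R : CovariantRep G A) {J : NonUnitalStarSubalgebra ℂ A}
    (hJinv : ∀ t : G, ∀ a ∈ J, t • a ∈ J) {z : CovariantFamilies G A}
    (hz : z ∈ crossedProductOf G J) {ξ : R.H} (hξ : ∀ a ∈ J, R.rep a ξ = 0) : R.eval z ξ = 0 := by
  let S : NonUnitalStarSubalgebra ℂ (CovariantFamilies G A) :=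
    { carrier := {z | R.eval z ξ = 0 ∧ R.eval (star z) ξ = 0}
      zero_mem' := by simp
      add_mem' := by
        rintro a b ⟨h1, h2⟩ ⟨h3, h4⟩
        simp only [Set.mem_ofPred_eq, star_add, map_add, add_apply, h1, h2, h3, h4, add_zero,
          and_self]
      smul_mem' := by
        rintro c a ⟨h1, h2⟩
        simp only [Set.mem_ofPred_eq, star_smul, map_smul, smul_apply, h1, h2, smul_zero,
          and_self]
      mul_mem' := by
        rintro a b ⟨h1, h2⟩ ⟨h3, h4⟩
        constructor
        · rw [map_mul, mul_apply_eq_comp, h3, map_zero]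
        · rw [star_mul, map_mul, mul_apply_eq_comp, h2, map_zero]
      star_mem' := by
        rintro a ⟨h1, h2⟩
        exact ⟨h2, by rwa [star_star]⟩ }
  have hS : IsClosed (S : Set (CovariantFamilies G A)) :=
    IsClosed.inter
      (isClosed_eq (R.continuous_eval.clm_apply continuous_const) continuous_const)
      (isClosed_eq ((R.continuous_eval.comp continuous_star).clm_apply continuous_const)
        continuous_const)
  have hle : crossedProductOf G J ≤ S := by
    refine NonUnitalStarSubalgebra.topologicalClosure_minimal _
      (NonUnitalStarAlgebra.adjoin_le ?_) hS
    rintro _ ⟨f, hf, rfl⟩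
    constructor
    · rw [CovariantRep.eval_universalRep_apply]
      refine integral_eq_zero_of_ae (Eventually.of_forall fun s => ?_)
      have h1 := R.covariant s (s⁻¹ • f s) ξ
      rw [hξ _ (hJinv _ _ (hf s)), map_zero, smul_smul, mul_inv_cancel, one_smul] at h1
      exact h1.symm
    · refine ext_inner_right ℂ fun η => ?_
      rw [map_star, ContinuousLinearMap.star_eq_adjoint, ContinuousLinearMap.adjoint_inner_left,
        CovariantRep.eval_universalRep_apply, ← integral_inner (R.integrable_integrand f η),
        inner_zero_left]
      refine integral_eq_zero_of_ae (Eventually.of_forall fun s => ?_)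
      change ⟪ξ, R.rep (f s) (R.U s η)⟫_ℂ = 0
      rw [← star_star (f s), ← inner_starAlgHom_apply_left, hξ _ (star_mem (hf s)),
        inner_zero_left]
  exact (hle hz).1

/-- A vector on which `A` acts as the identity is in the kernel of the negative part of `A - c`, for
`c ≤ 1`. -/
theorem negPart_apply_eq_zero_of_apply_eq {H : Type*} [NormedAddCommGroup H]
    [InnerProductSpace ℂ H] [CompleteSpace H] {A : H →L[ℂ] H} (hA : IsSelfAdjoint A) {c : ℝ}
    (hc : c ≤ 1) {ξ : H} (hξ : A ξ = ξ) : (A - (c : ℂ) • (1 : H →L[ℂ] H))⁻ ξ = 0 := by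
  have h1 : (c : ℂ) • (1 : ℂ →L[ℂ] ℂ) ≤ 1 := by
    rw [smul_one_le_iff_of_isSelfAdjoint (.one _)]
    intro x
    rw [one_apply_eq_self, inner_self_eq_norm_sq (𝕜 := ℂ)]
    nlinarith [sq_nonneg ‖x‖]
  -- a fixed vector of `A` is an intertwiner of `A` with the identity of `ℂ`
  have h2 := negPart_comp_eq_zero hA h1 (X := ContinuousLinearMap.toSpanSingleton ℂ ξ) (by
    ext
    simp [hξ])
  simpa using DFunLike.congr_fun h2 1

/-- A family which is bounded below uniformly in all covariant representations is invertible. -/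
theorem isUnit_of_forall_smul_one_le_eval {T : CovariantFamilies G A} {c : ℝ} (hc : 0 < c)
    (h : ∀ R : CovariantRep G A, (c : ℂ) • (1 : R.H →L[ℂ] R.H) ≤ R.eval T) : IsUnit T := by
  have hbound : ∀ (R : CovariantRep G A) ξ, ‖ξ‖ ≤ c⁻¹ * ‖R.eval T ξ‖ := by
    intro R ξ
    have h1 := (smul_one_le_iff_of_isSelfAdjoint (isSelfAdjoint_of_smul_one_le (h R)) c).1 (h R) ξ
    have h2 := (RCLike.re_le_norm _).trans (norm_inner_le_norm (𝕜 := ℂ) (R.eval T ξ) ξ)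
    rw [inv_mul_eq_div, le_div_iff₀ hc]
    rcases (norm_nonneg ξ).eq_or_lt with h0 | h0
    · rw [← h0, zero_mul]
      exact norm_nonneg _
    · refine le_of_mul_le_mul_right ?_ h0
      linarith
  have hu : ∀ R : CovariantRep G A, IsUnit (R.eval T) := fun R => by
    have hsa := isSelfAdjoint_of_smul_one_le (h R)
    have h1 : IsUnit ((c : ℂ) • (1 : R.H →L[ℂ] R.H)) :=
      (isUnit_one).smul (Units.mk0 (c : ℂ) (by exact_mod_cast hc.ne'))
    refine CStarAlgebra.isUnit_of_le _ (h R) ⟨?_, h1⟩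
    rw [show (0 : R.H →L[ℂ] R.H) = ((0 : ℝ) : ℂ) • 1 by simp,
      smul_one_le_iff_of_isSelfAdjoint (isSelfAdjoint_ofReal_smul_one c)]
    intro x
    rw [smul_apply, one_apply_eq_self, inner_smul_left, Complex.conj_ofReal,
      inner_self_eq_norm_sq_to_K, zero_mul]
    change 0 ≤ ((c : ℂ) * (‖x‖ : ℂ) ^ 2).re
    rw [← Complex.ofReal_pow, ← Complex.ofReal_mul, Complex.ofReal_re]
    positivity
  choose S hS using hu
  have hinv : ∀ R : CovariantRep G A, ‖((S R)⁻¹ : (R.H →L[ℂ] R.H)ˣ).val‖ ≤ c⁻¹ := by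
    intro R
    refine ContinuousLinearMap.opNorm_le_bound _ (by positivity) fun ξ => ?_
    refine (hbound R _).trans_eq ?_
    rw [← hS, ← mul_apply_eq_comp, Units.mul_inv, one_apply_eq_self]
  let Q : CovariantFamilies G A := ⟨fun R => ((S R)⁻¹ : (R.H →L[ℂ] R.H)ˣ).val,
    memℓp_infty ⟨c⁻¹, by rintro _ ⟨R, rfl⟩; exact hinv R⟩⟩
  refine isUnit_iff_exists.2 ⟨Q, ?_, ?_⟩
  · refine lp.ext (funext fun R => ?_)
    change R.eval T * ((S R)⁻¹ : (R.H →L[ℂ] R.H)ˣ).val = 1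
    rw [← hS, Units.mul_inv]
  · refine lp.ext (funext fun R => ?_)
    change ((S R)⁻¹ : (R.H →L[ℂ] R.H)ˣ).val * R.eval T = 1
    rw [← hS, Units.inv_mul]

variable [T2Space G] [SMulCommClass G ℂ A] [StarSMul G A] [ContinuousSMul G A]
  {H₀ : Type v} [NormedAddCommGroup H₀] [InnerProductSpace ℂ H₀]
  [CompleteSpace H₀] {X : Type*} [TopologicalSpace X] {J : NonUnitalStarSubalgebra ℂ A}
  {Φ : J ≃⋆ₐ[ℂ] C₀(X, compactOperators H₀)} [IsClosed (J : Set A)] [MulAction G X]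

/-- Lower bounds for `T ∈ 1 + G ⋉ J` in the representations induced from those which are supported
in the members of a family of relatively compact open sets, whose translates cover the base space,
are lower bounds in all covariant representations. -/
theorem CovariantRep.smul_one_le_eval [T2Space X] [NormalSpace X] [Nontrivial H₀]
    [ContinuousConstSMul G X]
    (hJ : ∀ a ∈ J, ∀ x : A, x * a ∈ J ∧ a * x ∈ J)
    (hprop : IsProperAction G X) (hJinv : ∀ t : G, ∀ a ∈ J, t • a ∈ J)
    (hinv : ∀ (t : G) (x : X) (a : J), ‖evalAt Φ x ⟨t • a, hJinv t a a.2⟩‖ = ‖evalAt Φ (t • x) a‖)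
    {T : CovariantFamilies G A} (hT : IsSelfAdjoint T) (hTJ : T - 1 ∈ crossedProductOf G J)
    {c : ℝ} (hc1 : c ≤ 1) {ι : Type*} {U N : ι → Set X} (hU : ∀ i, IsOpen (U i))
    (hN : ∀ i, IsCompact (N i)) (hUN : ∀ i, U i ⊆ N i) (hcov : ∀ x : X, ∃ i, ∃ t : G, t • x ∈ U i)
    (hc : ∀ (i : ι) (E : Type (max u v)) [NormedAddCommGroup E] [InnerProductSpace ℂ E]
      [CompleteSpace E] (hE : Nontrivial E) (ρ : A →⋆ₐ[ℂ] (E →L[ℂ] E)),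
      IsSupportedIn Φ ρ (U i) →
      (c : ℂ) • (1 : L2Haar G E →L[ℂ] L2Haar G E) ≤ inducedHom G ρ hE T)
    (R : CovariantRep G A) : (c : ℂ) • (1 : R.H →L[ℂ] R.H) ≤ R.eval T := by
  set B := (R.eval T - (c : ℂ) • (1 : R.H →L[ℂ] R.H))⁻ with hB
  have hsa : IsSelfAdjoint (R.eval T) := hT.map R.eval
  have hess : ∀ i t, ∀ ζ ∈ essentialSubspace R.rep (idealOn Φ hJ (U i)), B (R.U t ζ) = 0 := by
    intro i t ζ hζ
    rcases subsingleton_or_nontrivial (essentialSubspace R.rep (idealOn Φ hJ (U i))) with hE | hE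
    · have : (⟨ζ, hζ⟩ : essentialSubspace R.rep (idealOn Φ hJ (U i))) = 0 := Subsingleton.elim _ _
      rw [show ζ = 0 from congrArg Subtype.val this, map_zero, map_zero]
    · refine R.negPart_apply_U_apply_eq_zero (hprop _ (hN i)) (fun r hr a ha b hb => ?_) hT hTJ hE
        (hc i _ hE _ ?_) t ⟨ζ, hζ⟩
      · obtain ⟨haJ, ha0⟩ := (mem_idealOn Φ hJ (U i) a).1 ha
        obtain ⟨hbJ, hb0⟩ := (mem_idealOn Φ hJ (U i) b).1 hb
        have : star (⟨b, hbJ⟩ : J) * ⟨r • a, hJinv r a haJ⟩ = 0 := by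
          refine eq_of_evalAt_eq Φ fun x => ?_
          rw [map_mul, map_star, map_zero]
          by_cases hx : x ∈ U i
          · have hrx : r • x ∉ U i := fun h => hr ⟨x, hUN i hx, hUN i h⟩
            have h1 := hinv r x ⟨a, haJ⟩
            rw [(evalAt_eq_zero Φ _ _).2 (ha0 _ hrx), norm_zero, norm_eq_zero] at h1
            rw [h1, mul_zero]
          · rw [(evalAt_eq_zero Φ _ _).2 (hb0 _ hx), star_zero, zero_mul]
        exact congrArg Subtype.val this
      · refine top_unique ((dense_subrepresentation_essentialSubspace R.rep
          (idealOn Φ hJ (U i))).symm.le.trans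
          (Submodule.topologicalClosure_mono (Submodule.span_mono ?_)))
        rintro _ ⟨a, ha, ξ, rfl⟩
        obtain ⟨haJ, ha0⟩ := (mem_idealOn Φ hJ (U i) a).1 ha
        exact ⟨⟨a, haJ⟩, fun y hy => (evalAt_eq_zero Φ _ _).2 (ha0 y hy), ξ, rfl⟩
  -- decompose `a` into sections which are supported in translates of the sets `U i`
  have hrep : ∀ (a : J) ξ, B (R.rep a ξ) = 0 := by
    intro a ξ
    rw [← norm_le_zero_iff]
    refine le_of_forall_pos_le_add fun ε hε => ?_
    have hδ : 0 < ε / (‖B‖ * ‖ξ‖ + 1) := by positivity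
    obtain ⟨t, b, hb, hab⟩ := exists_sum_supported Φ (fun p : ι × G => (fun x => p.2 • x) ⁻¹' U p.1)
      (fun p => (hU p.1).preimage (continuous_const_smul p.2))
      (Set.eq_univ_of_forall fun x => by
        obtain ⟨i, t, h⟩ := hcov x
        exact Set.mem_iUnion.2 ⟨(i, t), h⟩) a hδ
    have hb0 : ∀ i : t, B (R.rep (b i) ξ) = 0 := by
      intro i
      have hmem : (i.1.2⁻¹ • (b i : A)) ∈ idealOn Φ hJ (U i.1.1) := by
        refine (mem_idealOn Φ hJ _ _).2 ⟨hJinv _ _ (b i).2, fun x hx => ?_⟩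
        rw [← evalAt_eq_zero, ← norm_eq_zero, hinv, norm_eq_zero]
        refine hb i _ fun h => hx ?_
        rw [Set.mem_preimage, smul_inv_smul] at h
        exact h
      have h1 := R.covariant i.1.2 (i.1.2⁻¹ • (b i : A)) (R.U i.1.2⁻¹ ξ)
      rw [smul_inv_smul, CovariantRep.U_apply_U_inv_apply] at h1
      rw [← h1]
      exact hess i.1.1 i.1.2 _ (apply_mem_essentialSubspace R.rep hmem _)
    have h2 : B (R.rep a ξ) = B (R.rep ((a - ∑ i, b i : J) : A) ξ) := by
      have h3 : ((a - ∑ i, b i : J) : A) = a - ∑ i, (b i : A) := by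
        rw [AddSubgroupClass.coe_sub, AddSubmonoidClass.coe_finsetSum]
      rw [h3, map_sub, map_sum, sub_apply, map_sub, sum_apply, map_sum, Finset.sum_congr rfl
        fun i _ => hb0 i, Finset.sum_const_zero, sub_zero]
    rw [h2, zero_add]
    calc ‖B (R.rep ((a - ∑ i, b i : J) : A) ξ)‖ ≤ ‖B‖ * (ε / (‖B‖ * ‖ξ‖ + 1) * ‖ξ‖) := by
          refine B.le_opNorm_of_le ?_
          exact ContinuousLinearMap.le_of_opNorm_le _ ((R.norm_rep_le _).trans hab) _
      _ = ε * (‖B‖ * ‖ξ‖) / (‖B‖ * ‖ξ‖ + 1) := by ring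
      _ ≤ ε := by
          rw [div_le_iff₀ (by positivity)]
          nlinarith
  refine smul_one_le_of_negPart_eq_zero hsa
    (s := {x | (∃ (a : J) (ξ : R.H), R.rep a ξ = x) ∨ ∀ a ∈ J, R.rep a x = 0}) ?_ ?_
  · rw [Submodule.topologicalClosure_eq_top_iff, Submodule.eq_bot_iff]
    intro η hη
    have h1 : ∀ a ∈ J, R.rep a η = 0 := by
      intro a ha
      refine ext_inner_left ℂ fun ξ => ?_
      rw [inner_zero_right, ← star_star a, ← inner_starAlgHom_apply_left]
      exact (Submodule.mem_orthogonal _ _).1 hη _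
        (Submodule.subset_span (.inl ⟨⟨star a, star_mem ha⟩, ξ, rfl⟩))
    exact inner_self_eq_zero.1 ((Submodule.mem_orthogonal _ _).1 hη _
      (Submodule.subset_span (.inr h1)))
  · rintro x (⟨a, ξ, rfl⟩ | hx)
    · exact hrep a ξ
    · refine negPart_apply_eq_zero_of_apply_eq hsa hc1 ?_
      have h1 := R.eval_apply_eq_zero hJinv hTJ hx
      rw [map_sub, map_one, sub_apply, one_apply_eq_self, sub_eq_zero] at h1
      exact h1

end UniformBound

/-! ### The action on the spectrum and its orbit space -/

section SpectrumAction

variable {G : Type u} {A : Type v} [CommGroup G] [CStarAlgebra A] [MulSemiringAction G A]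
  [SMulCommClass G ℂ A] [StarSMul G A]

theorem CStarSpectrum.smul_mk (t : G) {H : Type v} [NormedAddCommGroup H] [InnerProductSpace ℂ H]
    [CompleteSpace H] (π : A →⋆ₐ[ℂ] (H →L[ℂ] H)) (hπ : IsIrreducibleRep π) :
    t • CStarSpectrum.mk π hπ = CStarSpectrum.mk (π.comp (actionHom t)) (hπ.comp_actionHom t) :=
  rfl

/-- The group acts by homeomorphisms on the spectrum, because it permutes the ideals of `A`. -/
instance : ContinuousConstSMul G (CStarSpectrum A) where
  continuous_const_smul t := by
    refine continuous_def.2 ?_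
    rintro _ ⟨I, rfl⟩
    refine ⟨I.comap (actionHom t⁻¹ : A →⋆ₐ[ℂ] A), Set.ext ?_⟩
    rintro ⟨σ⟩
    constructor
    · rintro ⟨a, ha, ha0⟩
      refine ⟨t • a, ?_, ha0⟩
      refine (TwoSidedIdeal.mem_comap _).2 ?_
      change t⁻¹ • t • a ∈ I
      rwa [inv_smul_smul]
    · rintro ⟨a, ha, ha0⟩
      refine ⟨t⁻¹ • a, (TwoSidedIdeal.mem_comap _).1 ha, ?_⟩
      change σ.rep (t • t⁻¹ • a) ≠ 0
      rwa [smul_inv_smul]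

instance (Y : SubMulAction G (CStarSpectrum A)) : ContinuousConstSMul G Y where
  continuous_const_smul t :=
    ((continuous_const_smul t).comp continuous_subtype_val).subtype_mk _

end SpectrumAction

/-- If the orbit space is compact, then finitely many sets of a family of neighbourhoods of all
points suffice to reach every orbit. -/
theorem exists_finset_forall_exists_smul_mem {G X : Type*} [Group G] [TopologicalSpace X]
    [MulAction G X] [ContinuousConstSMul G X] [CompactSpace (MulAction.orbitRel.Quotient G X)]
    {U : X → Set X} (hU : ∀ x, IsOpen (U x)) (hx : ∀ x, x ∈ U x) :
    ∃ s : Finset X, ∀ x, ∃ y ∈ s, ∃ t : G, t • x ∈ U y := by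
  let q : X → MulAction.orbitRel.Quotient G X := Quotient.mk _
  have hq : IsOpenMap q := isOpenMap_quotient_mk'_mul
  obtain ⟨s, hs⟩ := isCompact_univ.elim_finite_subcover (fun y => q '' U y)
    (fun y => hq _ (hU y)) (by
      intro z _
      obtain ⟨x, rfl⟩ := Quotient.exists_rep z
      exact Set.mem_iUnion.2 ⟨x, x, hx x, rfl⟩)
  refine ⟨s, fun x => ?_⟩
  obtain ⟨y, hy, z, hz, hzx⟩ := Set.mem_iUnion₂.1 (hs (Set.mem_univ (q x)))
  obtain ⟨t, ht⟩ := Quotient.exact hzx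
  exact ⟨y, hy, t, by rwa [show t • x = z from ht]⟩

theorem norm_eq_of_intertwines {H K : Type*} [NormedAddCommGroup H] [InnerProductSpace ℂ H]
    [NormedAddCommGroup K] [InnerProductSpace ℂ K] {S : H →L[ℂ] H} {T : K →L[ℂ] K}
    (W : H ≃ₗᵢ[ℂ] K) (hW : ∀ ξ, W (S ξ) = T (W ξ)) : ‖S‖ = ‖T‖ := by
  refine le_antisymm (S.opNorm_le_bound (norm_nonneg _) fun ξ => ?_)
    (T.opNorm_le_bound (norm_nonneg _) fun ξ => ?_)
  · rw [← W.norm_map, hW, ← W.norm_map ξ]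
    exact T.le_opNorm _
  · rw [← W.apply_symm_apply ξ, ← hW, W.norm_map, W.norm_map]
    exact S.le_opNorm _

/-- The base space is locally compact if at every point some section does not vanish, since the sets
where the norm of a section is at least `ε > 0` are compact. -/
theorem locallyCompactSpace_of_trivialization {M H₀ : Type v} [CStarAlgebra M]
    [NormedAddCommGroup H₀] [InnerProductSpace ℂ H₀] [CompleteSpace H₀] {X : Type*}
    [TopologicalSpace X] [T2Space X] {J : NonUnitalStarSubalgebra ℂ M}
    (Φ : J ≃⋆ₐ[ℂ] C₀(X, compactOperators H₀)) (h : ∀ x, ∃ a, Φ a x ≠ 0) :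
    LocallyCompactSpace X := by
  have : WeaklyLocallyCompactSpace X := ⟨fun x => by
    obtain ⟨a, ha⟩ := h x
    rw [Ne, ← evalAt_eq_zero, ← Ne, ← norm_pos_iff] at ha
    refine ⟨_, isCompact_setOf_le_norm_evalAt Φ a (half_pos ha), ?_⟩
    filter_upwards [((continuous_evalAt Φ a).norm.tendsto x).eventually_const_lt (half_lt_self ha)]
      with y hy using hy.le⟩
  infer_instance

section LowerBound

variable {G : Type u} {A : Type v} [Group G] [TopologicalSpace G] [IsTopologicalGroup G]
  [LocallyCompactSpace G] [MeasurableSpace G] [BorelSpace G]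
  [CStarAlgebra A] [MulSemiringAction G A]

theorem CovariantRep.exists_smul_one_le_eval (R : CovariantRep G A)
    (v : crossedProductUnitization G A) (hinj : Function.Injective (R.extend v))
    (hcl : IsClosed (Set.range (R.extend v))) : ∃ c : ℝ, 0 < c ∧ (c : ℂ) • (1 : R.H →L[ℂ] R.H) ≤
      R.eval ((star v * v : crossedProductUnitization G A) : CovariantFamilies G A) :=
  exists_smul_one_le_adjoint_comp hinj hcl

/-- An element with a right inverse is surjective in every covariant representation. -/
theorem CovariantRep.surjective_extend (R : CovariantRep G A)
    {v w : crossedProductUnitization G A} (h : v * w = 1) : Function.Surjective (R.extend v) :=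
  fun φ => by
    have h1 := congrArg R.extend h
    rw [map_mul, map_one] at h1
    exact ⟨_, DFunLike.congr_fun h1 φ⟩

end LowerBound

/-! ### Isometries from polar decomposition -/

section Isometry

variable {A : Type*} [CStarAlgebra A]

/-- The isometry in the polar decomposition of an element `v` with `v* v` invertible. The
invertibility keeps the spectrum away from zero, where `x ^ (-1/2)` is not continuous. -/
theorem star_mul_self_of_isUnit {v : A} (hu : IsUnit (star v * v)) :
    star (v * cfc (fun x : ℝ => x ^ (-(1 / 2) : ℝ)) (star v * v)) *
      (v * cfc (fun x : ℝ => x ^ (-(1 / 2) : ℝ)) (star v * v)) = 1 := by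
  set a := star v * v with ha
  have hsa : IsSelfAdjoint a := .star_mul_self v
  have hpos : ∀ x ∈ spectrum ℝ a, 0 < x := fun x hx =>
    (spectrum_star_mul_self_nonneg x hx).lt_of_ne fun h =>
      spectrum.zero_notMem ℝ hu (by rwa [← h] at hx)
  have hcont : ContinuousOn (fun x : ℝ => x ^ (-(1 / 2) : ℝ)) (spectrum ℝ a) := fun x hx =>
    (Real.continuousAt_rpow_const _ _ (.inl (hpos x hx).ne')).continuousWithinAt
  have hf : IsSelfAdjoint (cfc (fun x : ℝ => x ^ (-(1 / 2) : ℝ)) a) := cfc_predicate _ a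
  rw [star_mul, hf.star_eq, mul_assoc, ← mul_assoc (star v), ← ha]
  nth_rw 2 [← cfc_id ℝ a]
  rw [← cfc_mul _ _ a continuousOn_id hcont, ← cfc_mul _ (fun x => id x * x ^ (-(1 / 2) : ℝ)) a
    hcont (continuousOn_id.mul hcont), ← cfc_one ℝ a]
  refine cfc_congr fun x hx => ?_
  have h1 : x ^ (-(1 / 2) : ℝ) * x ^ (-(1 / 2) : ℝ) = x⁻¹ := by
    rw [← Real.rpow_add (hpos x hx), ← Real.rpow_neg_one]
    norm_num
  simp only [id, Pi.one_apply]
  rw [mul_left_comm, h1, mul_inv_cancel₀ (hpos x hx).ne']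

end Isometry

/-! ### Invertibility of elements that are bounded below in the regular representations -/

/-- An element `T ∈ 1 + G ⋉ J` which is bounded below in the regular representations for all points
of the spectrum of `J` is invertible. -/
theorem isUnit_of_forall_smul_one_le_regularRep {G : Type u} {M H₀ : Type v}
    [CommGroup G] [TopologicalSpace G] [IsTopologicalGroup G] [LocallyCompactSpace G]
    [T2Space G] [MeasurableSpace G] [BorelSpace G]
    [CStarAlgebra M] [MulSemiringAction G M] [SMulCommClass G ℂ M] [StarSMul G M]
    [ContinuousSMul G M]
    [NormedAddCommGroup H₀] [InnerProductSpace ℂ H₀] [CompleteSpace H₀]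
    {Y : SubMulAction G (CStarSpectrum M)} [MetrizableSpace Y] (hYproper : IsProperAction G Y)
    [CompactSpace (MulAction.orbitRel.Quotient G Y)] [Nontrivial H₀]
    {J : NonUnitalStarSubalgebra ℂ M} [IsClosed (J : Set M)]
    (hJideal : ∀ a ∈ J, ∀ x : M, x * a ∈ J ∧ a * x ∈ J)
    (hJinv : ∀ t : G, ∀ a ∈ J, t • a ∈ J)
    (hJY : (Y : Set (CStarSpectrum M)) = CStarSpectrum.nonvanishing (J : Set M))
    (Φ₀ : J ≃⋆ₐ[ℂ] C₀(Y, compactOperators H₀))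
    {π : Y → (M →⋆ₐ[ℂ] (H₀ →L[ℂ] H₀))} (hπ : ∀ y, IsIrreducibleRep (π y))
    (hπY : ∀ y, CStarSpectrum.mk (π y) (hπ y) = y) {T : CovariantFamilies G M}
    (hT : IsSelfAdjoint T) (hTJ : T - 1 ∈ crossedProductOf G J) {c : Y → ℝ} (hc0 : ∀ y, 0 < c y)
    (hc : ∀ y, ((c y : ℝ) : ℂ) •
      (1 : (regularRep G (π y) (hπ y).1).H →L[ℂ] (regularRep G (π y) (hπ y).1).H) ≤
        (regularRep G (π y) (hπ y).1).eval T) : IsUnit T := by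
  obtain ⟨Φ, hΦ⟩ := exists_adapted_trivialization Φ₀ hJideal
    (ι := (Subtype.val : Y → CStarSpectrum M)) Topology.IsEmbedding.subtypeVal
    (by rw [← hJY]; exact Subtype.range_coe) π hπ hπY
  have hnorm : ∀ (y : Y) (a : J), ‖evalAt Φ y a‖ = ‖π y a‖ := fun y a => by
    obtain ⟨W, hW⟩ := hΦ y
    exact norm_eq_of_intertwines W (hW a)
  have hne : ∀ y, ∃ a, Φ a y ≠ 0 := by
    intro y
    have h1 : (y : CStarSpectrum M) ∈ CStarSpectrum.nonvanishing (J : Set M) := hJY ▸ y.2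
    rw [← hπY, CStarSpectrum.mk_mem_nonvanishing] at h1
    obtain ⟨a, ha, ha0⟩ := h1
    refine ⟨⟨a, ha⟩, ?_⟩
    rwa [Ne, ← evalAt_eq_zero, ← norm_eq_zero, hnorm, norm_eq_zero]
  have hloc : LocallyCompactSpace Y := locallyCompactSpace_of_trivialization Φ hne
  -- `π (t • y)` and `π y ∘ t` are equivalent by the definition of the action on the spectrum
  have hinv : ∀ (t : G) (y : Y) (a : J),
      ‖evalAt Φ y ⟨t • a, hJinv t a a.2⟩‖ = ‖evalAt Φ (t • y) a‖ := by
    intro t y a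
    have h1 : CStarSpectrum.mk (π (t • y)) (hπ (t • y)) =
        CStarSpectrum.mk ((π y).comp (actionHom t)) ((hπ y).comp_actionHom t) := by
      rw [hπY, ← CStarSpectrum.smul_mk t (π y) (hπ y), hπY]
      rfl
    obtain ⟨W, hW⟩ := CStarSpectrum.exists_linearIsometryEquiv_of_mk_eq h1
    rw [hnorm, hnorm]
    exact (norm_eq_of_intertwines W (hW a)).symm
  have hlocal : ∀ y : Y, ∃ U N : Set Y, IsOpen U ∧ y ∈ U ∧ IsCompact N ∧ U ⊆ N ∧
      ∀ (E : Type (max u v)) [NormedAddCommGroup E] [InnerProductSpace ℂ E]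
      [CompleteSpace E] (hE : Nontrivial E) (ρ : M →⋆ₐ[ℂ] (E →L[ℂ] E)), IsSupportedIn Φ ρ U →
      ((c y / 2 : ℝ) : ℂ) • (1 : L2Haar G E →L[ℂ] L2Haar G E) ≤ inducedHom G ρ hE T := by
    intro y
    obtain ⟨W, hW⟩ := hΦ y
    obtain ⟨O, hO, h⟩ := exists_nhds_smul_one_le_inducedHom hJideal hYproper hJinv hinv hT hTJ
      (hne y) hW (hπ y).1 (hc y) (half_pos (hc0 y))
    obtain ⟨N, hN, hNy⟩ := exists_compact_mem_nhds y
    refine ⟨interior (O ∩ N), N, isOpen_interior,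
      mem_interior_iff_mem_nhds.2 (inter_mem hO hNy), hN,
      interior_subset.trans Set.inter_subset_right, fun E _ _ _ hE ρ hρ => ?_⟩
    have h1 := h E hE ρ (hρ.mono (interior_subset.trans Set.inter_subset_left))
    rwa [sub_half] at h1
  choose U N hU hyU hN hUN hUc using hlocal
  obtain ⟨s, hs⟩ := exists_finset_forall_exists_smul_mem (G := G) hU hyU
  -- the condition `d ≤ 1` is for the vectors annihilated by `J`, on which `T` is the identity
  obtain ⟨d, ⟨hds, hd1⟩, hd0⟩ : ∃ d : ℝ, ((∀ y ∈ s, d ≤ c y / 2) ∧ d ≤ 1) ∧ 0 < d := by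
    have h1 : ∀ᶠ d : ℝ in nhdsWithin 0 (Set.Ioi 0), (∀ y ∈ s, d ≤ c y / 2) ∧ d ≤ 1 := by
      refine Filter.Eventually.and ((Finset.eventually_all s).2 fun y _ => ?_) ?_
      · exact nhdsWithin_le_nhds (eventually_le_nhds (half_pos (hc0 y)))
      · exact nhdsWithin_le_nhds (eventually_le_nhds one_pos)
    exact (h1.and self_mem_nhdsWithin).exists
  have hbound : ∀ R : CovariantRep G M, (d : ℂ) • (1 : R.H →L[ℂ] R.H) ≤ R.eval T :=
    CovariantRep.smul_one_le_eval hJideal hYproper hJinv hinv hT hTJ hd1 (ι := s)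
      (U := fun i => U i) (N := fun i => N i) (fun i => hU i) (fun i => hN i) (fun i => hUN i)
      (fun x => by
        obtain ⟨y, hy, t, h⟩ := hs x
        exact ⟨⟨y, hy⟩, t, h⟩)
      (fun i E _ _ _ hE ρ hρ => by
        have h1 := hUc i E hE ρ hρ
        have hsa := isSelfAdjoint_of_smul_one_le h1
        rw [smul_one_le_iff_of_isSelfAdjoint hsa] at h1 ⊢
        intro x
        exact (mul_le_mul_of_nonneg_right (hds i i.2) (sq_nonneg _)).trans (h1 x))
  exact isUnit_of_forall_smul_one_le_eval hd0 hbound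

end

theorem proposition4p6 {G : Type u} {M H₀ : Type v}
    [CommGroup G] [TopologicalSpace G] [IsTopologicalGroup G] [LocallyCompactSpace G]
    [MetrizableSpace G] [MeasurableSpace G] [BorelSpace G]
    [CStarAlgebra M] [MulSemiringAction G M] [SMulCommClass G ℂ M] [StarSMul G M]
    [ContinuousSMul G M]
    [NormedAddCommGroup H₀] [InnerProductSpace ℂ H₀] [CompleteSpace H₀] [SeparableSpace H₀]
    -- the open invariant subset `Y` of the spectrum of `M`
    (Y : SubMulAction G (CStarSpectrum M)) (hYopen : IsOpen (Y : Set (CStarSpectrum M)))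
    (hYmetrizable : MetrizableSpace Y) (hYproper : IsProperAction G Y)
    (hYcompact : CompactSpace (MulAction.orbitRel.Quotient G Y))
    -- the closed two-sided invariant ideal `J` with spectrum `Y`
    (J : NonUnitalStarSubalgebra ℂ M) (hJclosed : IsClosed (J : Set M))
    (hJideal : ∀ a ∈ J, ∀ x : M, x * a ∈ J ∧ a * x ∈ J)
    (hJinv : ∀ t : G, ∀ a ∈ J, t • a ∈ J)
    (hJY : (Y : Set (CStarSpectrum M)) = CStarSpectrum.nonvanishing (J : Set M))
    (hJiso : Nonempty (J ≃⋆ₐ[ℂ] C₀(Y, compactOperators H₀)))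
    (hJnonunital : ¬ ∃ e ∈ J, ∀ a ∈ J, e * a = a ∧ a * e = a)
    -- for every `y ∈ Y`, the corresponding irreducible representation `π y` of `M` on `H₀`
    (π : Y → (M →⋆ₐ[ℂ] (H₀ →L[ℂ] H₀))) (hπ : ∀ y, IsIrreducibleRep (π y))
    (hπY : ∀ y, CStarSpectrum.mk (π y) (hπ y) = y)
    (v : crossedProductUnitization G M)
    (hv : ((star v * v : crossedProductUnitization G M) : CovariantFamilies G M) - 1 ∈
      crossedProductOf G J)
    (hv' : ((v * star v : crossedProductUnitization G M) : CovariantFamilies G M) - 1 ∈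
      crossedProductOf G J)
    (hreg : ∀ y : Y,
      Function.Injective ((regularRep G (π y) (hπ y).1).extend v) ∧
      IsClosed (Set.range ((regularRep G (π y) (hπ y).1).extend v)) ∧
      ¬ Function.Surjective ((regularRep G (π y) (hπ y).1).extend v)) :
    IsUnit (star v * v) ∧
      star (v * cfc (fun x : ℝ => x ^ (-(1 / 2) : ℝ)) (star v * v)) *
        (v * cfc (fun x : ℝ => x ^ (-(1 / 2) : ℝ)) (star v * v)) = 1 ∧
      (v * cfc (fun x : ℝ => x ^ (-(1 / 2) : ℝ)) (star v * v)) *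
        star (v * cfc (fun x : ℝ => x ^ (-(1 / 2) : ℝ)) (star v * v)) ≠ 1 := by
  have := hJclosed
  -- if `Y` were empty, then `J` would be zero, and `0` would be a unit of `J`
  have hYne : Nonempty Y := by
    by_contra hne
    rw [not_nonempty_iff] at hne
    obtain ⟨Φ⟩ := hJiso
    have h0 : ∀ a : J, a = 0 := fun a => eq_of_evalAt_eq Φ fun x => isEmptyElim x
    refine hJnonunital ⟨0, zero_mem J, fun a ha => ?_⟩
    rw [show a = 0 from congrArg Subtype.val (h0 ⟨a, ha⟩), mul_zero]
    exact ⟨rfl, rfl⟩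
  obtain ⟨y₀⟩ := hYne
  have hH₀ : Nontrivial H₀ := (hπ y₀).1
  obtain ⟨Φ⟩ := hJiso
  choose c hc0 hc using fun y : Y =>
    (regularRep G (π y) (hπ y).1).exists_smul_one_le_eval v (hreg y).1 (hreg y).2.1
  have hT : IsSelfAdjoint ((star v * v : crossedProductUnitization G M) : CovariantFamilies G M) :=
    .star_mul_self (v : CovariantFamilies G M)
  have hunit : IsUnit (star v * v) := (StarSubalgebra.coe_isUnit _).1
    (isUnit_of_forall_smul_one_le_regularRep hYproper hJideal hJinv hJY Φ hπ hπY hT hv hc0 hc)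
  -- if the isometry were unitary, then `v` would have a right inverse
  refine ⟨hunit, star_mul_self_of_isUnit hunit, fun h => ?_⟩
  rw [mul_assoc] at h
  exact (hreg y₀).2.2 ((regularRep G (π y₀) (hπ y₀).1).surjective_extend h)
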